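/- Let $d\ge 3$ be an integer, let $\frac{4}{(4d-3)(d-2)}<a<\frac1{(d-1)(d-2)}$, put $a_1:=\frac a2+\frac1{2(d-1)(d-2)}$ and $\mu_{\rm low}:=\frac{(d-1)a_1}2+\frac1{2(d-2)}$ (so that $\frac1d<\frac{3}{3d-5}<(d-1)a<(d-1)a_1<\mu_{\rm low}<\frac1{d-2}$). For $\mu\in(\mu_{\rm low},\frac1{d-2})$ put $$\gamma:=\frac{\mu+1-(d-1)a}{\mu+a},\qquad \gamma_1:=\frac{\mu+1-(d-1)a_1}{\mu+a_1}.$$ Write $\Pi_+=\{(r,z)\in\mathbb R^2:r>0,z>0\}$, $\langle r,z\rangle=(1+r^2+z^2)^{1/2}$, $\langle z\rangle=(1+z^2)^{1/2}$, and $\langle X\rangle=(1+|X|^2)^{1/2}$ for $X\in\mathbb R^{d+4}$. For $M'>1$ let $\mathcal B_{M'}$ be the set of $\Omega\in C^1(\Pi_+)$ such that on $\Pi_+$ $$0<\Omega\le M'\min\{r^{-\frac{d-1}{d\mu}}z^{-\frac1{d\mu}},\,zr^{-\gamma}+zr^{-\gamma_1}\},\qquad |r\partial_r\Omega|+|z\partial_z\Omega|\le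 M'\Omega,$$ and $\Omega(r,z)\ge\frac1{M'}r^{-\frac{d-1}{d\mu}}z^{-\frac1{d\mu}}$ whenever $2<z<r<2z$. For $M>1$ let $\mathcal A_M$ be the set of $\psi\in C(\overline{\Pi_+})\cap C^2(\Pi_+)$ with $\psi(0,0)=a$; with $0<\psi\le a_1$ and $M^{-1}\langle r,z\rangle^{d-2-\frac1\mu}\le\psi\le M\langle r,z\rangle^{d-2-\frac1\mu}$ on $\overline{\Pi_+}$; and with, on $\Pi_+$, $$|\nabla_{r,z}\psi|\le\tfrac1{10}\langle r,z\rangle^{-1+\frac1{d\mu}}\langle z\rangle^{-\frac1{d\mu}}\psi,\qquad |\langle r,z\rangle\partial_r\psi|\le\tfrac1{10}\psi,$$ $$|\nabla^2_{r,z}\psi|\le\tfrac1{10}\Big(\langle r,z\rangle^{2-d+\frac1\mu}r^{d-3-\frac{d-1}{d\mu}}\langle z\rangle^{-1-\frac1{d\mu}}+r^{d-3-\gamma}\mathbf 1_{r^2+z^2\le1}\Big)\psi .$$ For $\Omega\in\mathcal B_{M'}$ and $X=(x,y)\in\mathbb R^{d+1}\times\mathbb R^3$ let $$\Psi_0(X)=\beta_d\int_{\mathbb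 R^{d+4}}|X-Y|^{-d-2}\,|\xi|^{d-3}|\eta|^{-1}\,\Omega(|\xi|,|\eta|)\,dY,\qquad Y=(\xi,\eta)\in\mathbb R^{d+1}\times\mathbb R^3,$$ where $\beta_d=\frac1{(d+4)(d+2)|B_1|}$ and $|B_1|$ is the volume of the unit ball of $\mathbb R^{d+4}$; put $\mathfrak M(\Omega)=\Psi_0(0)$. **Proposition.** For every $d$, $a$ as above and every $M'>1$ there are constants $M''>1$ and $\mu_0\in(\mu_{\rm low},\frac1{d-2})$, depending only on $d,a,M'$, such that for every $\mu\in(\mu_{\rm low},\frac1{d-2})$ and every $\Omega\in\mathcal B_{M'}$ the following hold. 1. For every $X\in\mathbb R^{d+4}$ the integral defining $\Psi_0(X)$ converges absolutely and $$\frac{1}{M''(1-\mu(d-2))}\langle X\rangle^{d-2-\frac1\mu}\le\Psi_0(X)\le\frac{M''}{1-\mu(d-2)}\langle X\rangle^{d-2-\frac1\mu}.$$ 2. The equation $$\Big(\partial_r^2+\frac dr\partial_r+\partial_z^2+\frac2z\partial_z\Big)\psi(r,z)=-\frac a{\mathfrak M(\Omega)}\,r^{d-3}\,\frac{\Omega(r,z)}z,\qquad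 (r,z)\in\Pi_+,$$ has exactly one solution $\psi\in C^1(\overline{\Pi_+})\cap C^2(\Pi_+)$ with $\lim_{r+z\to+\infty}\psi(r,z)=0$, namely $\psi=\frac a{\mathfrak M(\Omega)}\psi_0$, where $\psi_0$ is the function on $\overline{\Pi_+}$ with $\Psi_0(x,y)=\psi_0(|x|,|y|)$. 3. If $\mu\in(\mu_0,\frac1{d-2})$, then $\psi\in\mathcal A_{2(M'')^2}$. -/

import Mathlib

open MeasureTheory Filter Topology Set

noncomputable section

namespace EulerProfile

/-- The open quadrant `Π₊ = {(r, z) : r > 0, z > 0}`. -/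
def quadrant : Set (ℝ × ℝ) := {p | 0 < p.1 ∧ 0 < p.2}

/-- The closed quadrant, the closure of `Π₊`. -/
def closedQuadrant : Set (ℝ × ℝ) := {p | 0 ≤ p.1 ∧ 0 ≤ p.2}

/-- The partial derivative `∂_r f`. -/
def dr (f : ℝ × ℝ → ℝ) (p : ℝ × ℝ) : ℝ := deriv (fun s => f (s, p.2)) p.1

/-- The partial derivative `∂_z f`. -/
def dz (f : ℝ × ℝ → ℝ) (p : ℝ × ℝ) : ℝ := deriv (fun t => f (p.1, t)) p.2

/-- The Euclidean length of `∇_{r,z} f`. -/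
def gradNorm (f : ℝ × ℝ → ℝ) (p : ℝ × ℝ) : ℝ := √(dr f p ^ 2 + dz f p ^ 2)

/-- The Euclidean (Frobenius) length of the Hessian `∇²_{r,z} f`. -/
def hessNorm (f : ℝ × ℝ → ℝ) (p : ℝ × ℝ) : ℝ :=
  √(dr (dr f) p ^ 2 + dr (dz f) p ^ 2 + dz (dr f) p ^ 2 + dz (dz f) p ^ 2)

/-- The bracket `⟨r, z⟩ = (1 + r² + z²)^{1/2}`. -/
def jap (p : ℝ × ℝ) : ℝ := √(1 + p.1 ^ 2 + p.2 ^ 2)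

/-- The bracket `⟨z⟩ = (1 + z²)^{1/2}`. -/
def jap₁ (z : ℝ) : ℝ := √(1 + z ^ 2)

/-- `a₁ = a/2 + 1/(2(d-1)(d-2))`. -/
def aOne (d : ℕ) (a : ℝ) : ℝ := a / 2 + 1 / (2 * ((d : ℝ) - 1) * ((d : ℝ) - 2))

/-- The admissible range of `a`. -/
def ARange (d : ℕ) (a : ℝ) : Prop :=
  4 / ((4 * (d : ℝ) - 3) * ((d : ℝ) - 2)) < a ∧ a < 1 / (((d : ℝ) - 1) * ((d : ℝ) - 2))

/-- The lower end `(d-1)a₁/2 + 1/(2(d-2))` of the admissible range of `μ`. -/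
def muLow (d : ℕ) (a : ℝ) : ℝ := ((d : ℝ) - 1) * aOne d a / 2 + 1 / (2 * ((d : ℝ) - 2))

/-- The admissible range of `μ`. -/
def MuRange (d : ℕ) (a μ : ℝ) : Prop := muLow d a < μ ∧ μ < 1 / ((d : ℝ) - 2)

/-- For admissible `a` the range of `μ` is nonempty and its lower end lies above the listed
smaller numbers, so that these impose no further condition. -/
theorem muLow_chain {d : ℕ} (hd : 3 ≤ d) {a : ℝ} (ha : ARange d a) :
    1 / (d : ℝ) < 3 / (3 * (d : ℝ) - 5) ∧ 3 / (3 * (d : ℝ) - 5) < ((d : ℝ) - 1) * a ∧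
      ((d : ℝ) - 1) * a < ((d : ℝ) - 1) * aOne d a ∧
      ((d : ℝ) - 1) * aOne d a < muLow d a ∧ muLow d a < 1 / ((d : ℝ) - 2) := by
  obtain ⟨h1, h2⟩ := ha
  have hd' : (3 : ℝ) ≤ d := by exact_mod_cast hd
  set D : ℝ := (d : ℝ)
  have p1 : 0 < D - 1 := by linarith
  have p2 : 0 < D - 2 := by linarith
  have p3 : 0 < 4 * D - 3 := by linarith
  have p5 : 0 < 3 * D - 5 := by linarith
  have e1 : aOne d a = a / 2 + 1 / (((D - 1) * (D - 2))) / 2 := by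
    simp only [aOne, D]; field_simp
  have e2 : (D - 1) * (1 / ((D - 1) * (D - 2))) = 1 / (D - 2) := by field_simp
  have e3 : 1 / (2 * (D - 2)) = 1 / (D - 2) / 2 := by field_simp
  have h3 : (D - 1) * aOne d a < 1 / (D - 2) := by
    rw [← e2]; exact mul_lt_mul_of_pos_left (by rw [e1]; linarith) p1
  refine ⟨?_, ?_, mul_lt_mul_of_pos_left (by rw [e1]; linarith) p1, ?_, ?_⟩
  · rw [div_lt_div_iff₀ (by linarith) p5]; linarith
  · refine lt_trans ?_ (mul_lt_mul_of_pos_left h1 p1)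
    rw [mul_div_assoc', div_lt_div_iff₀ p5 (by positivity)]; nlinarith
  · simp only [muLow]; rw [e3]; linarith
  · simp only [muLow]; rw [e3]; linarith

/-- `γ = (μ + 1 - (d-1)a)/(μ + a)`; the exponent `γ₁` is `gam d (aOne d a) μ`. -/
def gam (d : ℕ) (a μ : ℝ) : ℝ := (μ + 1 - ((d : ℝ) - 1) * a) / (μ + a)

/-- Membership in the class `𝒜⁰` (with parameters `d, a, μ`). -/
structure MemA0 (d : ℕ) (a μ : ℝ) (ψ : ℝ × ℝ → ℝ) : Prop where
  continuousOn : ContinuousOn ψ closedQuadrant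
  contDiffOn : ContDiffOn ℝ 2 ψ quadrant
  apply_zero : ψ (0, 0) = a
  pos : ∀ p ∈ closedQuadrant, 0 < ψ p
  le_aOne : ∀ p ∈ closedQuadrant, ψ p ≤ aOne d a
  grad_le : ∀ p ∈ quadrant, gradNorm ψ p ≤
    1 / 10 * jap p ^ (-1 + 1 / (d * μ)) * jap₁ p.2 ^ (-(1 / (d * μ))) * ψ p
  dr_le : ∀ p ∈ quadrant, |jap p * dr ψ p| ≤ 1 / 10 * ψ p
  hess_le : ∀ p ∈ quadrant, hessNorm ψ p ≤
    1 / 10 * (jap p ^ (2 - (d : ℝ) + 1 / μ) * p.1 ^ ((d : ℝ) - 3 - ((d : ℝ) - 1) / (d * μ))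
        * jap₁ p.2 ^ (-1 - 1 / (d * μ))
      + (if p.1 ^ 2 + p.2 ^ 2 ≤ 1 then p.1 ^ ((d : ℝ) - 3 - gam d a μ) else 0)) * ψ p

/-- Membership in the class `𝒜_M`. -/
structure MemA (d : ℕ) (a μ M : ℝ) (ψ : ℝ × ℝ → ℝ) : Prop where
  memA0 : MemA0 d a μ ψ
  lower : ∀ p ∈ closedQuadrant, M⁻¹ * jap p ^ ((d : ℝ) - 2 - 1 / μ) ≤ ψ p
  upper : ∀ p ∈ closedQuadrant, ψ p ≤ M * jap p ^ ((d : ℝ) - 2 - 1 / μ)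

/-- Membership in the class `ℬ_{M'}` (with parameters `d, a, μ`). Only the values of `Ω` on the
open quadrant matter. -/
structure MemB (d : ℕ) (a μ M' : ℝ) (Ω : ℝ × ℝ → ℝ) : Prop where
  contDiffOn : ContDiffOn ℝ 1 Ω quadrant
  pos : ∀ p ∈ quadrant, 0 < Ω p
  upper : ∀ p ∈ quadrant, Ω p ≤ M' * min
    (p.1 ^ (-(((d : ℝ) - 1) / (d * μ))) * p.2 ^ (-(1 / (d * μ))))
    (p.2 * p.1 ^ (-gam d a μ) + p.2 * p.1 ^ (-gam d (aOne d a) μ))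
  lower : ∀ r z : ℝ, 2 < z → z < r → r < 2 * z →
    1 / M' * (r ^ (-(((d : ℝ) - 1) / (d * μ))) * z ^ (-(1 / (d * μ)))) ≤ Ω (r, z)
  log_deriv : ∀ p ∈ quadrant, |p.1 * dr Ω p| + |p.2 * dz Ω p| ≤ M' * Ω p

/-- The space `ℝ^{d+1} × ℝ³ = ℝ^{d+4}`; only its product Lebesgue measure is used, lengths of
vectors in `ℝ^{d+4}` are written out in terms of the two Euclidean components. -/
abbrev Space (d : ℕ) : Type := EuclideanSpace ℝ (Fin (d + 1)) × EuclideanSpace ℝ (Fin 3)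

/-- The Euclidean length of `X = (x, y)` in `ℝ^{d+4}`. -/
def len {d : ℕ} (X : Space d) : ℝ := √(‖X.1‖ ^ 2 + ‖X.2‖ ^ 2)

/-- `β_d = 1/((d+4)(d+2) α)` where `α` is the volume of the unit ball of `ℝ^{d+4}`. -/
def betaConst (d : ℕ) : ℝ :=
  1 / (((d : ℝ) + 4) * ((d : ℝ) + 2) *
    volume.real (Metric.ball (0 : EuclideanSpace ℝ (Fin (d + 4))) 1))

/-- The integrand `|X-Y|^{-d-2} |ξ|^{d-3} |η|^{-1} Ω(|ξ|,|η|)`, `Y = (ξ, η)`. -/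
def potentialIntegrand (d : ℕ) (Ω : ℝ × ℝ → ℝ) (X Y : Space d) : ℝ :=
  (len (X - Y) ^ (d + 2))⁻¹ * (‖Y.1‖ ^ (d - 3) * ‖Y.2‖⁻¹ * Ω (‖Y.1‖, ‖Y.2‖))

/-- The Newtonian potential `Ψ₀`. -/
def Psi0 (d : ℕ) (Ω : ℝ × ℝ → ℝ) (X : Space d) : ℝ :=
  betaConst d * ∫ Y : Space d, potentialIntegrand d Ω X Y

/-- The normalization `𝔐(Ω) = Ψ₀(0)`. -/
def normalization (d : ℕ) (Ω : ℝ × ℝ → ℝ) : ℝ := Psi0 d Ω 0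

/-- `ψ ∈ C¹(closure of Π₊) ∩ C²(Π₊)` solves the rescaled elliptic equation in `Π₊` and
`ψ(r, z) → 0` as `r + z → ∞`. -/
structure IsDecayingSolution (d : ℕ) (a : ℝ) (Ω ψ : ℝ × ℝ → ℝ) : Prop where
  contDiffOn_closed : ContDiffOn ℝ 1 ψ closedQuadrant
  contDiffOn : ContDiffOn ℝ 2 ψ quadrant
  equation : ∀ r z : ℝ, 0 < r → 0 < z →
    dr (dr ψ) (r, z) + d / r * dr ψ (r, z) + dz (dz ψ) (r, z) + 2 / z * dz ψ (r, z)
      = -(a / normalization d Ω * r ^ (d - 3) * (Ω (r, z) / z))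
  decay : Tendsto ψ (comap (fun p : ℝ × ℝ => p.1 + p.2) atTop ⊓ 𝓟 closedQuadrant) (𝓝 0)

end EulerProfile

end

open EulerProfile

open MeasureTheory Filter Topology Set
open EulerProfile

namespace EulerProfile

section

/-! ### Gaussian averages of powers of the norm -/

/-! The Newtonian kernel of `ℝ^{d+4}` is a superposition of Gaussians over all scales: up to a
constant, `|X-Y|^{-d-2}` is the integral over `l > 0` of `(l/2) l^{-(d+4)} exp(-|X-Y|²/l²)`. Hence
`Ψ₀` is a multiple of `pot w`, the integral over `l` of `l/2` times the Gaussian average at scale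
`l` of the source `w = r^{d-3} z^{-1} Ω` (`integrable_newton_and_eq`). A derivative of the potential
either falls on the Gaussian, at the cost of `1/l`, or is moved to the source by integration by
parts (`Source.smear_deriv`), where the logarithmic derivative bounds turn a derivative in `ξ` into
a factor `1/|ξ|`. Once Gaussian averages of the power majorants of `w` are bounded, every estimate
becomes a one-dimensional integral in `l`.

The source is described by three exponents: it decays like `r^{-t} (1+z)^{-β}` and, for `z < 1/2`,
may also have a singularity `r^{-s}`. The decisive number is `σ = t + β - 2 = 1/μ - (d-2)`, which is
positive and tends to zero as `μ` tends to `1/(d-2)`. The scales beyond `1+r+z` contribute the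
integral of `l^{-1-σ}`, so the potential is comparable with `σ⁻¹ (1+r+z)^{-σ}`: the upper bound is
`exists_pot_le`, and the lower bound `exists_le_pot` uses only the sector where `Ω` is bounded
below. First and second derivatives, and the excess `Ψ₀(X) - Ψ₀(0)`, satisfy bounds without the
factor `σ⁻¹`, since one more power of `l` in the decay makes the large scales harmless. After
normalization by `Ψ₀(0)` all of these are smaller than `ψ` by a factor of order `σ`; this yields the
constants `1/10` and the bound by `a₁` as soon as `μ` is close to `1/(d-2)` (`RadialBounds.memA0`).

Second derivatives with at least one direction in `ξ` are estimated directly. The remaining `∂_z²`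
is read off the equation, once `∂_zψ/z` is controlled by integrating the equation in the form
`∂_z(z² ∂_zψ)` (`exists_abs_radialOne_div_le`). The equation itself comes from the heat equation for
Gaussian averages and the fundamental theorem of calculus in `l` (`Source.sum_potTwo`), followed by
rotation invariance.

Uniqueness is a maximum principle in which the barrier `ε (log r + log z)` keeps the maximum away
from the two axes, where no boundary condition is given (`le_of_isDecayingSolution`). -/

theorem integrable_exp_neg_mul_sq_norm {n : ℕ} {b : ℝ} (hb : 0 < b) :
    Integrable (fun v : EuclideanSpace ℝ (Fin n) => Real.exp (-b * ‖v‖ ^ 2)) := by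
  -- A non-integrable function has integral zero by convention, so integrability follows from the
  -- nonzero value of the integral.
  refine not_imp_comm.1 integral_undef ?_
  rw [GaussianFourier.integral_rexp_neg_mul_sq_norm hb]
  positivity

/-- In polar coordinates the integrand becomes `y^{n-3}`. The singularity of order two in dimension
at least three is what limits the exponents of the averaged powers to `[0, 2]`. -/
theorem integrableOn_inv_sq_norm {n : ℕ} (hn : 3 ≤ n) :
    IntegrableOn (fun v : EuclideanSpace ℝ (Fin n) => (‖v‖ ^ 2)⁻¹) (Metric.ball 0 1) := by
  have : Nontrivial (EuclideanSpace ℝ (Fin n)) :=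
    Module.nontrivial_of_finrank_pos (R := ℝ) (by simp; omega)
  rw [integrableOn_fun_norm_addHaar volume (f := fun y => (y ^ 2)⁻¹)]
  have h1 : IntegrableOn (fun y : ℝ => y ^ (n - 3)) (Ioo 0 1) :=
    ((continuous_pow (n - 3)).integrableOn_Icc (a := 0) (b := 1)).mono_set Ioo_subset_Icc_self
  refine h1.congr_fun (fun y hy => ?_) measurableSet_Ioo
  have : y ≠ 0 := hy.1.ne'
  simp only [finrank_euclideanSpace, Fintype.card_fin, smul_eq_mul]
  rw [show n - 1 = (n - 3) + 2 by omega, pow_add]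
  field_simp

/-- The Gaussian average of an inverse square is bounded uniformly in the position of the pole. -/
theorem exists_integral_exp_mul_inv_sq_le {n : ℕ} (hn : 3 ≤ n) :
    ∃ K : ℝ, 0 < K ∧ ∀ x : EuclideanSpace ℝ (Fin n),
      Integrable (fun Z : EuclideanSpace ℝ (Fin n) =>
        Real.exp (-(1 / 8) * ‖Z‖ ^ 2) * (‖x + Z‖ ^ 2)⁻¹) ∧
      ∫ Z : EuclideanSpace ℝ (Fin n), Real.exp (-(1 / 8) * ‖Z‖ ^ 2) * (‖x + Z‖ ^ 2)⁻¹ ≤ K := by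
  -- Within distance one of the pole the Gaussian is at most one, and the integral of the truncated
  -- inverse square does not depend on `x` by translation invariance. Farther away the inverse
  -- square is at most one.
  set B : EuclideanSpace ℝ (Fin n) → ℝ :=
    (Metric.ball (0 : EuclideanSpace ℝ (Fin n)) 1).indicator (fun v => (‖v‖ ^ 2)⁻¹) with hB
  have hBi : Integrable B := (integrable_indicator_iff measurableSet_ball).2
    (integrableOn_inv_sq_norm hn)
  have hG := integrable_exp_neg_mul_sq_norm (n := n) (b := 1 / 8) (by norm_num)
  have hB0 : ∀ v, 0 ≤ B v := fun v => indicator_nonneg (fun _ _ => by positivity) v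
  have hle : ∀ x Z : EuclideanSpace ℝ (Fin n),
      Real.exp (-(1 / 8) * ‖Z‖ ^ 2) * (‖x + Z‖ ^ 2)⁻¹
        ≤ B (x + Z) + Real.exp (-(1 / 8) * ‖Z‖ ^ 2) := by
    intro x Z
    have he : Real.exp (-(1 / 8) * ‖Z‖ ^ 2) ≤ 1 := Real.exp_le_one_iff.2 (by nlinarith [sq_nonneg ‖Z‖])
    by_cases h : ‖x + Z‖ < 1
    · have : B (x + Z) = (‖x + Z‖ ^ 2)⁻¹ := indicator_of_mem (by simpa using h) _
      rw [this]
      have h2 : 0 ≤ (‖x + Z‖ ^ 2)⁻¹ := by positivity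
      nlinarith [Real.exp_pos (-(1 / 8) * ‖Z‖ ^ 2)]
    · have h2 : (‖x + Z‖ ^ 2)⁻¹ ≤ 1 := inv_le_one_of_one_le₀ (by nlinarith)
      nlinarith [hB0 (x + Z), Real.exp_pos (-(1 / 8) * ‖Z‖ ^ 2)]
  have hint : ∀ x, Integrable (fun Z => B (x + Z) + Real.exp (-(1 / 8) * ‖Z‖ ^ 2)) :=
    fun x => (hBi.comp_add_left x).add hG
  refine ⟨(∫ v, B v) + (∫ v : EuclideanSpace ℝ (Fin n), Real.exp (-(1 / 8) * ‖v‖ ^ 2)) + 1, ?_, ?_⟩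
  · have : 0 ≤ ∫ v, B v := integral_nonneg fun v => hB0 v
    have h2 : 0 ≤ ∫ v : EuclideanSpace ℝ (Fin n), Real.exp (-(1 / 8) * ‖v‖ ^ 2) :=
      integral_nonneg fun _ => (Real.exp_pos _).le
    positivity
  · intro x
    have hi : Integrable (fun Z : EuclideanSpace ℝ (Fin n) =>
        Real.exp (-(1 / 8) * ‖Z‖ ^ 2) * (‖x + Z‖ ^ 2)⁻¹) := by
      refine (hint x).mono' (by fun_prop) (.of_forall fun Z => ?_)
      rw [Real.norm_of_nonneg (by positivity)]
      exact hle x Z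
    refine ⟨hi, (integral_mono hi (hint x) (hle x)).trans ?_⟩
    rw [integral_add (hBi.comp_add_left x) hG, integral_add_left_eq_self B x]
    linarith

/-- Reduces all exponents in `[0, 2]` to the inverse square at once, with constants independent of
the exponent. -/
theorem rpow_ratio_le {α u : ℝ} (h0 : 0 ≤ α) (h2 : α ≤ 2) (hu : 0 ≤ u) : u ^ α ≤ 1 + u ^ 2 := by
  rcases le_total u 1 with h | h
  · exact (Real.rpow_le_one hu h h0).trans (by nlinarith)
  · calc u ^ α ≤ u ^ (2 : ℝ) := Real.rpow_le_rpow_of_exponent_le h h2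
      _ = u ^ 2 := by norm_cast
      _ ≤ _ := by linarith

/-- Gaussian averages at scale `l` of the power `(c + |·|)^{-α}` are bounded by
`(c + |x| + l)^{-α}`. -/
theorem exists_average_rpow_le {n : ℕ} (hn : 3 ≤ n) :
    ∃ K : ℝ, 0 < K ∧ ∀ (α c l : ℝ) (x : EuclideanSpace ℝ (Fin n)), 0 ≤ α → α ≤ 2 → 0 ≤ c → 0 < l →
      Integrable (fun Z : EuclideanSpace ℝ (Fin n) =>
        Real.exp (-(1 / 4) * ‖Z‖ ^ 2) * (c + ‖x + l • Z‖) ^ (-α)) ∧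
      ∫ Z : EuclideanSpace ℝ (Fin n), Real.exp (-(1 / 4) * ‖Z‖ ^ 2) * (c + ‖x + l • Z‖) ^ (-α)
        ≤ K * (c + ‖x‖ + l) ^ (-α) := by
  obtain ⟨K, hK, hav⟩ := exists_integral_exp_mul_inv_sq_le hn
  have hG := integrable_exp_neg_mul_sq_norm (n := n) (b := 1 / 8) (by norm_num)
  set G := ∫ v : EuclideanSpace ℝ (Fin n), Real.exp (-(1 / 8) * ‖v‖ ^ 2) with hGdef
  have hG0 : 0 ≤ G := integral_nonneg fun _ => (Real.exp_pos _).le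
  refine ⟨3 * G + 32 * K, by positivity, ?_⟩
  intro α c l x hα hα2 hc hl
  have : Nontrivial (EuclideanSpace ℝ (Fin n)) :=
    Module.nontrivial_of_finrank_pos (R := ℝ) (by simp; omega)
  set A : ℝ := c + ‖x‖ + l with hA
  have hApos : 0 < A := by positivity
  -- In units of `l` the pole sits at `-x'`, and the bound for the inverse square is uniform in that
  -- position.
  set x' := l⁻¹ • x with hx'
  obtain ⟨hi, hle⟩ := hav x'
  have key : ∀ Z : EuclideanSpace ℝ (Fin n), x' + Z ≠ 0 →
      Real.exp (-(1 / 4) * ‖Z‖ ^ 2) * (c + ‖x + l • Z‖) ^ (-α) ≤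
        A ^ (-α) * (3 * Real.exp (-(1 / 8) * ‖Z‖ ^ 2) +
          32 * (Real.exp (-(1 / 8) * ‖Z‖ ^ 2) * (‖x' + Z‖ ^ 2)⁻¹)) := by
    intro Z hZ
    have hxl : x + l • Z = l • (x' + Z) := by
      rw [smul_add, hx', smul_smul, mul_inv_cancel₀ hl.ne', one_smul]
    have hn' : ‖x + l • Z‖ = l * ‖x' + Z‖ := by rw [hxl, norm_smul, Real.norm_of_nonneg hl.le]
    set ν := ‖x' + Z‖ with hν
    have hνpos : 0 < ν := norm_pos_iff.2 hZ
    set D := c + ‖x + l • Z‖ with hD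
    have hDpos : 0 < D := by rw [hD, hn']; positivity
    have hx : ‖x‖ ≤ ‖x + l • Z‖ + l * ‖Z‖ := by
      calc ‖x‖ = ‖(x + l • Z) - l • Z‖ := by simp
        _ ≤ ‖x + l • Z‖ + ‖l • Z‖ := norm_sub_le _ _
        _ = _ := by rw [norm_smul, Real.norm_of_nonneg hl.le]
    have hratio : A / D ≤ 1 + (1 + ‖Z‖) / ν := by
      have e1 : l * (1 + ‖Z‖) / D ≤ (1 + ‖Z‖) / ν := by
        rw [div_le_div_iff₀ hDpos hνpos]
        have : l * ν ≤ D := by rw [hD, hn']; linarith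
        nlinarith [norm_nonneg Z, mul_le_mul_of_nonneg_left this (by positivity : 0 ≤ 1 + ‖Z‖)]
      have e2 : A / D ≤ (D + l * (1 + ‖Z‖)) / D := by
        gcongr
        rw [hA]; linarith
      rw [add_div D, div_self hDpos.ne'] at e2
      linarith
    have hpow : (A / D) ^ α ≤ 3 + 2 * ((1 + ‖Z‖) ^ 2 * (ν ^ 2)⁻¹) := by
      refine (rpow_ratio_le hα hα2 (by positivity)).trans ?_
      have h0 : 0 ≤ A / D := by positivity
      have : (A / D) ^ 2 ≤ (1 + (1 + ‖Z‖) / ν) ^ 2 := by gcongr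
      have e3 : ((1 + ‖Z‖) / ν) ^ 2 = (1 + ‖Z‖) ^ 2 * (ν ^ 2)⁻¹ := by rw [div_pow, div_eq_mul_inv]
      nlinarith [sq_nonneg (1 - (1 + ‖Z‖) / ν)]
    have hDA : D ^ (-α) = A ^ (-α) * (A / D) ^ α := by
      rw [Real.div_rpow hApos.le hDpos.le, Real.rpow_neg hApos.le, Real.rpow_neg hDpos.le]
      have := Real.rpow_pos_of_pos hApos α
      field_simp
    -- Half of the Gaussian absorbs the polynomial factor `(1+‖Z‖)²`; the other half remains for the
    -- average.
    have hexp : Real.exp (-(1 / 4) * ‖Z‖ ^ 2)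
        = Real.exp (-(1 / 8) * ‖Z‖ ^ 2) * Real.exp (-(1 / 8) * ‖Z‖ ^ 2) := by
      rw [← Real.exp_add]; congr 1; ring
    have hE1 : Real.exp (-(1 / 8) * ‖Z‖ ^ 2) ≤ 1 :=
      Real.exp_le_one_iff.2 (by nlinarith [sq_nonneg ‖Z‖])
    have hE2 : Real.exp (-(1 / 8) * ‖Z‖ ^ 2) * (1 + ‖Z‖) ^ 2 ≤ 16 := by
      have h1 : (1 + ‖Z‖) ^ 2 ≤ 16 * Real.exp (1 / 8 * ‖Z‖ ^ 2) := by
        have := Real.add_one_le_exp (1 / 8 * ‖Z‖ ^ 2)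
        nlinarith [sq_nonneg (1 - ‖Z‖)]
      have h3 : Real.exp (-(1 / 8) * ‖Z‖ ^ 2) * Real.exp (1 / 8 * ‖Z‖ ^ 2) = 1 := by
        rw [← Real.exp_add, ← Real.exp_zero]; congr 1; ring
      nlinarith [Real.exp_pos (-(1 / 8) * ‖Z‖ ^ 2)]
    rw [hDA, mul_left_comm]
    refine mul_le_mul_of_nonneg_left ?_ (by positivity)
    set e := Real.exp (-(1 / 8) * ‖Z‖ ^ 2) with he
    have he0 : 0 < e := Real.exp_pos _
    have hν2 : 0 ≤ e * (ν ^ 2)⁻¹ := by positivity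
    calc _ ≤ (e * e) * (3 + 2 * ((1 + ‖Z‖) ^ 2 * (ν ^ 2)⁻¹)) := by
            rw [hexp]; gcongr
      _ = 3 * (e * e) + 2 * ((e * (1 + ‖Z‖) ^ 2) * (e * (ν ^ 2)⁻¹)) := by ring
      _ ≤ 3 * (e * 1) + 2 * (16 * (e * (ν ^ 2)⁻¹)) := by gcongr
      _ = _ := by ring
  -- The pole, where a real power of zero takes a conventional value, is a null set.
  have hae : ∀ᵐ Z : EuclideanSpace ℝ (Fin n), x' + Z ≠ 0 := by
    have : ∀ᵐ Z : EuclideanSpace ℝ (Fin n), Z ≠ -x' := by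
      rw [ae_iff]; simp
    filter_upwards [this] with Z hZ h
    exact hZ (eq_neg_of_add_eq_zero_right h)
  have hbi : Integrable (fun Z : EuclideanSpace ℝ (Fin n) =>
      A ^ (-α) * (3 * Real.exp (-(1 / 8) * ‖Z‖ ^ 2) +
          32 * (Real.exp (-(1 / 8) * ‖Z‖ ^ 2) * (‖x' + Z‖ ^ 2)⁻¹))) :=
    ((hG.const_mul 3).add (hi.const_mul 32)).const_mul _
  have hii : Integrable (fun Z : EuclideanSpace ℝ (Fin n) =>
        Real.exp (-(1 / 4) * ‖Z‖ ^ 2) * (c + ‖x + l • Z‖) ^ (-α)) := by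
    refine hbi.mono' (Measurable.aestronglyMeasurable (by fun_prop)) ?_
    filter_upwards [hae] with Z hZ
    rw [Real.norm_of_nonneg (by positivity)]
    exact key Z hZ
  refine ⟨hii, (integral_mono_ae hii hbi (hae.mono key)).trans ?_⟩
  rw [integral_const_mul, integral_add (hG.const_mul 3) (hi.const_mul 32), integral_const_mul,
    integral_const_mul, mul_comm]
  gcongr

end

section

/-! ### Averages over `ℝ^{d+1} × ℝ³` -/

variable {d : ℕ}

instance : (volume : Measure (Space d)).IsAddHaarMeasure :=
  Measure.prod.instIsAddHaarMeasure volume volume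

/-- The square of the Euclidean length. -/
noncomputable def sqLen (Z : Space d) : ℝ := ‖Z.1‖ ^ 2 + ‖Z.2‖ ^ 2

/-- The Euclidean inner product. -/
noncomputable def dot (Z v : Space d) : ℝ := inner ℝ Z.1 v.1 + inner ℝ Z.2 v.2

@[fun_prop]
theorem continuous_sqLen : Continuous (sqLen (d := d)) := by unfold sqLen; fun_prop

@[fun_prop]
theorem continuous_dot (v : Space d) : Continuous (fun Z : Space d => dot Z v) := by
  unfold dot; fun_prop

theorem sqLen_nonneg (Z : Space d) : 0 ≤ sqLen Z := by unfold sqLen; positivity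

theorem sqLen_smul (c : ℝ) (Z : Space d) : sqLen (c • Z) = c ^ 2 * sqLen Z := by
  simp only [sqLen, Prod.smul_fst, Prod.smul_snd, norm_smul, mul_pow, Real.norm_eq_abs, sq_abs]
  ring

theorem sqLen_le_sub_add (Z u : Space d) : sqLen Z ≤ 2 * sqLen (Z - u) + 2 * sqLen u := by
  have h1 : ‖Z.1‖ ≤ ‖Z.1 - u.1‖ + ‖u.1‖ := by simpa using norm_add_le (Z.1 - u.1) u.1
  have h2 : ‖Z.2‖ ≤ ‖Z.2 - u.2‖ + ‖u.2‖ := by simpa using norm_add_le (Z.2 - u.2) u.2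
  simp only [sqLen, Prod.fst_sub, Prod.snd_sub]
  nlinarith [sq_nonneg (‖Z.1 - u.1‖ - ‖u.1‖), sq_nonneg (‖Z.2 - u.2‖ - ‖u.2‖), norm_nonneg Z.1,
    norm_nonneg Z.2, norm_nonneg u.1, norm_nonneg u.2, norm_nonneg (Z.1 - u.1),
    norm_nonneg (Z.2 - u.2)]

/-- The Gaussian average of `f` at scale `l` around `X`. -/
noncomputable def avg (f : Space d → ℝ) (l : ℝ) (X : Space d) : ℝ :=
  ∫ Z : Space d, Real.exp (-(1 / 4) * sqLen Z) * f (X + l • Z)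

/-- `f` is measurable and integrable against every Gaussian. -/
structure GaussInt (f : Space d → ℝ) : Prop where
  measurable : Measurable f
  integrable : ∀ l : ℝ, 0 < l → ∀ X : Space d,
    Integrable fun Z : Space d => Real.exp (-(1 / 4) * sqLen Z) * f (X + l • Z)

/-- The function `|ξ|^{-α} (c + |η|)^{-α'}`. -/
noncomputable def powProd (α c α' : ℝ) (Y : Space d) : ℝ := ‖Y.1‖ ^ (-α) * (c + ‖Y.2‖) ^ (-α')

theorem powProd_nonneg {α c α' : ℝ} (hc : 0 ≤ c) (Y : Space d) : 0 ≤ powProd α c α' Y := by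
  unfold powProd; positivity

theorem GaussInt.mono {f g : Space d → ℝ} (hg : GaussInt g) (hf : Measurable f)
    (h : ∀ Y, |f Y| ≤ g Y) : GaussInt f := by
  refine ⟨hf, fun l hl X => (hg.integrable l hl X).mono' ?_ (.of_forall fun Z => ?_)⟩
  · exact Measurable.aestronglyMeasurable (by fun_prop)
  · rw [norm_mul, Real.norm_of_nonneg (Real.exp_pos _).le]
    exact mul_le_mul_of_nonneg_left (h _) (Real.exp_pos _).le

theorem GaussInt.add {f g : Space d → ℝ} (hf : GaussInt f) (hg : GaussInt g) :
    GaussInt (fun Y => f Y + g Y) := by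
  refine ⟨hf.measurable.add hg.measurable, fun l hl X => ?_⟩
  simp only [mul_add]
  exact (hf.integrable l hl X).add (hg.integrable l hl X)

theorem GaussInt.const_mul {f : Space d → ℝ} (hf : GaussInt f) (c : ℝ) :
    GaussInt (fun Y => c * f Y) := by
  refine ⟨hf.measurable.const_mul c, fun l hl X => ?_⟩
  simp only [mul_left_comm _ c]
  exact (hf.integrable l hl X).const_mul c

theorem avg_add {f g : Space d → ℝ} (hf : GaussInt f) (hg : GaussInt g) {l : ℝ} (hl : 0 < l)
    (X : Space d) : avg (fun Y => f Y + g Y) l X = avg f l X + avg g l X := by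
  unfold avg
  simp only [mul_add]
  exact integral_add (hf.integrable l hl X) (hg.integrable l hl X)

theorem avg_const_mul (f : Space d → ℝ) (c l : ℝ) (X : Space d) :
    avg (fun Y => c * f Y) l X = c * avg f l X := by
  unfold avg
  simp only [mul_left_comm _ c]
  exact integral_const_mul _ _

/-- Gaussian averages of `|ξ|^{-α} (c + |η|)^{-α'}`. -/
theorem exists_avg_powProd_le (hd : 3 ≤ d) : ∃ K : ℝ, 0 < K ∧ ∀ α c α' : ℝ, 0 ≤ α → α ≤ 2 → 0 ≤ c →
    0 ≤ α' → α' ≤ 2 → GaussInt (powProd (d := d) α c α') ∧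
      ∀ (l : ℝ) (X : Space d), 0 < l →
        avg (powProd α c α') l X ≤ K * ((‖X.1‖ + l) ^ (-α) * (c + ‖X.2‖ + l) ^ (-α')) := by
  obtain ⟨K₁, hK₁, h₁⟩ := exists_average_rpow_le (n := d + 1) (by omega)
  obtain ⟨K₂, hK₂, h₂⟩ := exists_average_rpow_le (n := 3) le_rfl
  -- The Gaussian and the powers both factor over the two components, so Fubini reduces to one
  -- Euclidean space at a time.
  have hfac : ∀ (α c α' l : ℝ) (X Z : Space d),
      Real.exp (-(1 / 4) * sqLen Z) * powProd α c α' (X + l • Z) =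
      (Real.exp (-(1 / 4) * ‖Z.1‖ ^ 2) * (0 + ‖X.1 + l • Z.1‖) ^ (-α)) *
        (Real.exp (-(1 / 4) * ‖Z.2‖ ^ 2) * (c + ‖X.2 + l • Z.2‖) ^ (-α')) := by
    intro α c α' l X Z
    simp only [sqLen, powProd, mul_add, Real.exp_add, Prod.fst_add, Prod.snd_add, Prod.smul_fst,
      Prod.smul_snd, zero_add]
    ring
  refine ⟨K₁ * K₂, by positivity, fun α c α' hα hα2 hc hα' hα2' => ⟨⟨?_, ?_⟩, ?_⟩⟩
  · unfold powProd; fun_prop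
  · intro l hl X
    simp only [hfac]
    exact (h₁ α 0 l X.1 hα hα2 le_rfl hl).1.mul_prod (h₂ α' c l X.2 hα' hα2' hc hl).1
  · intro l X hl
    have e1 := (h₁ α 0 l X.1 hα hα2 le_rfl hl).2
    have e2 := (h₂ α' c l X.2 hα' hα2' hc hl).2
    unfold avg
    simp only [hfac]
    have := integral_prod_mul (μ := (volume : Measure (EuclideanSpace ℝ (Fin (d + 1)))))
      (ν := (volume : Measure (EuclideanSpace ℝ (Fin 3))))
      (fun Z : EuclideanSpace ℝ (Fin (d + 1)) =>
        Real.exp (-(1 / 4) * ‖Z‖ ^ 2) * (0 + ‖X.1 + l • Z‖) ^ (-α))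
      (fun Z : EuclideanSpace ℝ (Fin 3) =>
        Real.exp (-(1 / 4) * ‖Z‖ ^ 2) * (c + ‖X.2 + l • Z‖) ^ (-α'))
    refine (le_of_eq this).trans ?_
    calc _ ≤ (K₁ * (0 + ‖X.1‖ + l) ^ (-α)) * (K₂ * (c + ‖X.2‖ + l) ^ (-α')) := by
          refine mul_le_mul e1 e2 (integral_nonneg fun Z => ?_) (by positivity)
          positivity
      _ = _ := by rw [zero_add]; ring

/-! ### Kernels with Gaussian decay -/

/-- `h` is continuous with `|h| ≤ C exp(-|Z|²/2)`. -/
structure GaussKer (C : ℝ) (h : Space d → ℝ) : Prop where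
  continuous : Continuous h
  le : ∀ Z, |h Z| ≤ C * Real.exp (-(1 / 2) * sqLen Z)

/-- The integral of `f` against the kernel `h` at scale `l` around `X`. -/
noncomputable def smear (h f : Space d → ℝ) (l : ℝ) (X : Space d) : ℝ :=
  ∫ Z : Space d, h Z * f (X + l • Z)

theorem GaussKer.nonneg {C : ℝ} {h : Space d → ℝ} (hh : GaussKer C h) : 0 ≤ C := by
  have := (abs_nonneg _).trans (hh.le 0)
  exact nonneg_of_mul_nonneg_left this (Real.exp_pos _)

theorem exp_half_le_quarter (Z : Space d) :
    Real.exp (-(1 / 2) * sqLen Z) ≤ Real.exp (-(1 / 4) * sqLen Z) :=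
  Real.exp_le_exp.2 (by nlinarith [sqLen_nonneg Z])

/-- Because `|Z|² ≤ 2|Z-u|² + 2|u|²`, a shift costs half of the decay rate. This is why kernels
decay with rate `1/2` while averages are taken with rate `1/4`. -/
theorem GaussKer.shift_le {C : ℝ} {h : Space d → ℝ} (hh : GaussKer C h) (Z u : Space d) :
    |h (Z - u)| ≤ C * Real.exp (1 / 2 * sqLen u) * Real.exp (-(1 / 4) * sqLen Z) := by
  refine (hh.le _).trans ?_
  rw [mul_assoc, ← Real.exp_add]
  refine mul_le_mul_of_nonneg_left (Real.exp_le_exp.2 ?_) hh.nonneg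
  nlinarith [sqLen_le_sub_add Z u]

theorem GaussKer.shift_integrable {C : ℝ} {h f : Space d → ℝ} (hh : GaussKer C h)
    (hf : GaussInt f) {l : ℝ} (hl : 0 < l) (X u : Space d) :
    Integrable fun Z : Space d => h (Z - u) * f (X + l • Z) := by
  have hm := hf.measurable
  have hc := hh.continuous
  refine (((hf.integrable l hl X).norm).const_mul (C * Real.exp (1 / 2 * sqLen u))).mono'
    (Measurable.aestronglyMeasurable (by fun_prop)) (.of_forall fun Z => ?_)
  rw [norm_mul, norm_mul, ← mul_assoc, Real.norm_of_nonneg (Real.exp_pos _).le]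
  exact mul_le_mul_of_nonneg_right (hh.shift_le Z u) (norm_nonneg _)

theorem GaussKer.integrable {C : ℝ} {h f : Space d → ℝ} (hh : GaussKer C h)
    (hf : GaussInt f) {l : ℝ} (hl : 0 < l) (X : Space d) :
    Integrable fun Z : Space d => h Z * f (X + l • Z) := by
  simpa using hh.shift_integrable hf hl X 0

theorem GaussKer.abs_smear_le {C : ℝ} {h f B : Space d → ℝ} (hh : GaussKer C h)
    (hB : GaussInt B) (hfB : ∀ Y, |f Y| ≤ B Y) {l : ℝ} (hl : 0 < l) (X : Space d) :
    |smear h f l X| ≤ C * avg B l X := by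
  unfold smear avg
  rw [← integral_const_mul, ← Real.norm_eq_abs]
  refine norm_integral_le_of_norm_le ((hB.integrable l hl X).const_mul C) (.of_forall fun Z => ?_)
  rw [norm_mul, ← mul_assoc]
  refine mul_le_mul ?_ (hfB _) (norm_nonneg _) (mul_nonneg hh.nonneg (Real.exp_pos _).le)
  exact (hh.le Z).trans (mul_le_mul_of_nonneg_left (exp_half_le_quarter Z) hh.nonneg)

/-- Moving the centre is the same as moving the kernel, by a change of variables. All regularity in
the centre thus comes from the kernel, and `f` need only be measurable with Gaussian-integrable
growth. -/
theorem smear_add_smul (h f : Space d → ℝ) {l : ℝ} (hl : 0 < l) (X u : Space d) :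
    smear h f l (X + u) = ∫ Z : Space d, h (Z - l⁻¹ • u) * f (X + l • Z) := by
  rw [← integral_add_right_eq_self (fun Z => h (Z - l⁻¹ • u) * f (X + l • Z)) (l⁻¹ • u)]
  unfold smear
  congr 1
  ext Z
  rw [smul_add, smul_smul, mul_inv_cancel₀ hl.ne', one_smul, add_sub_cancel_right]
  congr 2
  abel

theorem continuous_smear {C : ℝ} {h f : Space d → ℝ} (hh : GaussKer C h) (hf : GaussInt f)
    {l : ℝ} (hl : 0 < l) : Continuous (smear h f l) := by
  rw [continuous_iff_continuousAt]
  intro X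
  have hm := hf.measurable
  have hc := hh.continuous
  have key : ContinuousAt (fun u : Space d => ∫ Z : Space d, h (Z - l⁻¹ • u) * f (X + l • Z)) 0 := by
    have hev : ∀ᶠ u : Space d in 𝓝 0, sqLen (l⁻¹ • u) ≤ 1 := by
      have : ContinuousAt (fun u : Space d => sqLen (l⁻¹ • u)) 0 :=
        Continuous.continuousAt (by fun_prop)
      have h0 : sqLen (l⁻¹ • (0 : Space d)) < 1 := by simp [sqLen]
      exact (this.eventually_lt_const h0).mono fun u hu => le_of_lt hu
    refine continuousAt_of_dominated
      (bound := fun Z => C * Real.exp (1 / 2) * ‖Real.exp (-(1 / 4) * sqLen Z) * f (X + l • Z)‖)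
      (.of_forall fun u => Measurable.aestronglyMeasurable (by fun_prop)) ?_
      (((hf.integrable l hl X).norm).const_mul _) (.of_forall fun Z => ?_)
    · filter_upwards [hev] with u hu
      refine .of_forall fun Z => ?_
      rw [norm_mul, norm_mul, ← mul_assoc, Real.norm_of_nonneg (Real.exp_pos _).le]
      refine mul_le_mul_of_nonneg_right ((hh.shift_le Z _).trans ?_) (norm_nonneg _)
      refine mul_le_mul_of_nonneg_right (mul_le_mul_of_nonneg_left
        (Real.exp_le_exp.2 (by linarith)) hh.nonneg) (Real.exp_pos _).le
    · exact Continuous.continuousAt (by fun_prop)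
  have e : smear h f l = (fun u : Space d => ∫ Z : Space d, h (Z - l⁻¹ • u) * f (X + l • Z)) ∘
      (fun Y => Y - X) := by
    ext Y
    simp only [Function.comp]
    rw [← smear_add_smul h f hl]
    congr 1
    abel
  rw [e]
  refine ContinuousAt.comp ?_ (by fun_prop)
  simpa using key

/-- `h'` is the derivative of `h` in the direction `v`. -/
def DirDeriv (v : Space d) (h h' : Space d → ℝ) : Prop :=
  ∀ Z, HasDerivAt (fun s : ℝ => h (Z + s • v)) (h' Z) 0

theorem DirDeriv.hasDerivAt {v : Space d} {h h' : Space d → ℝ} (H : DirDeriv v h h') (Z : Space d)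
    (s : ℝ) : HasDerivAt (fun s : ℝ => h (Z + s • v)) (h' (Z + s • v)) s := by
  have h1 := H (Z + s • v)
  have h2 : HasDerivAt (fun s' : ℝ => s' - s) 1 s := (hasDerivAt_id s).sub_const s
  have h3 : HasDerivAt (fun s : ℝ => h (Z + s • v)) (h' (Z + s • v) * 1) s := by
    have h4 : HasDerivAt (fun a : ℝ => h (Z + s • v + a • v)) (h' (Z + s • v)) (s - s) := by
      simpa using h1
    refine (HasDerivAt.comp (h := fun s' => s' - s) s h4 h2).congr_of_eventuallyEq
      (.of_forall fun a => ?_)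
    simp only [Function.comp]
    congr 1
    rw [sub_smul, add_assoc, add_sub_cancel]
  simpa using h3

/-- After the translation is moved to the kernel the argument is `Z - (s/l) v`, so differentiation
under the integral produces `-1/l`. -/
theorem hasDerivAt_smear {C C' : ℝ} {h h' f : Space d → ℝ} {v : Space d} (hh : GaussKer C h)
    (hh' : GaussKer C' h') (H : DirDeriv v h h') (hf : GaussInt f) {l : ℝ} (hl : 0 < l)
    (X : Space d) :
    HasDerivAt (fun s : ℝ => smear h f l (X + s • v)) (-(1 / l) * smear h' f l X) 0 := by
  have hm := hf.measurable
  have hc := hh.continuous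
  have hc' := hh'.continuous
  have e : (fun s : ℝ => smear h f l (X + s • v)) =
      fun s : ℝ => ∫ Z : Space d, h (Z - (l⁻¹ * s) • v) * f (X + l • Z) := by
    ext s
    rw [smear_add_smul h f hl]
    simp only [smul_smul]
  have e2 : -(1 / l) * smear h' f l X =
      ∫ Z : Space d, (-(1 / l) * h' (Z - (l⁻¹ * 0) • v)) * f (X + l • Z) := by
    unfold smear
    simp only [mul_zero, zero_smul, sub_zero, mul_assoc]
    rw [integral_const_mul]
  rw [e, e2]
  refine (hasDerivAt_integral_of_dominated_loc_of_deriv_le (s := Metric.ball 0 1)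
    (F' := fun (s : ℝ) (Z : Space d) => (-(1 / l) * h' (Z - (l⁻¹ * s) • v)) * f (X + l • Z))
    (bound := fun Z => (1 / l) * (C' * Real.exp (1 / 2 * sqLen (l⁻¹ • v))) *
      ‖Real.exp (-(1 / 4) * sqLen Z) * f (X + l • Z)‖)
    (Metric.ball_mem_nhds _ one_pos) (.of_forall fun s => Measurable.aestronglyMeasurable (by fun_prop))
    ?_ (Measurable.aestronglyMeasurable (by fun_prop)) ?_ ?_ ?_).2
  · simpa using hh.integrable hf hl X
  · refine .of_forall fun Z s hs => ?_
    have hs1 : s ^ 2 ≤ 1 := by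
      have : |s| < 1 := by simpa using hs
      rw [sq_le_one_iff_abs_le_one]; exact this.le
    rw [norm_mul, norm_mul, norm_mul, Real.norm_of_nonneg (Real.exp_pos _).le, norm_neg,
      Real.norm_of_nonneg (by positivity : 0 ≤ 1 / l), ← mul_assoc, mul_assoc (1 / l) (C' * _)]
    refine mul_le_mul_of_nonneg_right (mul_le_mul_of_nonneg_left ?_ (by positivity)) (norm_nonneg _)
    refine (hh'.shift_le Z _).trans ?_
    refine mul_le_mul_of_nonneg_right (mul_le_mul_of_nonneg_left
      (Real.exp_le_exp.2 ?_) hh'.nonneg) (Real.exp_pos _).le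
    rw [sqLen_smul, sqLen_smul]
    have : 0 ≤ l⁻¹ ^ 2 * sqLen v := by have := sqLen_nonneg v; positivity
    nlinarith
  · exact ((hf.integrable l hl X).norm).const_mul _
  · refine .of_forall fun Z s _ => HasDerivAt.mul_const ?_ _
    have h1 := H.hasDerivAt Z (-(l⁻¹ * s))
    have h2 : HasDerivAt (fun s : ℝ => -(l⁻¹ * s)) (-(1 / l)) s := by
      have := ((hasDerivAt_id s).const_mul l⁻¹).fun_neg
      simpa using this
    have h3 := HasDerivAt.comp (h := fun s : ℝ => -(l⁻¹ * s)) s h1 h2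
    simp only [Function.comp_def, neg_smul, ← sub_eq_add_neg] at h3
    rw [mul_comm]
    exact h3

end

section

variable {d : ℕ}

/-! ### The Gaussian and its derivatives -/

theorem exp_mul_exp_eq_one {a b : ℝ} (h : a + b = 0) : Real.exp a * Real.exp b = 1 := by
  rw [← Real.exp_add, h, Real.exp_zero]

/-- The Gaussian `exp(-|Z|²)`. -/
noncomputable def gker (Z : Space d) : ℝ := Real.exp (-sqLen Z)

/-- Minus the derivative of the Gaussian in the direction `v`. -/
noncomputable def gkerOne (v Z : Space d) : ℝ := 2 * dot Z v * gker Z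

/-- The second derivative of the Gaussian in the directions `v`, `w`. -/
noncomputable def gkerTwo (v w Z : Space d) : ℝ := (4 * dot Z v * dot Z w - 2 * dot v w) * gker Z

/-- The Laplacian of the Gaussian. -/
noncomputable def gkerLap (Z : Space d) : ℝ := (4 * sqLen Z - 2 * ((d : ℝ) + 4)) * gker Z

/-- Both components of `v` have length at most one. -/
def SubUnit (v : Space d) : Prop := ‖v.1‖ ≤ 1 ∧ ‖v.2‖ ≤ 1

theorem dot_comm (Z v : Space d) : dot Z v = dot v Z := by
  simp only [dot, real_inner_comm]

theorem SubUnit.dot_le {v : Space d} (hv : SubUnit v) (Z : Space d) :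
    |dot Z v| ≤ ‖Z.1‖ + ‖Z.2‖ := by
  have h1 := abs_real_inner_le_norm Z.1 v.1
  have h2 := abs_real_inner_le_norm Z.2 v.2
  have h3 : ‖Z.1‖ * ‖v.1‖ ≤ ‖Z.1‖ := mul_le_of_le_one_right (norm_nonneg _) hv.1
  have h4 : ‖Z.2‖ * ‖v.2‖ ≤ ‖Z.2‖ := mul_le_of_le_one_right (norm_nonneg _) hv.2
  exact (abs_add_le _ _).trans (by linarith)

theorem SubUnit.dot_sq_le {v : Space d} (hv : SubUnit v) (Z : Space d) :
    dot Z v ^ 2 ≤ 2 * sqLen Z := by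
  have h := hv.dot_le Z
  rw [← sq_abs]
  unfold sqLen
  nlinarith [abs_nonneg (dot Z v), sq_nonneg (‖Z.1‖ - ‖Z.2‖), norm_nonneg Z.1, norm_nonneg Z.2]

/-- Half of the exponent absorbs a quadratic prefactor, since `(1 + q/2) exp(-q/2) ≤ 1`. -/
theorem gaussKer_of_le {C : ℝ} {p : Space d → ℝ} (hp : Continuous p)
    (h : ∀ Z, |p Z| ≤ C * (1 + sqLen Z / 2)) : GaussKer C (fun Z => p Z * gker Z) := by
  refine ⟨by unfold gker; fun_prop, fun Z => ?_⟩
  have h0 := sqLen_nonneg Z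
  have hC : 0 ≤ C := nonneg_of_mul_nonneg_left ((abs_nonneg _).trans (h Z)) (by positivity)
  have e : gker Z = Real.exp (-(1 / 2) * sqLen Z) * Real.exp (-(1 / 2) * sqLen Z) := by
    rw [gker, ← Real.exp_add]; congr 1; ring
  have e1 : (1 + sqLen Z / 2) * Real.exp (-(1 / 2) * sqLen Z) ≤ 1 := by
    have h1 := Real.add_one_le_exp (sqLen Z / 2)
    have h2 : Real.exp (sqLen Z / 2) * Real.exp (-(1 / 2) * sqLen Z) = 1 := exp_mul_exp_eq_one (by ring)
    nlinarith [Real.exp_pos (-(1 / 2) * sqLen Z)]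
  rw [abs_mul, abs_of_pos (show 0 < gker Z from Real.exp_pos _), e, ← mul_assoc]
  refine mul_le_mul_of_nonneg_right ?_ (Real.exp_pos _).le
  calc |p Z| * Real.exp (-(1 / 2) * sqLen Z)
      ≤ C * (1 + sqLen Z / 2) * Real.exp (-(1 / 2) * sqLen Z) :=
        mul_le_mul_of_nonneg_right (h Z) (Real.exp_pos _).le
    _ = C * ((1 + sqLen Z / 2) * Real.exp (-(1 / 2) * sqLen Z)) := by ring
    _ ≤ C * 1 := by gcongr
    _ = C := mul_one C

theorem gaussKer_gker : GaussKer 1 (gker (d := d)) := by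
  have := gaussKer_of_le (d := d) (C := 1) (p := fun _ => 1) (by fun_prop)
    (fun Z => by have := sqLen_nonneg Z; simp; positivity)
  simpa using this

theorem SubUnit.gaussKer_gkerOne {v : Space d} (hv : SubUnit v) : GaussKer 4 (gkerOne v) := by
  refine gaussKer_of_le (by fun_prop) fun Z => ?_
  have h := hv.dot_sq_le Z
  rw [abs_le]
  constructor <;> nlinarith [sq_nonneg (dot Z v - 1), sq_nonneg (dot Z v + 1), sqLen_nonneg Z]

theorem SubUnit.gaussKer_gkerTwo {v w : Space d} (hv : SubUnit v) (hw : SubUnit w) :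
    GaussKer 16 (gkerTwo v w) := by
  refine gaussKer_of_le (by fun_prop) fun Z => ?_
  have h := hv.dot_sq_le Z
  have h' := hw.dot_sq_le Z
  have h2 : |dot v w| ≤ 2 := (hw.dot_le v).trans (by linarith [hv.1, hv.2])
  rw [abs_le] at h2 ⊢
  constructor <;> nlinarith [sq_nonneg (dot Z v - dot Z w), sq_nonneg (dot Z v + dot Z w),
    sqLen_nonneg Z]

theorem hasDerivAt_dot (Z v w : Space d) : HasDerivAt (fun s : ℝ => dot (Z + s • w) v) (dot w v) 0 := by
  have e : (fun s : ℝ => dot (Z + s • w) v) = fun s : ℝ => dot Z v + s * dot w v := by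
    ext s
    simp only [dot, Prod.fst_add, Prod.snd_add, Prod.smul_fst, Prod.smul_snd, inner_add_left,
      real_inner_smul_left]
    ring
  rw [e]
  simpa using ((hasDerivAt_id (0 : ℝ)).mul_const (dot w v)).const_add (dot Z v)

theorem sqLen_eq_dot (Z : Space d) : sqLen Z = dot Z Z := by
  simp [sqLen, dot]

theorem hasDerivAt_sqLen (Z w : Space d) :
    HasDerivAt (fun s : ℝ => sqLen (Z + s • w)) (2 * dot Z w) 0 := by
  have e : (fun s : ℝ => sqLen (Z + s • w)) =
      fun s : ℝ => sqLen Z + s * (2 * dot Z w) + s ^ 2 * sqLen w := by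
    ext s
    rw [sqLen_eq_dot, sqLen_eq_dot, sqLen_eq_dot]
    simp only [dot, Prod.fst_add, Prod.snd_add, Prod.smul_fst, Prod.smul_snd, inner_add_left,
      inner_add_right, real_inner_smul_left, real_inner_smul_right]
    rw [real_inner_comm Z.1 w.1, real_inner_comm Z.2 w.2]
    ring
  rw [e]
  have h1 := ((hasDerivAt_id (0 : ℝ)).mul_const (2 * dot Z w)).const_add (sqLen Z)
  have h2 := (hasDerivAt_pow 2 (0 : ℝ)).mul_const (sqLen w)
  simpa using h1.fun_add h2

theorem dirDeriv_gker (v : Space d) : DirDeriv v gker (fun Z => -gkerOne v Z) := by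
  intro Z
  have h := (hasDerivAt_sqLen Z v).fun_neg.exp
  refine h.congr_deriv ?_
  simp only [zero_smul, add_zero, gkerOne, gker]
  ring

theorem dirDeriv_gkerOne (v w : Space d) :
    DirDeriv w (gkerOne v) (fun Z => -gkerTwo v w Z) := by
  intro Z
  have h := ((hasDerivAt_dot Z v w).const_mul 2).mul (dirDeriv_gker w Z)
  refine h.congr_deriv ?_
  simp only [zero_smul, add_zero, gkerOne, gkerTwo, dot_comm w v]
  ring

theorem differentiable_sqLen : Differentiable ℝ (sqLen (d := d)) := by
  unfold sqLen
  exact (differentiable_fst.norm_sq ℝ).add (differentiable_snd.norm_sq ℝ)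

theorem differentiable_gker : Differentiable ℝ (gker (d := d)) := by
  unfold gker
  exact differentiable_sqLen.neg.exp

theorem differentiable_gkerOne (v : Space d) : Differentiable ℝ (gkerOne v) := by
  unfold gkerOne
  refine Differentiable.mul ?_ differentiable_gker
  refine Differentiable.const_mul ?_ 2
  unfold dot
  exact (differentiable_fst.inner ℝ (differentiable_const _)).add
    (differentiable_snd.inner ℝ (differentiable_const _))

/-- The standard basis of `ℝ^{d+1} × ℝ³`. -/
noncomputable def basisVec : Fin (d + 1) ⊕ Fin 3 → Space d
  | .inl i => (EuclideanSpace.single i 1, 0)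
  | .inr j => (0, EuclideanSpace.single j 1)

theorem subUnit_basisVec (i : Fin (d + 1) ⊕ Fin 3) : SubUnit (basisVec i) := by
  cases i <;> simp [SubUnit, basisVec]

theorem sum_gkerTwo (Z : Space d) : ∑ i, gkerTwo (basisVec i) (basisVec i) Z = gkerLap Z := by
  have h1 : ‖Z.1‖ ^ 2 = ∑ i, Z.1 i ^ 2 := by simp [EuclideanSpace.norm_sq_eq]
  have h2 : ‖Z.2‖ ^ 2 = ∑ i, Z.2 i ^ 2 := by simp [EuclideanSpace.norm_sq_eq]
  simp only [gkerTwo, gkerLap, ← Finset.sum_mul, Fintype.sum_sum_type, sqLen, h1, h2]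
  congr 1
  have e1 : ∀ i, dot Z (basisVec (.inl i)) = Z.1 i := fun i => by
    simp [dot, basisVec, EuclideanSpace.inner_single_right]
  have e2 : ∀ i, dot Z (basisVec (.inr i)) = Z.2 i := fun i => by
    simp [dot, basisVec, EuclideanSpace.inner_single_right]
  have e3 : ∀ i, dot (basisVec i) (basisVec (d := d) i) = 1 := fun i => by
    cases i <;> simp [dot, basisVec]
  simp only [e1, e2, e3, Finset.sum_sub_distrib, mul_add, Finset.mul_sum]
  simp
  have e4 : ∀ x : ℝ, 4 * x * x = 4 * x ^ 2 := fun x => by ring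
  simp only [e4]
  ring

theorem smear_sum_gkerTwo {f : Space d → ℝ} (hf : GaussInt f) {l : ℝ} (hl : 0 < l) (X : Space d) :
    ∑ i, smear (gkerTwo (basisVec i) (basisVec i)) f l X = smear gkerLap f l X := by
  unfold smear
  rw [← integral_finsetSum]
  · congr 1
    ext Z
    rw [← sum_gkerTwo, Finset.sum_mul]
  · intro i _
    exact ((subUnit_basisVec i).gaussKer_gkerTwo (subUnit_basisVec i)).integrable hf hl X

theorem finrank_space : Module.finrank ℝ (Space d) = d + 4 := by
  rw [Module.finrank_prod]; simp

theorem integral_gker : ∫ Z : Space d, gker Z = Real.pi ^ (((d : ℝ) + 4) / 2) := by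
  have e : ∀ Z : Space d, gker Z = Real.exp (-1 * ‖Z.1‖ ^ 2) * Real.exp (-1 * ‖Z.2‖ ^ 2) := by
    intro Z
    rw [gker, sqLen, ← Real.exp_add]; congr 1; ring
  simp only [e]
  have := integral_prod_mul (μ := (volume : Measure (EuclideanSpace ℝ (Fin (d + 1)))))
      (ν := (volume : Measure (EuclideanSpace ℝ (Fin 3))))
      (fun Z => Real.exp (-1 * ‖Z‖ ^ 2)) (fun Z => Real.exp (-1 * ‖Z‖ ^ 2))
  refine (show _ = _ from this).trans ?_
  rw [GaussianFourier.integral_rexp_neg_mul_sq_norm one_pos,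
    GaussianFourier.integral_rexp_neg_mul_sq_norm one_pos, div_one,
    ← Real.rpow_add Real.pi_pos]
  congr 1
  simp
  ring

theorem integral_comp_dilation (F : Space d → ℝ) {c : ℝ} (hc : 0 < c) :
    ∫ Z : Space d, F Z = c ^ (d + 4) * ∫ Z : Space d, F (c • Z) := by
  rw [Measure.integral_comp_smul, finrank_space, abs_of_pos (by positivity), smul_eq_mul,
    ← mul_assoc, mul_inv_cancel₀ (by positivity), one_mul]

/-- The heat equation in the scale variable. -/
theorem hasDerivAt_smear_scale {f : Space d → ℝ} (hf : GaussInt f) {l : ℝ} (hl : 0 < l)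
    (X : Space d) :
    HasDerivAt (fun l => smear gker f l X) (1 / (2 * l) * smear gkerLap f l X) l := by
  have hm := hf.measurable
  set N : ℕ := d + 4 with hN
  -- Rescaling `Z` keeps the argument of `f` at the fixed scale `l`, so the variable scale enters
  -- only through the smooth kernel, via `c = l / l'`.
  have hrep : ∀ l' : ℝ, 0 < l' → smear gker f l' X =
      ∫ Z : Space d, ((l / l') ^ N * Real.exp (-((l / l') ^ 2 * sqLen Z))) * f (X + l • Z) := by
    intro l' hl'
    unfold smear
    rw [integral_comp_dilation _ (div_pos hl hl'), ← integral_const_mul]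
    congr 1
    ext Z
    rw [gker, sqLen_smul, smul_smul, mul_div_cancel₀ l hl'.ne']
    ring
  have hder : HasDerivAt (fun c : ℝ => ∫ Z : Space d,
      (c ^ N * Real.exp (-(c ^ 2 * sqLen Z))) * f (X + l • Z))
      (∫ Z : Space d, ((N * (1 : ℝ) ^ (N - 1) * Real.exp (-(1 ^ 2 * sqLen Z)) + 1 ^ N *
        (Real.exp (-(1 ^ 2 * sqLen Z)) * (-(2 * 1 * sqLen Z))))) * f (X + l • Z)) 1 := by
    -- On this ball `c² ≥ 1/2`, which leaves two factors `exp(-|Z|²/4)`: one absorbs the factor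
    -- `|Z|²` from the derivative, the other makes `f` integrable.
    refine (hasDerivAt_integral_of_dominated_loc_of_deriv_le (s := Metric.ball 1 (1 / 4))
      (F' := fun (c : ℝ) (Z : Space d) => ((N * c ^ (N - 1) * Real.exp (-(c ^ 2 * sqLen Z)) +
        c ^ N * (Real.exp (-(c ^ 2 * sqLen Z)) * (-(2 * c * sqLen Z))))) * f (X + l • Z))
      (bound := fun Z => (N * 2 ^ (N - 1) + 2 ^ N * 16) *
        ‖Real.exp (-(1 / 4) * sqLen Z) * f (X + l • Z)‖)
      (Metric.ball_mem_nhds _ (by norm_num))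
      (.of_forall fun s => Measurable.aestronglyMeasurable (by fun_prop))
      ?_ (Measurable.aestronglyMeasurable (by fun_prop)) ?_ ?_ ?_).2
    · simpa [gker] using gaussKer_gker.integrable hf hl X
    · refine .of_forall fun Z c hc => ?_
      have hc1 : |c - 1| < 1 / 4 := by simpa [Real.dist_eq] using hc
      rw [abs_lt] at hc1
      have hc0 : 0 < c := by linarith
      have hc2 : c ≤ 2 := by linarith
      have hq := sqLen_nonneg Z
      rw [norm_mul, norm_mul, Real.norm_of_nonneg (Real.exp_pos (-(1 / 4) * sqLen Z)).le,
        ← mul_assoc ((N : ℝ) * 2 ^ (N - 1) + 2 ^ N * 16)]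
      refine mul_le_mul_of_nonneg_right ?_ (norm_nonneg (f (X + l • Z)))
      have he : Real.exp (-(c ^ 2 * sqLen Z)) ≤
          Real.exp (-(1 / 4) * sqLen Z) * Real.exp (-(1 / 4) * sqLen Z) := by
        rw [← Real.exp_add]
        refine Real.exp_le_exp.2 ?_
        have hcc : 1 / 2 ≤ c ^ 2 := by nlinarith
        linarith [mul_le_mul_of_nonneg_right hcc hq]
      have he1 : Real.exp (-(1 / 4) * sqLen Z) ≤ 1 := Real.exp_le_one_iff.2 (by linarith)
      have he2 : Real.exp (-(1 / 4) * sqLen Z) * (2 * c * sqLen Z) ≤ 16 := by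
        have h1 := Real.add_one_le_exp (1 / 4 * sqLen Z)
        have h2 : Real.exp (-(1 / 4) * sqLen Z) * Real.exp (1 / 4 * sqLen Z) = 1 := exp_mul_exp_eq_one (by ring)
        have h3 : 2 * c * sqLen Z ≤ 16 * Real.exp (1 / 4 * sqLen Z) := by nlinarith
        calc _ ≤ Real.exp (-(1 / 4) * sqLen Z) * (16 * Real.exp (1 / 4 * sqLen Z)) := by gcongr
          _ = 16 := by rw [mul_left_comm, h2, mul_one]
      set e := Real.exp (-(1 / 4) * sqLen Z) with hedef
      have he0 : 0 < e := Real.exp_pos _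
      refine (norm_add_le _ _).trans ?_
      calc ‖(N : ℝ) * c ^ (N - 1) * Real.exp (-(c ^ 2 * sqLen Z))‖ +
            ‖c ^ N * (Real.exp (-(c ^ 2 * sqLen Z)) * (-(2 * c * sqLen Z)))‖
          = N * c ^ (N - 1) * Real.exp (-(c ^ 2 * sqLen Z)) +
            c ^ N * (Real.exp (-(c ^ 2 * sqLen Z)) * (2 * c * sqLen Z)) := by
            rw [Real.norm_of_nonneg (by positivity), norm_mul, norm_mul, norm_neg,
              Real.norm_of_nonneg (by positivity), Real.norm_of_nonneg (Real.exp_pos _).le,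
              Real.norm_of_nonneg (by positivity)]
        _ ≤ N * 2 ^ (N - 1) * (e * e) + 2 ^ N * ((e * e) * (2 * c * sqLen Z)) := by gcongr
        _ ≤ N * 2 ^ (N - 1) * (e * 1) + 2 ^ N * (e * 16) := by
            rw [mul_assoc e e (2 * c * sqLen Z)]; gcongr
        _ = _ := by ring
    · exact ((hf.integrable l hl X).norm).const_mul _
    · refine .of_forall fun Z c _ => HasDerivAt.mul_const ?_ _
      refine (hasDerivAt_pow N c).mul ?_
      have := ((hasDerivAt_pow 2 c).mul_const (sqLen Z)).fun_neg.exp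
      simpa using this
  -- At `c = 1` the derivative of the kernel is `(N - 2|Z|²) exp(-|Z|²)`, which is `-1/2` times the
  -- Laplacian of the Gaussian because `N = d + 4` is the dimension.
  have hder' : HasDerivAt (fun c : ℝ => ∫ Z : Space d,
      (c ^ N * Real.exp (-(c ^ 2 * sqLen Z))) * f (X + l • Z))
      (-(1 / 2) * smear gkerLap f l X) 1 := by
    refine hder.congr_deriv ?_
    unfold smear
    rw [← integral_const_mul]
    congr 1
    ext Z
    simp only [gkerLap, gker, hN]
    push_cast
    simp
    ring
  have hinv : HasDerivAt (fun l' : ℝ => l / l') (-(1 / l)) l := by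
    have := (hasDerivAt_inv hl.ne').const_mul l
    simp only [← div_eq_mul_inv] at this
    refine this.congr_deriv ?_
    field_simp
  rw [← div_self hl.ne'] at hder'
  have hcomp := HasDerivAt.comp (h := fun l' : ℝ => l / l') l hder' hinv
  refine (hcomp.congr_of_eventuallyEq ?_).congr_deriv ?_
  · filter_upwards [lt_mem_nhds hl] with l' hl'
    exact hrep l' hl'
  · field_simp

/-! ### The Gaussian as an approximate identity. -/

theorem norm_sq_le_sqLen (Z : Space d) : ‖Z‖ ^ 2 ≤ sqLen Z := by
  rw [Prod.norm_def, sqLen]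
  rcases max_cases ‖Z.1‖ ‖Z.2‖ with h | h <;> rw [h.1] <;> nlinarith [sq_nonneg ‖Z.1‖, sq_nonneg ‖Z.2‖]

/-- At distance at least `δ` from the centre three quarters of the Gaussian exponent are traded for
the small factor `l²/δ²`. -/
theorem gker_le_of_far {l δ : ℝ} (hδ : 0 < δ) {Z : Space d} (hq : δ ^ 2 ≤ l ^ 2 * sqLen Z) :
    gker Z ≤ 2 * l ^ 2 / δ ^ 2 * Real.exp (-(1 / 4) * sqLen Z) := by
  have h0 := sqLen_nonneg Z
  have e1 : gker Z = Real.exp (-(3 / 4) * sqLen Z) * Real.exp (-(1 / 4) * sqLen Z) := by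
    rw [gker, ← Real.exp_add]; congr 1; ring
  rw [e1]
  refine mul_le_mul_of_nonneg_right ?_ (Real.exp_pos _).le
  rw [le_div_iff₀ (by positivity)]
  have h1 := Real.add_one_le_exp (3 / 4 * sqLen Z)
  have h2 : Real.exp (-(3 / 4) * sqLen Z) * Real.exp (3 / 4 * sqLen Z) = 1 :=
    exp_mul_exp_eq_one (by ring)
  generalize Real.exp (-(3 / 4) * sqLen Z) = E at *
  generalize Real.exp (3 / 4 * sqLen Z) = E' at *
  have hE : 0 < E := by
    by_contra hneg
    have : E * E' ≤ 0 := mul_nonpos_of_nonpos_of_nonneg (not_lt.1 hneg) (by linarith)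
    linarith
  have h3 : E * sqLen Z ≤ 2 := by
    have := mul_le_mul_of_nonneg_left h1 hE.le
    linarith
  calc E * δ ^ 2 ≤ E * (l ^ 2 * sqLen Z) := by gcongr
    _ = l ^ 2 * (E * sqLen Z) := by ring
    _ ≤ l ^ 2 * 2 := by gcongr
    _ = _ := by ring

theorem integrable_gker : Integrable (gker (d := d)) := by
  refine not_imp_comm.1 integral_undef ?_
  rw [integral_gker]
  positivity

theorem integrable_exp_quarter : Integrable fun Z : Space d => Real.exp (-(1 / 4) * sqLen Z) := by
  have h := (integrable_exp_neg_mul_sq_norm (n := d + 1) (b := 1 / 4) (by norm_num)).mul_prod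
    (integrable_exp_neg_mul_sq_norm (n := 3) (b := 1 / 4) (by norm_num))
  refine h.congr (.of_forall fun Z => ?_)
  simp only [sqLen, ← Real.exp_add]
  congr 1
  ring

theorem GaussInt.abs {f : Space d → ℝ} (hf : GaussInt f) : GaussInt (fun Y => |f Y|) :=
  ⟨hf.measurable.abs, fun l hl Z => by
    simpa [abs_mul, abs_of_pos (Real.exp_pos _)] using (hf.integrable l hl Z).abs⟩

theorem gaussInt_const (c : ℝ) : GaussInt (fun _ : Space d => c) :=
  ⟨measurable_const, fun _ _ _ => integrable_exp_quarter.mul_const c⟩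

/-- Continuity at the single point `X` handles nearby arguments. Far arguments carry the factor
`l²`, so even averages of `|f|` growing like `1/l` are harmless and `f` may be unbounded. -/
theorem tendsto_smear_zero {f : Space d → ℝ} (hf : GaussInt f) {X : Space d}
    (hcont : ContinuousAt f X) {K : ℝ}
    (hK : ∀ l : ℝ, 0 < l → l < 1 → avg (fun Y => |f Y|) l X ≤ K * l⁻¹) :
    Tendsto (fun l => smear gker f l X) (𝓝[>] 0) (𝓝 (f X * ∫ Z : Space d, gker Z)) := by
  have hGpos : 0 < ∫ Z : Space d, gker Z := by rw [integral_gker]; positivity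
  obtain ⟨G, hG⟩ : ∃ G, G = ∫ Z : Space d, gker Z := ⟨_, rfl⟩
  rw [← hG] at hGpos ⊢
  rw [Metric.tendsto_nhdsWithin_nhds]
  intro ε hε
  obtain ⟨δ, hδ, hδf⟩ := Metric.continuousAt_iff.1 hcont (ε / (2 * G)) (by positivity)
  have hpt : ∀ l : ℝ, 0 < l → ∀ Z : Space d,
      ‖gker Z * f (X + l • Z) - f X * gker Z‖ ≤ ε / (2 * G) * gker Z +
        2 * l ^ 2 / δ ^ 2 * (Real.exp (-(1 / 4) * sqLen Z) * (|f (X + l • Z)| + |f X|)) := by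
    intro l hl Z
    have hg : 0 < gker Z := Real.exp_pos _
    have e : gker Z * f (X + l • Z) - f X * gker Z = gker Z * (f (X + l • Z) - f X) := by ring
    rw [e, Real.norm_eq_abs, abs_mul, abs_of_pos hg]
    have h3 : 0 ≤ 2 * l ^ 2 / δ ^ 2 *
        (Real.exp (-(1 / 4) * sqLen Z) * (|f (X + l • Z)| + |f X|)) := by positivity
    have h6 : 0 ≤ ε / (2 * G) * gker Z := by positivity
    by_cases hd' : dist (X + l • Z) X < δ
    · have h1 := (hδf hd').le
      rw [Real.dist_eq] at h1
      linarith [mul_le_mul_of_nonneg_left h1 hg.le, mul_comm (gker Z) (ε / (2 * G))]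
    · have hq : δ ^ 2 ≤ l ^ 2 * sqLen Z := by
        rw [dist_self_add_left, norm_smul, Real.norm_of_nonneg hl.le, not_lt] at hd'
        calc δ ^ 2 ≤ (l * ‖Z‖) ^ 2 := by gcongr
          _ = l ^ 2 * ‖Z‖ ^ 2 := by ring
          _ ≤ _ := by gcongr; exact norm_sq_le_sqLen Z
      have h5 : |f (X + l • Z) - f X| ≤ |f (X + l • Z)| + |f X| := abs_sub _ _
      have h7 := mul_le_mul (gker_le_of_far hδ hq) h5 (abs_nonneg _) (by positivity)
      rw [mul_assoc] at h7
      linarith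
  have habs := hf.abs
  have hsum : GaussInt (fun Y => |f Y| + |f X|) := habs.add (gaussInt_const _)
  obtain ⟨Q, hQ⟩ : ∃ Q, Q = avg (fun _ : Space d => |f X|) 1 X := ⟨_, rfl⟩
  have hQ0 : 0 ≤ Q := by
    rw [hQ]; exact integral_nonneg fun Z => by positivity
  have hmain : ∀ l : ℝ, 0 < l → l < 1 →
      |smear gker f l X - f X * G| ≤ ε / 2 + 2 * (|K| + Q) / δ ^ 2 * l := by
    intro l hl hl1
    have e1 : smear gker f l X - f X * G = ∫ Z, (gker Z * f (X + l • Z) - f X * gker Z) := by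
      rw [integral_sub (gaussKer_gker.integrable hf hl X) (integrable_gker.const_mul _),
        integral_const_mul, ← hG]
      rfl
    have i1 := (integrable_gker (d := d)).const_mul (ε / (2 * G))
    have i2 := (hsum.integrable l hl X).const_mul (2 * l ^ 2 / δ ^ 2)
    have h1 := norm_integral_le_of_norm_le (i1.add i2) (.of_forall (hpt l hl))
    rw [e1, ← Real.norm_eq_abs]
    refine h1.trans ?_
    have h2 : ∫ Z : Space d, (ε / (2 * G) * gker Z + 2 * l ^ 2 / δ ^ 2 *
        (Real.exp (-(1 / 4) * sqLen Z) * (|f (X + l • Z)| + |f X|))) =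
        ε / 2 + 2 * l ^ 2 / δ ^ 2 * (avg (fun Y => |f Y|) l X + Q) := by
      rw [integral_add i1 i2, integral_const_mul, integral_const_mul, ← hG]
      have h3 := avg_add habs (gaussInt_const |f X|) hl X
      have h4 : avg (fun _ : Space d => |f X|) l X = Q := by rw [hQ]; rfl
      rw [h4] at h3
      rw [← h3]
      have : ε / (2 * G) * G = ε / 2 := by field_simp
      rw [this]
      rfl
    refine (le_of_eq h2).trans ?_
    have h5 : avg (fun Y => |f Y|) l X + Q ≤ (|K| + Q) * l⁻¹ := by
      have h6 := hK l hl hl1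
      have h7 : 1 ≤ l⁻¹ := (one_le_inv₀ hl).2 hl1.le
      have h8 : K * l⁻¹ ≤ |K| * l⁻¹ := by gcongr; exact le_abs_self K
      nlinarith
    have h9 : 2 * l ^ 2 / δ ^ 2 * (avg (fun Y => |f Y|) l X + Q) ≤
        2 * l ^ 2 / δ ^ 2 * ((|K| + Q) * l⁻¹) := by gcongr
    have h10 : 2 * l ^ 2 / δ ^ 2 * ((|K| + Q) * l⁻¹) = 2 * (|K| + Q) / δ ^ 2 * l := by
      field_simp
    linarith
  obtain ⟨A, hA⟩ : ∃ A, A = 2 * (|K| + Q) / δ ^ 2 := ⟨_, rfl⟩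
  have hA0 : 0 ≤ A := by rw [hA]; positivity
  refine ⟨min 1 (ε / (2 * (A + 1))), by positivity, fun {l} hl hl1 => ?_⟩
  have hl0 : 0 < l := hl
  rw [Real.dist_eq, sub_zero, abs_of_pos hl0, lt_min_iff, lt_div_iff₀ (by positivity)] at hl1
  rw [Real.dist_eq]
  refine (hmain l hl0 hl1.1).trans_lt ?_
  rw [← hA]
  nlinarith

end

section

variable {d : ℕ}

/-! ### Functions of the two radii with power bounds -/

/-- Admissible exponents, quantitatively. -/
structure Exponents (θ t s β : ℝ) : Prop where
  pos : 0 < θ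
  le_t : θ ≤ t
  t_le : t ≤ s
  s_le : s ≤ 1 - θ
  le_β : 1 + θ ≤ β
  β_le : β ≤ 2 - θ
  sum_gt : 2 < t + β
  sum_le : t + β ≤ 3

/-- A positive `C¹` function on the quadrant with the upper bounds and logarithmic derivative
bounds of the source of the potential. -/
structure Source (t s β C : ℝ) (w : ℝ × ℝ → ℝ) : Prop where
  contDiffOn : ContDiffOn ℝ 1 w quadrant
  pos : ∀ p ∈ quadrant, 0 < w p
  upper : ∀ p ∈ quadrant,
    w p ≤ C * (p.1 ^ (-t) * (1 + p.2) ^ (-β) + if p.2 < 1 / 2 then p.1 ^ (-s) else 0)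
  dr_le : ∀ p ∈ quadrant, |fderiv ℝ w p (1, 0)| ≤ C * (w p * p.1⁻¹)
  dz_le : ∀ p ∈ quadrant, |fderiv ℝ w p (0, 1)| ≤ C * (w p * p.2⁻¹)

theorem isOpen_quadrant : IsOpen quadrant :=
  (isOpen_lt continuous_const continuous_fst).inter (isOpen_lt continuous_const continuous_snd)

theorem quadrant_mem_nhds {p : ℝ × ℝ} (hp : p ∈ quadrant) : quadrant ∈ 𝓝 p :=
  isOpen_quadrant.mem_nhds hp

/-- The complement of the two axes. -/
def offAxes (d : ℕ) : Set (Space d) := {Y | Y.1 ≠ 0 ∧ Y.2 ≠ 0}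

theorem isOpen_offAxes : IsOpen (offAxes d) :=
  (isOpen_ne_fun continuous_fst continuous_const).inter
    (isOpen_ne_fun continuous_snd continuous_const)

/-- The pair of radii. -/
noncomputable def radii (Y : Space d) : ℝ × ℝ := (‖Y.1‖, ‖Y.2‖)

@[fun_prop]
theorem continuous_radii : Continuous (radii (d := d)) := by unfold radii; fun_prop

theorem radii_mem {Y : Space d} (hY : Y ∈ offAxes d) : radii Y ∈ quadrant :=
  ⟨norm_pos_iff.2 hY.1, norm_pos_iff.2 hY.2⟩

/-- The function `w(|ξ|, |η|)`, set to zero on the axes. -/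
noncomputable def lift (w : ℝ × ℝ → ℝ) : Space d → ℝ :=
  (offAxes d).indicator fun Y => w (radii Y)

/-- The derivative of `w(|ξ|, |η|)` in the direction `v`, set to zero on the axes. -/
noncomputable def dirLift (w : ℝ × ℝ → ℝ) (v : Space d) : Space d → ℝ :=
  (offAxes d).indicator fun Y =>
    fderiv ℝ w (radii Y) (inner ℝ Y.1 v.1 / ‖Y.1‖, inner ℝ Y.2 v.2 / ‖Y.2‖)

theorem measurable_indicator_of_continuousOn {S : Set (Space d)} (hS : IsOpen S)
    {f : Space d → ℝ} (hf : ContinuousOn f S) : Measurable (S.indicator f) := by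
  classical
  rw [← piecewise_eq_indicator]
  exact hf.measurable_piecewise continuousOn_const hS.measurableSet

section

variable {t s β C : ℝ} {w : ℝ × ℝ → ℝ}

theorem Source.differentiableAt (hw : Source t s β C w) {p : ℝ × ℝ} (hp : p ∈ quadrant) :
    DifferentiableAt ℝ w p :=
  (hw.contDiffOn.differentiableOn one_ne_zero).differentiableAt (quadrant_mem_nhds hp)

theorem Source.continuousOn_fderiv (hw : Source t s β C w) :
    ContinuousOn (fderiv ℝ w) quadrant :=
  hw.contDiffOn.continuousOn_fderiv_of_isOpen isOpen_quadrant le_rfl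

theorem Source.nonneg_const (hw : Source t s β C w) : 0 ≤ C := by
  have h := hw.dr_le (1, 1) (by simp [quadrant])
  have h1 := hw.pos (1, 1) (by simp [quadrant])
  have h2 := (abs_nonneg _).trans h
  simp only [inv_one, mul_one] at h2
  exact nonneg_of_mul_nonneg_left h2 h1

theorem Source.continuousOn_comp_radii (hw : Source t s β C w) :
    ContinuousOn (fun Y : Space d => w (radii Y)) (offAxes d) :=
  hw.contDiffOn.continuousOn.comp continuous_radii.continuousOn fun _ hY => radii_mem hY

theorem Source.measurable_lift (hw : Source t s β C w) : Measurable (lift (d := d) w) :=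
  measurable_indicator_of_continuousOn isOpen_offAxes hw.continuousOn_comp_radii

theorem Source.continuousAt_lift (hw : Source t s β C w) {Y : Space d} (hY : Y ∈ offAxes d) :
    ContinuousAt (lift (d := d) w) Y := by
  have h := hw.continuousOn_comp_radii.continuousAt (isOpen_offAxes.mem_nhds hY)
  refine h.congr ?_
  filter_upwards [isOpen_offAxes.mem_nhds hY] with Z hZ
  exact (indicator_of_mem hZ (fun Y => w (radii Y))).symm

theorem Source.measurable_dirLift (hw : Source t s β C w) (v : Space d) :
    Measurable (dirLift w v) := by
  refine measurable_indicator_of_continuousOn isOpen_offAxes ?_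
  refine ContinuousOn.clm_apply (hw.continuousOn_fderiv.comp continuous_radii.continuousOn
    fun _ hY => radii_mem hY) ?_
  refine ContinuousOn.prodMk ?_ ?_
  · exact ContinuousOn.div (by fun_prop) (by fun_prop) fun Y hY => norm_ne_zero_iff.2 hY.1
  · exact ContinuousOn.div (by fun_prop) (by fun_prop) fun Y hY => norm_ne_zero_iff.2 hY.2

theorem Source.lift_nonneg (hw : Source t s β C w) (Y : Space d) : 0 ≤ lift w Y :=
  indicator_nonneg (fun _ hY => (hw.pos _ (radii_mem hY)).le) Y

theorem Source.upper_crude (hw : Source t s β C w) (hβ : 0 ≤ β) {p : ℝ × ℝ} (hp : p ∈ quadrant) :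
    w p ≤ C * (p.1 ^ (-t) + p.1 ^ (-s)) := by
  refine (hw.upper p hp).trans (mul_le_mul_of_nonneg_left ?_ hw.nonneg_const)
  have h1 : 0 < p.1 := hp.1
  have h2 : 0 < p.2 := hp.2
  have h3 : (1 + p.2) ^ (-β) ≤ 1 := Real.rpow_le_one_of_one_le_of_nonpos (by linarith) (by linarith)
  have h4 : p.1 ^ (-t) * (1 + p.2) ^ (-β) ≤ p.1 ^ (-t) := mul_le_of_le_one_right (by positivity) h3
  have h5 : 0 ≤ p.1 ^ (-s) := by positivity
  split_ifs <;> linarith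

theorem Source.abs_fderiv_le (hw : Source t s β C w) {p : ℝ × ℝ} (hp : p ∈ quadrant) (a b : ℝ) :
    |fderiv ℝ w p (a, b)| ≤ C * (w p * (p.1⁻¹ * |a| + p.2⁻¹ * |b|)) := by
  have e : fderiv ℝ w p (a, b) = a * fderiv ℝ w p (1, 0) + b * fderiv ℝ w p (0, 1) := by
    have : ((a, b) : ℝ × ℝ) = a • (1, 0) + b • (0, 1) := by simp
    rw [this, map_add, map_smul, map_smul, smul_eq_mul, smul_eq_mul]
  rw [e]
  refine (abs_add_le _ _).trans ?_
  rw [abs_mul, abs_mul]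
  calc _ ≤ |a| * (C * (w p * p.1⁻¹)) + |b| * (C * (w p * p.2⁻¹)) := by
        gcongr
        · exact hw.dr_le p hp
        · exact hw.dz_le p hp
    _ = _ := by ring

end

theorem ae_mem_offAxes {l : ℝ} (hl : 0 < l) (X : Space d) :
    ∀ᵐ Z : Space d, X + l • Z ∈ offAxes d := by
  have h1 : ∀ᵐ Z : Space d, Z.1 ≠ -(l⁻¹ • X.1) := by
    have : ∀ᵐ z : EuclideanSpace ℝ (Fin (d + 1)), z ≠ -(l⁻¹ • X.1) := by rw [ae_iff]; simp
    exact Measure.quasiMeasurePreserving_fst.ae this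
  have h2 : ∀ᵐ Z : Space d, Z.2 ≠ -(l⁻¹ • X.2) := by
    have : ∀ᵐ z : EuclideanSpace ℝ (Fin 3), z ≠ -(l⁻¹ • X.2) := by rw [ae_iff]; simp
    exact Measure.quasiMeasurePreserving_snd.ae this
  filter_upwards [h1, h2] with Z hZ1 hZ2
  refine ⟨fun h => hZ1 ?_, fun h => hZ2 ?_⟩
  · have h' : X.1 + l • Z.1 = 0 := h
    rw [← smul_neg, ← eq_neg_of_add_eq_zero_right h', smul_smul, inv_mul_cancel₀ hl.ne', one_smul]
  · have h' : X.2 + l • Z.2 = 0 := h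
    rw [← smul_neg, ← eq_neg_of_add_eq_zero_right h', smul_smul, inv_mul_cancel₀ hl.ne', one_smul]

/-! ### Integration by parts -/

/-- The regularized norm `(|x|² + ε)^{1/2}`. -/
noncomputable def regNorm {n : ℕ} (ε : ℝ) (x : EuclideanSpace ℝ (Fin n)) : ℝ := √(‖x‖ ^ 2 + ε)

theorem regNorm_pos {n : ℕ} {ε : ℝ} (hε : 0 < ε) (x : EuclideanSpace ℝ (Fin n)) :
    0 < regNorm ε x := Real.sqrt_pos.2 (by positivity)

theorem norm_le_regNorm {n : ℕ} {ε : ℝ} (hε : 0 < ε) (x : EuclideanSpace ℝ (Fin n)) :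
    ‖x‖ ≤ regNorm ε x := Real.le_sqrt_of_sq_le (by linarith)

theorem differentiable_regNorm {n : ℕ} {ε : ℝ} (hε : 0 < ε) :
    Differentiable ℝ (regNorm (n := n) ε) := by
  intro x
  unfold regNorm
  exact (((differentiable_id.norm_sq ℝ).add_const ε) x).sqrt (by positivity)

theorem hasDerivAt_regNorm {n : ℕ} {ε : ℝ} (hε : 0 < ε) (x v : EuclideanSpace ℝ (Fin n)) :
    HasDerivAt (fun s : ℝ => regNorm ε (x + s • v)) (inner ℝ x v / regNorm ε x) 0 := by
  have e : (fun s : ℝ => ‖x + s • v‖ ^ 2 + ε) =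
      fun s : ℝ => ‖x‖ ^ 2 + ε + s * (2 * inner ℝ x v) + s ^ 2 * ‖v‖ ^ 2 := by
    ext s
    rw [norm_add_sq_real, norm_smul, inner_smul_right, mul_pow, Real.norm_eq_abs, sq_abs]
    ring
  have h1 : HasDerivAt (fun s : ℝ => ‖x + s • v‖ ^ 2 + ε) (2 * inner ℝ x v) 0 := by
    rw [e]
    have h1 := ((hasDerivAt_id (0 : ℝ)).mul_const (2 * inner ℝ x v)).const_add (‖x‖ ^ 2 + ε)
    have h2 := (hasDerivAt_pow 2 (0 : ℝ)).mul_const (‖v‖ ^ 2)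
    simpa using h1.fun_add h2
  have h2 := h1.sqrt (by simp; positivity)
  unfold regNorm
  refine h2.congr_deriv ?_
  simp only [zero_smul, add_zero]
  rw [mul_div_mul_left _ _ two_ne_zero]

theorem tendsto_regNorm {n : ℕ} (x : EuclideanSpace ℝ (Fin n)) :
    Tendsto (fun k : ℕ => regNorm (1 / ((k : ℝ) + 1)) x) atTop (𝓝 ‖x‖) := by
  have h : Tendsto (fun k : ℕ => √(‖x‖ ^ 2 + 1 / ((k : ℝ) + 1))) atTop (𝓝 √(‖x‖ ^ 2 + 0)) :=
    (Real.continuous_sqrt.tendsto _).comp (tendsto_one_div_add_atTop_nhds_zero_nat.const_add _)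
  rwa [add_zero, Real.sqrt_sq (norm_nonneg x)] at h

/-- The regularized pair of radii. -/
noncomputable def regRadii (ε : ℝ) (Y : Space d) : ℝ × ℝ := (regNorm ε Y.1, regNorm ε Y.2)

theorem regRadii_mem {ε : ℝ} (hε : 0 < ε) (Y : Space d) : regRadii ε Y ∈ quadrant :=
  ⟨regNorm_pos hε _, regNorm_pos hε _⟩

theorem differentiable_regRadii {ε : ℝ} (hε : 0 < ε) :
    Differentiable ℝ (regRadii (d := d) ε) :=
  ((differentiable_regNorm hε).comp differentiable_fst).prodMk
    ((differentiable_regNorm hε).comp differentiable_snd)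

theorem hasDerivAt_regRadii {ε : ℝ} (hε : 0 < ε) (Y v : Space d) :
    HasDerivAt (fun s : ℝ => regRadii ε (Y + s • v))
      (inner ℝ Y.1 v.1 / regNorm ε Y.1, inner ℝ Y.2 v.2 / regNorm ε Y.2) 0 :=
  (hasDerivAt_regNorm hε Y.1 v.1).prodMk (hasDerivAt_regNorm hε Y.2 v.2)

section

variable {θ t s β C : ℝ} {w : ℝ × ℝ → ℝ}

/-- The majorant of the source and of its gradient used for qualitative statements. -/
noncomputable def crude (t s : ℝ) (Y : Space d) : ℝ :=
  (powProd t 0 0 Y + powProd s 0 0 Y) + ((powProd (1 + t) 0 0 Y + powProd (1 + s) 0 0 Y) +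
    (powProd t 0 1 Y + powProd s 0 1 Y))

theorem gaussInt_crude (hd : 3 ≤ d) (he : Exponents θ t s β) : GaussInt (crude (d := d) t s) := by
  obtain ⟨K, -, h⟩ := exists_avg_powProd_le hd
  have h0 := he.pos
  have h1 := he.le_t
  have h2 := he.t_le
  have h3 := he.s_le
  refine GaussInt.add (GaussInt.add ?_ ?_) (GaussInt.add (GaussInt.add ?_ ?_) (GaussInt.add ?_ ?_)) <;>
    refine (h _ _ _ ?_ ?_ le_rfl ?_ ?_).1 <;> linarith

theorem powProd_zero_eq {α α' : ℝ} (Y : Space d) : powProd α 0 α' Y = ‖Y.1‖ ^ (-α) * ‖Y.2‖ ^ (-α') := by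
  rw [powProd, zero_add]

theorem crude_nonneg (Y : Space d) : 0 ≤ crude t s Y := by
  unfold crude powProd; positivity

/-- Bounds by the majorant at any point with larger radii. -/
theorem Source.le_crude (hw : Source t s β C w) (he : Exponents θ t s β) {Y : Space d}
    (hY : Y ∈ offAxes d) {p : ℝ × ℝ} (h1 : ‖Y.1‖ ≤ p.1) (h2 : ‖Y.2‖ ≤ p.2) :
    w p ≤ C * crude t s Y ∧ w p * (p.1⁻¹ + p.2⁻¹) ≤ C * crude t s Y := by
  have hC := hw.nonneg_const
  have hr : 0 < ‖Y.1‖ := norm_pos_iff.2 hY.1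
  have hz : 0 < ‖Y.2‖ := norm_pos_iff.2 hY.2
  have hp : p ∈ quadrant := ⟨hr.trans_le h1, hz.trans_le h2⟩
  have hp1 : 0 < p.1 := hp.1
  have hp2 : 0 < p.2 := hp.2
  have ht : 0 ≤ t := by linarith [he.pos, he.le_t]
  have hs : 0 ≤ s := by linarith [he.t_le]
  have hβ : 0 ≤ β := by linarith [he.pos, he.le_β]
  have hmono : ∀ α : ℝ, 0 ≤ α → p.1 ^ (-α) ≤ ‖Y.1‖ ^ (-α) := fun α hα =>
    Real.rpow_le_rpow_of_nonpos hr h1 (by linarith)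
  have h3 := hw.upper_crude hβ hp
  have hw' : w p ≤ C * (‖Y.1‖ ^ (-t) + ‖Y.1‖ ^ (-s)) :=
    h3.trans (mul_le_mul_of_nonneg_left (add_le_add (hmono t ht) (hmono s hs)) hC)
  have i1 : p.1⁻¹ ≤ ‖Y.1‖⁻¹ := inv_anti₀ hr h1
  have i2 : p.2⁻¹ ≤ ‖Y.2‖⁻¹ := inv_anti₀ hz h2
  have e0 : ∀ α : ℝ, ‖Y.1‖ ^ (-(1 + α)) = ‖Y.1‖ ^ (-α) * ‖Y.1‖⁻¹ := fun α => by
    rw [neg_add, Real.rpow_add hr, Real.rpow_neg_one]; ring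
  have hcr : crude t s Y = (‖Y.1‖ ^ (-t) + ‖Y.1‖ ^ (-s)) * (1 + (‖Y.1‖⁻¹ + ‖Y.2‖⁻¹)) := by
    simp only [crude, powProd_zero_eq, e0, neg_zero, Real.rpow_zero, Real.rpow_neg_one]
    ring
  have hP : 0 ≤ ‖Y.1‖ ^ (-t) + ‖Y.1‖ ^ (-s) := by positivity
  have hI : 0 ≤ ‖Y.1‖⁻¹ + ‖Y.2‖⁻¹ := by positivity
  rw [hcr]
  constructor
  · refine hw'.trans (mul_le_mul_of_nonneg_left ?_ hC)
    nlinarith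
  · calc w p * (p.1⁻¹ + p.2⁻¹) ≤ (C * (‖Y.1‖ ^ (-t) + ‖Y.1‖ ^ (-s))) * (‖Y.1‖⁻¹ + ‖Y.2‖⁻¹) := by
          refine mul_le_mul hw' (add_le_add i1 i2) (by positivity) (by positivity)
      _ = C * ((‖Y.1‖ ^ (-t) + ‖Y.1‖ ^ (-s)) * (‖Y.1‖⁻¹ + ‖Y.2‖⁻¹)) := by ring
      _ ≤ _ := mul_le_mul_of_nonneg_left (by nlinarith) hC

theorem Source.gaussInt_lift (hd : 3 ≤ d) (hw : Source t s β C w) (he : Exponents θ t s β) :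
    GaussInt (lift (d := d) w) := by
  refine ((gaussInt_crude hd he).const_mul C).mono hw.measurable_lift fun Y => ?_
  rw [abs_of_nonneg (hw.lift_nonneg Y)]
  by_cases hY : Y ∈ offAxes d
  · rw [lift, indicator_of_mem hY]
    exact (hw.le_crude he hY le_rfl le_rfl).1
  · rw [lift, indicator_of_notMem hY]
    exact mul_nonneg hw.nonneg_const (crude_nonneg Y)

/-- The radii `p` may exceed those of `Y`, so that the bound covers both the true radii and their
regularizations: in either case the direction vectors have length at most one. -/
theorem Source.abs_fderiv_radial_le {v : Space d} (hw : Source t s β C w)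
    {p : ℝ × ℝ} {Y : Space d} (hp : p ∈ quadrant) (h1 : ‖Y.1‖ ≤ p.1) (h2 : ‖Y.2‖ ≤ p.2) :
    |fderiv ℝ w p (inner ℝ Y.1 v.1 / p.1, inner ℝ Y.2 v.2 / p.2)| ≤
      C * (w p * (p.1⁻¹ * ‖v.1‖ + p.2⁻¹ * ‖v.2‖)) := by
  have hp1 : 0 < p.1 := hp.1
  have hp2 : 0 < p.2 := hp.2
  refine (hw.abs_fderiv_le hp _ _).trans ?_
  have hw0 := (hw.pos p hp).le
  have hC := hw.nonneg_const
  have a1 : |inner ℝ Y.1 v.1 / p.1| ≤ ‖v.1‖ := by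
    rw [abs_div, abs_of_pos hp1, div_le_iff₀ hp1]
    refine (abs_real_inner_le_norm _ _).trans ?_
    rw [mul_comm]; gcongr
  have a2 : |inner ℝ Y.2 v.2 / p.2| ≤ ‖v.2‖ := by
    rw [abs_div, abs_of_pos hp2, div_le_iff₀ hp2]
    refine (abs_real_inner_le_norm _ _).trans ?_
    rw [mul_comm]; gcongr
  gcongr

theorem SubUnit.abs_fderiv_le_crude {v : Space d} (hv : SubUnit v) (hw : Source t s β C w)
    (he : Exponents θ t s β) {p : ℝ × ℝ} {Y : Space d} (hY : Y ∈ offAxes d) (h1 : ‖Y.1‖ ≤ p.1)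
    (h2 : ‖Y.2‖ ≤ p.2) :
    |fderiv ℝ w p (inner ℝ Y.1 v.1 / p.1, inner ℝ Y.2 v.2 / p.2)| ≤ C * C * crude t s Y := by
  have hp1 : 0 < p.1 := (norm_pos_iff.2 hY.1).trans_le h1
  have hp2 : 0 < p.2 := (norm_pos_iff.2 hY.2).trans_le h2
  have hp : p ∈ quadrant := ⟨hp1, hp2⟩
  refine (hw.abs_fderiv_radial_le hp h1 h2).trans ?_
  have hw0 := (hw.pos p hp).le
  have hC := hw.nonneg_const
  rw [mul_assoc]
  refine mul_le_mul_of_nonneg_left (le_trans ?_ (hw.le_crude he hY h1 h2).2) hC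
  refine mul_le_mul_of_nonneg_left (add_le_add ?_ ?_) hw0
  · exact mul_le_of_le_one_right (by positivity) hv.1
  · exact mul_le_of_le_one_right (by positivity) hv.2

theorem DirDeriv.fderiv_eq {v : Space d} {h h' : Space d → ℝ} (H : DirDeriv v h h')
    (hh : Differentiable ℝ h) (Z : Space d) : fderiv ℝ h Z v = h' Z := by
  have h1 : HasDerivAt (fun s : ℝ => Z + s • v) v 0 := by
    simpa using ((hasDerivAt_id (0 : ℝ)).smul_const v).const_add Z
  have h2 : HasFDerivAt h (fderiv ℝ h Z) (Z + (0 : ℝ) • v) := by simpa using (hh Z).hasFDerivAt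
  exact (h2.comp_hasDerivAt 0 h1).unique (H Z)

/-- Integration by parts moves a derivative from the kernel to the source. -/
theorem Source.smear_deriv (hd : 3 ≤ d) (hw : Source t s β C w) (he : Exponents θ t s β)
    {v : Space d} (hv : SubUnit v) {A A' : ℝ} {h h' : Space d → ℝ} (hh : GaussKer A h)
    (hh' : GaussKer A' h') (H : DirDeriv v h h') (hdiff : Differentiable ℝ h) {l : ℝ}
    (hl : 0 < l) (X : Space d) :
    smear h' (lift w) l X = -l * smear h (dirLift w v) l X := by
  have hcr := (gaussInt_crude (d := d) hd he)
  have hC := hw.nonneg_const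
  have hc := hh.continuous
  have hc' := hh'.continuous
  -- The source is not differentiable on the axes. With `|x|` replaced by `(|x|²+ε)^{1/2}` it is
  -- `C¹` everywhere, and since the regularized radii are larger and `crude` decreases in the radii,
  -- one majorant serves all `ε`.
  obtain ⟨ε, hεdef⟩ : ∃ ε : ℕ → ℝ, ε = fun k : ℕ => 1 / ((k : ℝ) + 1) := ⟨_, rfl⟩
  have hε : ∀ k, 0 < ε k := fun k => by rw [hεdef]; positivity
  obtain ⟨f, hf⟩ : ∃ f : ℕ → Space d → ℝ, f = fun k Y => w (regRadii (ε k) Y) := ⟨_, rfl⟩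
  obtain ⟨g, hg⟩ : ∃ g : ℕ → Space d → ℝ, g = fun k Y => fderiv ℝ w (regRadii (ε k) Y)
    (inner ℝ Y.1 v.1 / regNorm (ε k) Y.1, inner ℝ Y.2 v.2 / regNorm (ε k) Y.2) := ⟨_, rfl⟩
  have hcontR : ∀ k, Continuous (regRadii (d := d) (ε k)) := fun k =>
    (differentiable_regRadii (hε k)).continuous
  have hcf : ∀ k, Continuous (f k) := fun k => by
    rw [hf]
    exact hw.contDiffOn.continuousOn.comp_continuous (hcontR k) (regRadii_mem (hε k))
  have hcg : ∀ k, Continuous (g k) := fun k => by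
    rw [hg]
    refine (hw.continuousOn_fderiv.comp_continuous (hcontR k) (regRadii_mem (hε k))).clm_apply ?_
    have c1 := ((continuous_fst (X := ℝ) (Y := ℝ)).comp (hcontR k))
    have c2 := ((continuous_snd (X := ℝ) (Y := ℝ)).comp (hcontR k))
    refine Continuous.prodMk ?_ ?_
    · exact Continuous.div (by fun_prop) c1 fun Y => (regNorm_pos (hε k) _).ne'
    · exact Continuous.div (by fun_prop) c2 fun Y => (regNorm_pos (hε k) _).ne'
  have hbf : ∀ k, ∀ Y ∈ offAxes d, |f k Y| ≤ C * crude t s Y := fun k Y hY => by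
    rw [hf]
    simp only
    rw [abs_of_pos (hw.pos _ (regRadii_mem (hε k) Y))]
    exact (hw.le_crude he hY (norm_le_regNorm (hε k) _) (norm_le_regNorm (hε k) _)).1
  have hbg : ∀ k, ∀ Y ∈ offAxes d, |g k Y| ≤ C * C * crude t s Y := fun k Y hY => by
    rw [hg]
    exact hv.abs_fderiv_le_crude (p := regRadii (ε k) Y) hw he hY (norm_le_regNorm (hε k) _)
      (norm_le_regNorm (hε k) _)
  have hdom : ∀ {B B' : ℝ} {k : Space d → ℝ} {F : Space d → ℝ}, GaussKer B k →
      (∀ Y ∈ offAxes d, |F Y| ≤ B' * crude t s Y) → ∀ᵐ Z : Space d, ‖k Z * F (X + l • Z)‖ ≤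
        B * B' * (Real.exp (-(1 / 4) * sqLen Z) * crude t s (X + l • Z)) := by
    intro B B' k F hk hF
    filter_upwards [ae_mem_offAxes hl X] with Z hZ
    rw [norm_mul]
    have h1 := (hk.le Z).trans (mul_le_mul_of_nonneg_left (exp_half_le_quarter Z) hk.nonneg)
    refine (mul_le_mul h1 (hF _ hZ) (abs_nonneg _) (mul_nonneg hk.nonneg (Real.exp_pos _).le)).trans
      (le_of_eq ?_)
    ring
  have hint : ∀ {B B' : ℝ} {k : Space d → ℝ} {F : Space d → ℝ}, GaussKer B k → Continuous F →
      (∀ Y ∈ offAxes d, |F Y| ≤ B' * crude t s Y) → Integrable fun Z : Space d =>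
        k Z * F (X + l • Z) := by
    intro B B' k F hk hcF hF
    have := hk.continuous
    exact ((hcr.integrable l hl X).const_mul _).mono' (Continuous.aestronglyMeasurable (by fun_prop))
      (hdom hk hF)
  -- For the regularized source there are no boundary terms; the factor `l` is the chain rule for `X
  -- + l Z`.
  have hIBP : ∀ k, ∫ Z : Space d, h' Z * f k (X + l • Z) = -l * ∫ Z : Space d, h Z * g k (X + l • Z) := by
    intro k
    have hFd : Differentiable ℝ (fun Z : Space d => f k (X + l • Z)) := by
      intro Z
      rw [hf]
      have d1 : DifferentiableAt ℝ (fun Z : Space d => regRadii (ε k) (X + l • Z)) Z :=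
        ((differentiable_regRadii (hε k)) _).comp Z
          ((differentiableAt_id.const_smul l).const_add X)
      exact DifferentiableAt.comp (g := w) Z
        (hw.differentiableAt (regRadii_mem (hε k) (X + l • Z))) d1
    have hFv : ∀ Z : Space d, fderiv ℝ (fun Z : Space d => f k (X + l • Z)) Z v
        = l * g k (X + l • Z) := by
      intro Z
      refine DirDeriv.fderiv_eq (h := fun Z : Space d => f k (X + l • Z))
        (h' := fun Z => l * g k (X + l • Z)) (fun Z => ?_) hFd Z
      have c1 := hasDerivAt_regRadii (hε k) (X + l • Z) v
      have c2 : HasFDerivAt w (fderiv ℝ w (regRadii (ε k) (X + l • Z)))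
          (regRadii (ε k) (X + l • Z + (0 : ℝ) • v)) := by
        simpa using (hw.differentiableAt (regRadii_mem (hε k) (X + l • Z))).hasFDerivAt
      have c3 := c2.comp_hasDerivAt 0 c1
      have c4 : HasDerivAt (fun s : ℝ => s * l) l 0 := by
        simpa using (hasDerivAt_id (0 : ℝ)).mul_const l
      rw [← zero_mul l] at c3
      have c5 := HasDerivAt.comp (h := fun s : ℝ => s * l) 0 c3 c4
      rw [hf, hg]
      refine (c5.congr_of_eventuallyEq (.of_forall fun s => ?_)).congr_deriv (mul_comm _ _)
      simp only [Function.comp]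
      rw [smul_add, smul_smul, mul_comm l s, add_assoc]
    have i0 := hint hh (hcf k) (hbf k)
    have i1 := hint hh' (hcf k) (hbf k)
    have i2 := hint hh (hcg k) (hbg k)
    have key := integral_mul_fderiv_eq_neg_fderiv_mul_of_integrable (μ := (volume : Measure (Space d)))
      (f := h) (g := fun Z : Space d => f k (X + l • Z)) (v := v)
      (by simpa only [H.fderiv_eq hdiff] using i1)
      (by simpa only [hFv, mul_left_comm _ l] using i2.const_mul l) i0
      (fun x _ => hdiff x) (fun x _ => hFd x)
    simp only [hFv, H.fderiv_eq hdiff, mul_left_comm _ l] at key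
    rw [integral_const_mul] at key
    linarith
  have hlim1 : Tendsto (fun k => ∫ Z : Space d, h' Z * f k (X + l • Z)) atTop
      (𝓝 (smear h' (lift w) l X)) := by
    refine tendsto_integral_of_dominated_convergence _
      (fun k => Continuous.aestronglyMeasurable (by have := hcf k; fun_prop))
      ((hcr.integrable l hl X).const_mul (A' * C)) (fun k => hdom hh' (hbf k)) ?_
    filter_upwards [ae_mem_offAxes hl X] with Z hZ
    refine Tendsto.const_mul _ ?_
    rw [lift, indicator_of_mem hZ, hf, hεdef]
    have h1 := (hw.contDiffOn.continuousOn.continuousAt (quadrant_mem_nhds (radii_mem hZ)))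
    exact h1.tendsto.comp ((tendsto_regNorm _).prodMk_nhds (tendsto_regNorm _))
  have hlim2 : Tendsto (fun k => ∫ Z : Space d, h Z * g k (X + l • Z)) atTop
      (𝓝 (smear h (dirLift w v) l X)) := by
    refine tendsto_integral_of_dominated_convergence _
      (fun k => Continuous.aestronglyMeasurable (by have := hcg k; fun_prop))
      ((hcr.integrable l hl X).const_mul (A * (C * C))) (fun k => hdom hh (hbg k)) ?_
    filter_upwards [ae_mem_offAxes hl X] with Z hZ
    refine Tendsto.const_mul _ ?_
    rw [dirLift, indicator_of_mem hZ, hg, hεdef]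
    have h1 := (hw.continuousOn_fderiv.continuousAt (quadrant_mem_nhds (radii_mem hZ)))
    have h2 := h1.tendsto.comp ((tendsto_regNorm (X + l • Z).1).prodMk_nhds
      (tendsto_regNorm (X + l • Z).2))
    refine ((isBoundedBilinearMap_apply (𝕜 := ℝ) (E := ℝ × ℝ) (F := ℝ)).continuous.tendsto
      (_, _)).comp (h2.prodMk_nhds (Tendsto.prodMk_nhds ?_ ?_))
    · exact tendsto_const_nhds.div (tendsto_regNorm _) (norm_ne_zero_iff.2 hZ.1)
    · exact tendsto_const_nhds.div (tendsto_regNorm _) (norm_ne_zero_iff.2 hZ.2)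
  refine tendsto_nhds_unique hlim1 ?_
  simp only [hIBP]
  exact hlim2.const_mul _

end

end

section

variable {d : ℕ}

/-! ### Uniform bounds for the smeared source -/

/-- The sharp majorant of the source, divided by `|ξ|^k`. -/
noncomputable def fine (t s β k : ℝ) (Y : Space d) : ℝ :=
  ‖Y.1‖ ^ (-(k + t)) * (1 + ‖Y.2‖) ^ (-β) + if ‖Y.2‖ < 1 / 2 then ‖Y.1‖ ^ (-(k + s)) else 0

/-- The size of the smeared source at scale `l` around a point with radii `r`, `z`. -/
noncomputable def coarse (t s β k r z l : ℝ) : ℝ :=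
  ((r + l) ^ (-(k + t)) + (r + l) ^ (-(k + s))) * (1 + z + l) ^ (-β)

theorem coarse_nonneg {t s β k r z l : ℝ} (hr : 0 ≤ r) (hz : 0 ≤ z) (hl : 0 ≤ l) :
    0 ≤ coarse t s β k r z l := by
  unfold coarse
  have h1 : 0 ≤ r + l := by positivity
  have h2 : 0 ≤ 1 + z + l := by positivity
  positivity

section

variable {θ t s β C : ℝ} {w : ℝ × ℝ → ℝ}

theorem fine_nonneg (k : ℝ) (Y : Space d) : 0 ≤ fine t s β k Y := by
  unfold fine
  split_ifs <;> positivity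

theorem Source.lift_le_fine (hw : Source t s β C w) (Y : Space d) :
    |lift w Y| ≤ C * fine t s β 0 Y := by
  rw [abs_of_nonneg (hw.lift_nonneg Y)]
  by_cases hY : Y ∈ offAxes d
  · rw [lift, indicator_of_mem hY]
    simpa [fine, radii] using hw.upper _ (radii_mem hY)
  · rw [lift, indicator_of_notMem hY]
    exact mul_nonneg hw.nonneg_const (fine_nonneg _ _)

/-- A direction without `η`-component only costs `1/|ξ|`; a derivative in `η` would cost `1/|η|`,
which is too singular for the bounds below. One factor `C` comes from the logarithmic derivative,
the other from the size of the source. -/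
theorem Source.dirLift_le_fine (hw : Source t s β C w) {v : Space d} (hv : SubUnit v)
    (hv2 : v.2 = 0) (Y : Space d) : |dirLift w v Y| ≤ C * C * fine t s β 1 Y := by
  have hC := hw.nonneg_const
  by_cases hY : Y ∈ offAxes d
  · rw [dirLift, indicator_of_mem hY]
    have hr : 0 < ‖Y.1‖ := norm_pos_iff.2 hY.1
    refine (hw.abs_fderiv_radial_le (Y := Y) (p := radii Y) (radii_mem hY) le_rfl le_rfl).trans ?_
    have hu := hw.upper _ (radii_mem hY)
    have h0 := (hw.pos _ (radii_mem hY)).le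
    rw [hv2, norm_zero, mul_zero, add_zero, mul_assoc]
    refine mul_le_mul_of_nonneg_left ?_ hC
    have e0 : ∀ α : ℝ, ‖Y.1‖ ^ (-(1 + α)) = ‖Y.1‖ ^ (-α) * ‖Y.1‖⁻¹ := fun α => by
      rw [neg_add, Real.rpow_add hr, Real.rpow_neg_one]; ring
    have e1 : fine t s β 1 Y = (‖Y.1‖ ^ (-t) * (1 + ‖Y.2‖) ^ (-β) +
        if ‖Y.2‖ < 1 / 2 then ‖Y.1‖ ^ (-s) else 0) * ‖Y.1‖⁻¹ := by
      rw [fine, e0, e0]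
      split_ifs <;> ring
    rw [e1, ← mul_assoc C]
    refine mul_le_mul hu ?_ (by have := hv.1; positivity) (h0.trans hu)
    exact mul_le_of_le_one_right (inv_nonneg.2 hr.le) hv.1
  · rw [dirLift, indicator_of_notMem hY, abs_zero]
    exact mul_nonneg (mul_nonneg hC hC) (fine_nonneg _ _)

/-- The coarse bound of smeared functions. -/
theorem exists_abs_smear_le_coarse (hd : 3 ≤ d) : ∃ K : ℝ, 0 < K ∧ ∀ {θ t s β k A B : ℝ},
    Exponents θ t s β → 0 ≤ k → k ≤ 1 → 0 ≤ B → ∀ {h f : Space d → ℝ}, GaussKer A h →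
    (∀ Y, |f Y| ≤ B * fine t s β k Y) → ∀ {l : ℝ}, 0 < l → ∀ X : Space d,
      |smear h f l X| ≤ K * (A * B) * coarse t s β k ‖X.1‖ ‖X.2‖ l := by
  obtain ⟨K, hK, hav⟩ := exists_avg_powProd_le hd
  refine ⟨9 * K, by positivity, ?_⟩
  intro θ t s β k A B he hk hk1 hB h f hh hf l hl X
  obtain ⟨h0, h1, h2, h3, h4, h5, -, -⟩ := he
  have ⟨g1, a1⟩ := hav (k + t) 1 β (by linarith) (by linarith) zero_le_one (by linarith) (by linarith)
  have ⟨g2, a2⟩ := hav (k + s) 1 β (by linarith) (by linarith) zero_le_one (by linarith) (by linarith)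
  have hmaj : ∀ Y : Space d, |f Y| ≤ 9 * B * (powProd (k + t) 1 β Y + powProd (k + s) 1 β Y) := by
    intro Y
    refine (hf Y).trans ?_
    rw [mul_comm (9 : ℝ) B, mul_assoc]
    refine mul_le_mul_of_nonneg_left ?_ hB
    have p1 := powProd_nonneg (α := k + t) (α' := β) zero_le_one Y
    have p2 := powProd_nonneg (α := k + s) (α' := β) zero_le_one Y
    have e1 : fine t s β k Y = powProd (k + t) 1 β Y +
      if ‖Y.2‖ < 1 / 2 then ‖Y.1‖ ^ (-(k + s)) else 0 := rfl
    rw [e1]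
    split_ifs with hz
    -- Where the indicator is active `(1+|η|)^β ≤ 3² = 9`, so the singular part may be given the
    -- same decay in `η` as the regular part.
    · have h6 : 1 / 9 ≤ (1 + ‖Y.2‖) ^ (-β) := by
        have hpos : (0 : ℝ) < 1 + ‖Y.2‖ := by positivity
        rw [Real.rpow_neg hpos.le, one_div]
        refine inv_anti₀ (by positivity) ?_
        calc (1 + ‖Y.2‖) ^ β ≤ (3 : ℝ) ^ β :=
              Real.rpow_le_rpow hpos.le (by linarith) (by linarith)
          _ ≤ (3 : ℝ) ^ (2 : ℝ) := Real.rpow_le_rpow_of_exponent_le (by norm_num) (by linarith)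
          _ = 9 := by norm_num
      have h7 : ‖Y.1‖ ^ (-(k + s)) ≤ 9 * powProd (k + s) 1 β Y := by
        rw [powProd]
        have : 0 ≤ ‖Y.1‖ ^ (-(k + s)) := by positivity
        nlinarith
      linarith
    · linarith
  have hg := (g1.add g2).const_mul (9 * B)
  refine (hh.abs_smear_le hg hmaj hl X).trans ?_
  rw [avg_const_mul, avg_add g1 g2 hl]
  have hA := hh.nonneg
  calc A * (9 * B * (avg (powProd (k + t) 1 β) l X + avg (powProd (k + s) 1 β) l X))
      ≤ A * (9 * B * (K * ((‖X.1‖ + l) ^ (-(k + t)) * (1 + ‖X.2‖ + l) ^ (-β)) +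
        K * ((‖X.1‖ + l) ^ (-(k + s)) * (1 + ‖X.2‖ + l) ^ (-β)))) := by
        gcongr
        · exact a1 l X hl
        · exact a2 l X hl
    _ = _ := by unfold coarse; ring

/-- The fine bound of smeared functions; far from the axis `η = 0` the part of the source near that
axis contributes little at small scales. -/
theorem exists_abs_smear_le_fine (hd : 3 ≤ d) : ∃ K : ℝ, 0 < K ∧ ∀ {θ t s β k A B : ℝ},
    Exponents θ t s β → 0 ≤ k → k ≤ 1 → 0 ≤ B → ∀ {h f : Space d → ℝ}, GaussKer A h →
    Measurable f → (∀ Y, |f Y| ≤ B * fine t s β k Y) → ∀ {l : ℝ}, 0 < l → ∀ (X : Space d) (κ : ℝ),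
      (κ = 1 ∨ 3 / 4 ≤ ‖X.2‖ ∧ κ = (l / ‖X.2‖) ^ 2) →
      |smear h f l X| ≤ K * (A * B) * ((‖X.1‖ + l) ^ (-(k + t)) * (1 + ‖X.2‖ + l) ^ (-β) +
        (‖X.1‖ + l) ^ (-(k + s)) * κ) := by
  obtain ⟨K, hK, hav⟩ := exists_avg_powProd_le hd
  refine ⟨36 * K, by positivity, ?_⟩
  intro θ t s β k A B he hk hk1 hB h f hh hfm hf l hl X κ hκ
  obtain ⟨h0, h1, h2, h3, h4, h5, -, -⟩ := he
  have hA := hh.nonneg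
  have ⟨g1, a1⟩ := hav (k + t) 1 β (by linarith) (by linarith) zero_le_one (by linarith) (by linarith)
  have ⟨g2, a2⟩ := hav (k + s) 1 0 (by linarith) (by linarith) zero_le_one le_rfl (by norm_num)
  have hκ0 : 0 ≤ κ := by
    rcases hκ with h | h
    · rw [h]; norm_num
    · rw [h.2]; positivity
  have hpt : ∀ Z : Space d, ‖h Z * f (X + l • Z)‖ ≤ A * B *
      (Real.exp (-(1 / 4) * sqLen Z) * powProd (k + t) 1 β (X + l • Z) +
        36 * κ * (Real.exp (-(1 / 4) * sqLen Z) * powProd (k + s) 1 0 (X + l • Z))) := by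
    intro Z
    obtain ⟨Y, hY⟩ : ∃ Y, Y = X + l • Z := ⟨_, rfl⟩
    rw [← hY, norm_mul]
    have p1 := powProd_nonneg (α := k + t) (α' := β) zero_le_one Y
    have p2 := powProd_nonneg (α := k + s) (α' := 0) zero_le_one Y
    have hE := Real.exp_pos (-(1 / 4) * sqLen Z)
    have hhZ := hh.le Z
    have hq := exp_half_le_quarter Z
    have e1 : fine t s β k Y = powProd (k + t) 1 β Y +
      if ‖Y.2‖ < 1 / 2 then powProd (k + s) 1 0 Y else 0 := by
      simp [fine, powProd]
    have hfY := hf Y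
    have hmain : Real.exp (-(1 / 2) * sqLen Z) * fine t s β k Y ≤
        Real.exp (-(1 / 4) * sqLen Z) * powProd (k + t) 1 β Y +
        36 * κ * (Real.exp (-(1 / 4) * sqLen Z) * powProd (k + s) 1 0 Y) := by
      rw [e1, mul_add]
      refine add_le_add (mul_le_mul_of_nonneg_right hq p1) ?_
      split_ifs with hz
      · rw [← mul_assoc (36 * κ)]
        refine mul_le_mul_of_nonneg_right ?_ p2
        rcases hκ with h | ⟨h, h'⟩
        · rw [h]; linarith
        · have hzpos : 0 < ‖X.2‖ := by linarith
          -- To reach the slab `|η| < 1/2` from `|X.2| ≥ 3/4` the displacement must be at least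
          -- `|X.2|/3`. Hence `|Z|²` is at least a multiple of `1/κ`, and half of the Gaussian turns
          -- this into the factor `κ`.
          have h6 : ‖X.2‖ ≤ 3 * (l * ‖Z.2‖) := by
            have : X.2 = Y.2 - l • Z.2 := by rw [hY]; simp
            have h7 := norm_sub_le Y.2 (l • Z.2)
            rw [← this, norm_smul, Real.norm_of_nonneg hl.le] at h7
            linarith
          have h8 : 1 ≤ 9 * κ * sqLen Z := by
            have h9 : ‖X.2‖ ^ 2 ≤ 9 * (l ^ 2 * sqLen Z) := by
              calc ‖X.2‖ ^ 2 ≤ (3 * (l * ‖Z.2‖)) ^ 2 := by gcongr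
                _ = 9 * (l ^ 2 * ‖Z.2‖ ^ 2) := by ring
                _ ≤ _ := by
                  unfold sqLen
                  gcongr
                  linarith [sq_nonneg ‖Z.1‖]
            have e2 : 9 * κ * sqLen Z = 9 * (l ^ 2 * sqLen Z) / ‖X.2‖ ^ 2 := by
              rw [h', div_pow]; ring
            rw [e2, le_div_iff₀ (by positivity)]
            linarith
          have h10 : sqLen Z * Real.exp (-(1 / 2) * sqLen Z) ≤ 4 * Real.exp (-(1 / 4) * sqLen Z) := by
            have e3 : Real.exp (-(1 / 2) * sqLen Z) =
                Real.exp (-(1 / 4) * sqLen Z) * Real.exp (-(1 / 4) * sqLen Z) := by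
              rw [← Real.exp_add]; congr 1; ring
            have h11 := Real.add_one_le_exp (1 / 4 * sqLen Z)
            have h12 : Real.exp (-(1 / 4) * sqLen Z) * Real.exp (1 / 4 * sqLen Z) = 1 :=
              exp_mul_exp_eq_one (by ring)
            have h13 : sqLen Z * Real.exp (-(1 / 4) * sqLen Z) ≤ 4 := by
              have := mul_le_mul_of_nonneg_left h11 hE.le
              linarith
            rw [e3, ← mul_assoc]
            exact mul_le_mul_of_nonneg_right h13 hE.le
          have hE2 := Real.exp_pos (-(1 / 2) * sqLen Z)
          calc _ ≤ Real.exp (-(1 / 2) * sqLen Z) * (9 * κ * sqLen Z) := by nlinarith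
            _ = 9 * κ * (sqLen Z * Real.exp (-(1 / 2) * sqLen Z)) := by ring
            _ ≤ 9 * κ * (4 * Real.exp (-(1 / 4) * sqLen Z)) := by gcongr
            _ = _ := by ring
      · rw [mul_zero]; positivity
    calc |h Z| * |f Y| ≤ (A * Real.exp (-(1 / 2) * sqLen Z)) * (B * fine t s β k Y) :=
          mul_le_mul hhZ hfY (abs_nonneg _) (by positivity)
      _ = A * B * (Real.exp (-(1 / 2) * sqLen Z) * fine t s β k Y) := by ring
      _ ≤ _ := mul_le_mul_of_nonneg_left hmain (by positivity)
  have i1 := g1.integrable l hl X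
  have i2 := (g2.integrable l hl X).const_mul (36 * κ)
  have key := norm_integral_le_of_norm_le ((i1.add i2).const_mul (A * B)) (.of_forall hpt)
  have e2 : ∫ Z : Space d, A * B *
      (Real.exp (-(1 / 4) * sqLen Z) * powProd (k + t) 1 β (X + l • Z) +
        36 * κ * (Real.exp (-(1 / 4) * sqLen Z) * powProd (k + s) 1 0 (X + l • Z))) =
      A * B * (avg (powProd (k + t) 1 β) l X + 36 * κ * avg (powProd (k + s) 1 0) l X) := by
    rw [integral_const_mul, integral_add i1 i2, integral_const_mul]
    rfl
  rw [← Real.norm_eq_abs]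
  refine (key.trans (le_of_eq e2)).trans ?_
  have a1' := a1 l X hl
  have a2' := a2 l X hl
  rw [neg_zero, Real.rpow_zero, mul_one] at a2'
  have q1 : 0 ≤ (‖X.1‖ + l) ^ (-(k + t)) * (1 + ‖X.2‖ + l) ^ (-β) := by positivity
  calc _ ≤ A * B * (K * ((‖X.1‖ + l) ^ (-(k + t)) * (1 + ‖X.2‖ + l) ^ (-β)) +
        36 * κ * (K * (‖X.1‖ + l) ^ (-(k + s)))) := by gcongr
    _ ≤ A * B * (36 * (K * ((‖X.1‖ + l) ^ (-(k + t)) * (1 + ‖X.2‖ + l) ^ (-β))) +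
        36 * κ * (K * (‖X.1‖ + l) ^ (-(k + s)))) := by
        refine mul_le_mul_of_nonneg_left ?_ (by positivity)
        have : 0 ≤ K * ((‖X.1‖ + l) ^ (-(k + t)) * (1 + ‖X.2‖ + l) ^ (-β)) := by positivity
        linarith
    _ = _ := by ring

/-- The qualitative bound of the smeared gradient off the axes. -/
theorem exists_abs_smear_dirLift_le (hd : 3 ≤ d) : ∃ K : ℝ, 0 < K ∧ ∀ {θ t s β A C : ℝ},
    Exponents θ t s β → ∀ {w : ℝ × ℝ → ℝ}, Source t s β C w → ∀ {v : Space d}, SubUnit v →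
    ∀ {h : Space d → ℝ}, GaussKer A h → ∀ {l : ℝ}, 0 < l → ∀ X : Space d, X ∈ offAxes d →
      |smear h (dirLift w v) l X| ≤ K * (A * (C * C)) *
        ((‖X.1‖ ^ (-t) + ‖X.1‖ ^ (-s)) * (1 + ‖X.1‖⁻¹ + ‖X.2‖⁻¹)) := by
  obtain ⟨K, hK, hav⟩ := exists_avg_powProd_le hd
  refine ⟨K, hK, ?_⟩
  intro θ t s β A C he w hw v hv h hh l hl X hX
  have hle : ∀ Y, |dirLift w v Y| ≤ C * C * crude t s Y := by
    intro Y
    by_cases hY : Y ∈ offAxes d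
    · rw [dirLift, indicator_of_mem hY]
      exact hv.abs_fderiv_le_crude hw he hY le_rfl le_rfl
    · rw [dirLift, indicator_of_notMem hY, abs_zero]
      exact mul_nonneg (mul_nonneg hw.nonneg_const hw.nonneg_const) (crude_nonneg Y)
  have hG := (gaussInt_crude (d := d) hd he).const_mul (C * C)
  refine (hh.abs_smear_le hG hle hl X).trans ?_
  rw [avg_const_mul]
  have hA := hh.nonneg
  have hC := hw.nonneg_const
  obtain ⟨h0, h1, h2, h3, h4, h5, -, -⟩ := he
  have hr : 0 < ‖X.1‖ := norm_pos_iff.2 hX.1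
  have hz : 0 < ‖X.2‖ := norm_pos_iff.2 hX.2
  have hb : ∀ α α' : ℝ, 0 ≤ α → α ≤ 2 → 0 ≤ α' → α' ≤ 2 → GaussInt (powProd (d := d) α 0 α') ∧
      avg (powProd α 0 α') l X ≤ K * (‖X.1‖ ^ (-α) * ‖X.2‖ ^ (-α')) := by
    intro α α' ha ha2 ha' ha2'
    obtain ⟨g, a⟩ := hav α 0 α' ha ha2 le_rfl ha' ha2'
    refine ⟨g, (a l X hl).trans (mul_le_mul_of_nonneg_left ?_ hK.le)⟩
    rw [zero_add]
    refine mul_le_mul ?_ ?_ (by positivity) (by positivity)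
    · exact Real.rpow_le_rpow_of_nonpos hr (by linarith) (by linarith)
    · exact Real.rpow_le_rpow_of_nonpos hz (by linarith) (by linarith)
  obtain ⟨g1, b1⟩ := hb t 0 (by linarith) (by linarith) (by linarith) (by linarith)
  obtain ⟨g2, b2⟩ := hb s 0 (by linarith) (by linarith) (by linarith) (by linarith)
  obtain ⟨g3, b3⟩ := hb (1 + t) 0 (by linarith) (by linarith) (by linarith) (by linarith)
  obtain ⟨g4, b4⟩ := hb (1 + s) 0 (by linarith) (by linarith) (by linarith) (by linarith)
  obtain ⟨g5, b5⟩ := hb t 1 (by linarith) (by linarith) (by linarith) (by linarith)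
  obtain ⟨g6, b6⟩ := hb s 1 (by linarith) (by linarith) (by linarith) (by linarith)
  have e : avg (crude t s) l X = (avg (powProd t 0 0) l X + avg (powProd s 0 0) l X) +
      ((avg (powProd (1 + t) 0 0) l X + avg (powProd (1 + s) 0 0) l X) +
      (avg (powProd t 0 1) l X + avg (powProd s 0 1) l X)) := by
    have := avg_add (g1.add g2) ((g3.add g4).add (g5.add g6)) hl X
    rw [avg_add g1 g2 hl, avg_add (g3.add g4) (g5.add g6) hl, avg_add g3 g4 hl,
      avg_add g5 g6 hl] at this
    exact this
  have e0 : ∀ α : ℝ, ‖X.1‖ ^ (-(1 + α)) = ‖X.1‖ ^ (-α) * ‖X.1‖⁻¹ := fun α => by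
    rw [neg_add, Real.rpow_add hr, Real.rpow_neg_one]; ring
  simp only [e0, neg_zero, Real.rpow_zero, mul_one, Real.rpow_neg_one] at b1 b2 b3 b4 b5 b6
  have hsum : avg (crude t s) l X ≤
      K * ((‖X.1‖ ^ (-t) + ‖X.1‖ ^ (-s)) * (1 + ‖X.1‖⁻¹ + ‖X.2‖⁻¹)) := by
    rw [e]; linarith
  calc _ ≤ A * (C * C * (K * ((‖X.1‖ ^ (-t) + ‖X.1‖ ^ (-s)) * (1 + ‖X.1‖⁻¹ + ‖X.2‖⁻¹)))) := by
        gcongr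
    _ = _ := by ring

end

end

section

/-! ### One-dimensional integrals -/

/-- `F` is dominated on `(0, ∞)` by an integrable function with integral at most `M`. -/
def IntBound (F : ℝ → ℝ) (M : ℝ) : Prop :=
  ∃ G : ℝ → ℝ, IntegrableOn G (Ioi 0) ∧ (∀ l, 0 < l → F l ≤ G l) ∧ ∫ l in Ioi 0, G l ≤ M

theorem IntBound.mono {F F' : ℝ → ℝ} {M M' : ℝ} (h : IntBound F M) (hF : ∀ l, 0 < l → F' l ≤ F l)
    (hM : M ≤ M') : IntBound F' M' := by
  obtain ⟨G, h1, h2, h3⟩ := h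
  exact ⟨G, h1, fun l hl => (hF l hl).trans (h2 l hl), h3.trans hM⟩

theorem IntBound.add {F F' : ℝ → ℝ} {M M' : ℝ} (h : IntBound F M) (h' : IntBound F' M') :
    IntBound (fun l => F l + F' l) (M + M') := by
  obtain ⟨G, h1, h2, h3⟩ := h
  obtain ⟨G', h1', h2', h3'⟩ := h'
  refine ⟨fun l => G l + G' l, h1.add h1', fun l hl => add_le_add (h2 l hl) (h2' l hl), ?_⟩
  rw [integral_add h1 h1']
  exact add_le_add h3 h3'

theorem IntBound.const_mul {F : ℝ → ℝ} {M c : ℝ} (h : IntBound F M) (hc : 0 ≤ c) :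
    IntBound (fun l => c * F l) (c * M) := by
  obtain ⟨G, h1, h2, h3⟩ := h
  refine ⟨fun l => c * G l, h1.const_mul c, fun l hl => mul_le_mul_of_nonneg_left (h2 l hl) hc, ?_⟩
  rw [integral_const_mul]
  exact mul_le_mul_of_nonneg_left h3 hc

theorem IntBound.integrableOn {F f : ℝ → ℝ} {M : ℝ} (h : IntBound F M)
    (hf : AEStronglyMeasurable f (volume.restrict (Ioi 0))) (hle : ∀ l, 0 < l → |f l| ≤ F l) :
    IntegrableOn f (Ioi 0) := by
  obtain ⟨G, h1, h2, -⟩ := h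
  exact h1.mono' hf ((ae_restrict_iff' measurableSet_Ioi).2
    (.of_forall fun l hl => (hle l hl).trans (h2 l hl)))

theorem IntBound.integral_le {F f : ℝ → ℝ} {M : ℝ} (h : IntBound F M)
    (hf : IntegrableOn f (Ioi 0)) (hle : ∀ l, 0 < l → f l ≤ F l) : ∫ l in Ioi 0, f l ≤ M := by
  obtain ⟨G, h1, h2, h3⟩ := h
  exact (setIntegral_mono_on hf h1 measurableSet_Ioi
    fun l hl => (hle l hl).trans (h2 l hl)).trans h3

theorem IntBound.abs_integral_le {F f : ℝ → ℝ} {M : ℝ} (h : IntBound F M)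
    (hle : ∀ l, 0 < l → |f l| ≤ F l) : |∫ l in Ioi 0, f l| ≤ M := by
  obtain ⟨G, h1, h2, h3⟩ := h
  rw [← Real.norm_eq_abs]
  refine (norm_integral_le_of_norm_le h1 ?_).trans h3
  exact (ae_restrict_iff' measurableSet_Ioi).2
    (.of_forall fun l hl => (hle l hl).trans (h2 l hl))

/-- The model majorant: a power integrable at zero below the scale `ρ` and a power integrable at
infinity above it. All the scale integrals below reduce to it with a suitable `ρ`. -/
theorem intBound_two_powers {A a B b ρ : ℝ} (ha : a < 1) (hb : 0 < b) (hρ : 0 < ρ) :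
    IntBound (fun l => if l ≤ ρ then A * l ^ (-a) else B * l ^ (-1 - b))
      (A * (ρ ^ (1 - a) / (1 - a)) + B * (ρ ^ (-b) / b)) := by
  have hU : Ioi (0 : ℝ) = Ioc 0 ρ ∪ Ioi ρ := (Ioc_union_Ioi_eq_Ioi hρ.le).symm
  obtain ⟨G, hG⟩ : ∃ G : ℝ → ℝ, G = fun l => if l ≤ ρ then A * l ^ (-a) else B * l ^ (-1 - b) :=
    ⟨_, rfl⟩
  have e1 : EqOn G (fun l => A * l ^ (-a)) (Ioc 0 ρ) := fun l hl => by
    rw [hG]; exact if_pos hl.2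
  have e2 : EqOn G (fun l => B * l ^ (-1 - b)) (Ioi ρ) := fun l hl => by
    rw [hG]; exact if_neg (not_le.2 hl)
  have i1 : IntegrableOn (fun l : ℝ => l ^ (-a)) (Ioc 0 ρ) :=
    (intervalIntegral.intervalIntegrable_rpow' (by linarith) (a := 0) (b := ρ)).1
  have i2 : IntegrableOn (fun l : ℝ => l ^ (-1 - b)) (Ioi ρ) :=
    integrableOn_Ioi_rpow_of_lt (by linarith) hρ
  have j1 : IntegrableOn G (Ioc 0 ρ) := IntegrableOn.congr_fun (i1.const_mul A) e1.symm measurableSet_Ioc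
  have j2 : IntegrableOn G (Ioi ρ) := IntegrableOn.congr_fun (i2.const_mul B) e2.symm measurableSet_Ioi
  refine ⟨G, ?_, fun l _ => by rw [hG], ?_⟩
  · rw [hU]; exact j1.union j2
  · rw [hU, setIntegral_union (Ioc_disjoint_Ioi le_rfl) measurableSet_Ioi j1 j2,
      setIntegral_congr_fun measurableSet_Ioc e1, setIntegral_congr_fun measurableSet_Ioi e2,
      integral_const_mul, integral_const_mul, integral_Ioi_rpow_of_lt (by linarith) hρ,
      ← intervalIntegral.integral_of_le hρ.le, integral_rpow (.inl (by linarith)),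
      Real.zero_rpow (by linarith)]
    apply le_of_eq
    have e3 : -a + 1 = 1 - a := by ring
    have e4 : -1 - b + 1 = -b := by ring
    rw [e3, e4, sub_zero, neg_div_neg_eq]

/-! ### Comparison of negative powers. -/

theorem rpow_neg_anti {x y α : ℝ} (hy : 0 < y) (h : y ≤ x) (hα : 0 ≤ α) : x ^ (-α) ≤ y ^ (-α) :=
  Real.rpow_le_rpow_of_nonpos hy h (by linarith)

theorem rpow_neg_le_of_half {x y α : ℝ} (hy : 0 < y) (h : y / 2 ≤ x) (hα : 0 ≤ α) (hα2 : α ≤ 2) :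
    x ^ (-α) ≤ 4 * y ^ (-α) := by
  refine (rpow_neg_anti (by linarith) h hα).trans ?_
  rw [Real.div_rpow hy.le (by norm_num), Real.rpow_neg (by norm_num : (0 : ℝ) ≤ 2), div_inv_eq_mul,
    mul_comm]
  refine mul_le_mul_of_nonneg_right ?_ (by positivity)
  calc (2 : ℝ) ^ α ≤ 2 ^ (2 : ℝ) := Real.rpow_le_rpow_of_exponent_le (by norm_num) hα2
    _ = 4 := by norm_num

theorem rpow_neg_exp_anti {x α α' : ℝ} (hx : 1 ≤ x) (h : α ≤ α') : x ^ (-α') ≤ x ^ (-α) :=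
  Real.rpow_le_rpow_of_exponent_le hx (by linarith)

/-- Trading powers of the smaller variable for powers of the larger one. -/
theorem rpow_neg_trade {x y α α' : ℝ} (hx : 0 < x) (h : x ≤ y) (hα : α ≤ α') :
    x ^ (-α) ≤ x ^ (-α') * y ^ (α' - α) := by
  have : x ^ (-α) = x ^ (-α') * x ^ (α' - α) := by rw [← Real.rpow_add hx]; congr 1; ring
  rw [this]
  exact mul_le_mul_of_nonneg_left (Real.rpow_le_rpow hx.le h (by linarith)) (by positivity)

/-! ### Integrals of the majorants over all scales. -/

section

variable {θ t s β r z : ℝ}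

theorem coarse_le_far (he : Exponents θ t s β) {k : ℝ} (hk : 0 ≤ k) (hr : 0 ≤ r) (hz : 0 ≤ z)
    {l : ℝ} (hl : 1 ≤ l) : coarse t s β k r z l ≤ 2 * l ^ (-(k + t + β)) := by
  obtain ⟨h0, h1, h2, h3, h4, h5, -, -⟩ := he
  have hl0 : 0 < l := by linarith
  have e1 : (r + l) ^ (-(k + t)) ≤ l ^ (-(k + t)) := rpow_neg_anti hl0 (by linarith) (by linarith)
  have e2 : (r + l) ^ (-(k + s)) ≤ l ^ (-(k + t)) :=
    (rpow_neg_anti hl0 (by linarith) (by linarith)).trans (rpow_neg_exp_anti hl (by linarith))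
  have e3 : (1 + z + l) ^ (-β) ≤ l ^ (-β) := rpow_neg_anti hl0 (by linarith) (by linarith)
  have e4 : l ^ (-(k + t + β)) = l ^ (-(k + t)) * l ^ (-β) := by
    rw [← Real.rpow_add hl0]; congr 1; ring
  rw [e4, ← mul_assoc]
  unfold coarse
  refine mul_le_mul (by linarith) e3 (by positivity) (by positivity)

/-- Either `r` or `1+z` is at least half of `ρ = 1+r+z`. In the first case the radial factor is
frozen at `ρ^{-t}` and the axial one is at most `l^{-β}`. In the second the axial factor is frozen,
and `l ≤ ρ` lets the radial power be traded for `l^{-β}`, because `t` and `s` are at most `β`. -/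
theorem coarse_le_near (he : Exponents θ t s β) (hr : 0 ≤ r) (hz : 0 ≤ z)
    {l : ℝ} (hl : 0 < l) (hlρ : l ≤ 1 + r + z) :
    coarse t s β 0 r z l ≤ 8 * ((1 + r + z) ^ (-t) * l ^ (-β)) := by
  obtain ⟨h0, h1, h2, h3, h4, h5, -, -⟩ := he
  obtain ⟨ρ, hρ⟩ : ∃ ρ, ρ = 1 + r + z := ⟨_, rfl⟩
  rw [← hρ] at hlρ ⊢
  have hρ1 : 1 ≤ ρ := by linarith
  have hρ0 : 0 < ρ := by linarith
  unfold coarse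
  rw [zero_add, zero_add]
  have hlast : ρ ^ (-s) ≤ ρ ^ (-t) := rpow_neg_exp_anti hρ1 h2
  rcases le_total (ρ / 2) r with h | h
  · have e1 : (r + l) ^ (-t) ≤ 4 * ρ ^ (-t) :=
      rpow_neg_le_of_half hρ0 (by linarith) (by linarith) (by linarith)
    have e2 : (r + l) ^ (-s) ≤ 4 * ρ ^ (-s) :=
      rpow_neg_le_of_half hρ0 (by linarith) (by linarith) (by linarith)
    have e3 : (1 + z + l) ^ (-β) ≤ l ^ (-β) := rpow_neg_anti hl (by linarith) (by linarith)
    rw [← mul_assoc]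
    exact mul_le_mul (by linarith) e3 (by positivity) (by positivity)
  · have e1 : (r + l) ^ (-t) ≤ l ^ (-β) * ρ ^ (β - t) :=
      (rpow_neg_anti hl (by linarith) (by linarith)).trans (rpow_neg_trade hl hlρ (by linarith))
    have e2 : (r + l) ^ (-s) ≤ l ^ (-β) * ρ ^ (β - s) :=
      (rpow_neg_anti hl (by linarith) (by linarith)).trans (rpow_neg_trade hl hlρ (by linarith))
    have e3 : (1 + z + l) ^ (-β) ≤ 4 * ρ ^ (-β) :=
      rpow_neg_le_of_half hρ0 (by linarith) (by linarith) (by linarith)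
    have e4 : ρ ^ (β - t) * ρ ^ (-β) = ρ ^ (-t) := by rw [← Real.rpow_add hρ0]; congr 1; ring
    have e5 : ρ ^ (β - s) * ρ ^ (-β) = ρ ^ (-s) := by rw [← Real.rpow_add hρ0]; congr 1; ring
    have hlβ : 0 ≤ l ^ (-β) := by positivity
    calc _ ≤ (l ^ (-β) * ρ ^ (β - t) + l ^ (-β) * ρ ^ (β - s)) * (4 * ρ ^ (-β)) :=
          mul_le_mul (add_le_add e1 e2) e3 (by positivity) (by positivity)
      _ = 4 * (l ^ (-β) * (ρ ^ (β - t) * ρ ^ (-β)) + l ^ (-β) * (ρ ^ (β - s) * ρ ^ (-β))) := by ring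
      _ = 4 * (l ^ (-β) * ρ ^ (-t) + l ^ (-β) * ρ ^ (-s)) := by rw [e4, e5]
      _ ≤ _ := by nlinarith [mul_le_mul_of_nonneg_left hlast hlβ]

/-- The integral controlling the potential; the far part with an arbitrary power is used to compare
the potential at two points. -/
theorem intBound_near_far (he : Exponents θ t s β) (hr : 0 ≤ r) (hz : 0 ≤ z) {B b : ℝ} (hb : 0 < b) :
    IntBound (fun l => if l ≤ 1 + r + z then l * coarse t s β 0 r z l else B * l ^ (-1 - b))
      (8 / θ * (1 + r + z) ^ (2 - t - β) + B * ((1 + r + z) ^ (-b) / b)) := by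
  have hρ0 : 0 < 1 + r + z := by linarith
  -- The weight `l` turns `l^{-β}` into `l^{-(β-1)}`, integrable at zero because `β ≤ 2 - θ`.
  have h := intBound_two_powers (A := 8 * (1 + r + z) ^ (-t)) (B := B)
    (show β - 1 < 1 by linarith [he.β_le, he.pos]) hb hρ0
  refine h.mono (fun l hl => ?_) (add_le_add ?_ le_rfl)
  · split_ifs with hlρ
    · have h1 := mul_le_mul_of_nonneg_left (coarse_le_near he hr hz hl hlρ) hl.le
      have e : l ^ (-(β - 1)) = l * l ^ (-β) := by
        rw [neg_sub, sub_eq_add_neg, Real.rpow_add hl, Real.rpow_one]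
      rw [e]
      linarith
    · exact le_rfl
  · have hθ := he.pos
    have e : (1 + r + z) ^ (2 - t - β) = (1 + r + z) ^ (-t) * (1 + r + z) ^ (1 - (β - 1)) := by
      rw [← Real.rpow_add hρ0]; congr 1; ring
    have h1 : (1 + r + z) ^ (1 - (β - 1)) / (1 - (β - 1)) ≤ (1 + r + z) ^ (1 - (β - 1)) / θ := by
      gcongr
      linarith [he.β_le]
    calc _ ≤ 8 * (1 + r + z) ^ (-t) * ((1 + r + z) ^ (1 - (β - 1)) / θ) := by gcongr
      _ = _ := by rw [e]; ring

/-- Beyond `1+r+z` the integrand is of size `l^{1-t-β}`, barely integrable when `t + β - 2` is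
small. This is the only source of the large factor `1/(t+β-2)`. -/
theorem intBound_potential (he : Exponents θ t s β) (hr : 0 ≤ r) (hz : 0 ≤ z) :
    IntBound (fun l => l * coarse t s β 0 r z l)
      ((8 / θ + 2) / (t + β - 2) * (1 + r + z) ^ (2 - t - β)) := by
  have hσ : 0 < t + β - 2 := by linarith [he.sum_gt]
  have hσ1 : t + β - 2 ≤ 1 := by linarith [he.sum_le]
  have hθ := he.pos
  refine (intBound_near_far he hr hz (B := 2) hσ).mono (fun l hl => ?_) ?_
  · split_ifs with hlρ
    · exact le_rfl
    · have h1 := mul_le_mul_of_nonneg_left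
        (coarse_le_far he le_rfl hr hz (l := l) (by linarith)) hl.le
      refine h1.trans (le_of_eq ?_)
      have e : l ^ (-1 - (t + β - 2)) = l * l ^ (-(0 + t + β)) := by
        rw [show -1 - (t + β - 2) = 1 + -(0 + t + β) by ring, Real.rpow_add hl, Real.rpow_one]
      rw [e]; ring
  · have e : -(t + β - 2) = 2 - t - β := by ring
    rw [e]
    have hP : 0 ≤ (1 + r + z) ^ (2 - t - β) := by positivity
    have : 8 / θ ≤ 8 / θ / (t + β - 2) := by
      rw [le_div_iff₀ hσ]
      exact mul_le_of_le_one_right (by positivity) hσ1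
    calc _ ≤ 8 / θ / (t + β - 2) * (1 + r + z) ^ (2 - t - β) +
          2 * ((1 + r + z) ^ (2 - t - β) / (t + β - 2)) := by gcongr
      _ = _ := by ring

/-- A bound of the gradient integral that is sharp when `r` is dominated by `1 + z`. -/
theorem intBound_coarse (he : Exponents θ t s β) (hr : 0 ≤ r) (hz : 0 ≤ z) :
    IntBound (fun l => coarse t s β 0 r z l) ((2 / θ + 2) * (1 + z) ^ (1 - t - β)) := by
  obtain ⟨h0, h1, h2, h3, h4, h5, h6, -⟩ := id he
  obtain ⟨R, hR⟩ : ∃ R, R = 1 + z := ⟨_, rfl⟩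
  rw [← hR]
  have hR1 : 1 ≤ R := by linarith
  have hR0 : 0 < R := by linarith
  -- Below the scale `1+z` the axial factor is frozen and the radial one is at worst of order
  -- `l^{-s}`, integrable since `s ≤ 1 - θ`.
  refine (intBound_two_powers (A := 2 * R ^ (s - t - β)) (B := 2) (a := s) (b := t + β - 1)
    (by linarith) (by linarith) hR0).mono (fun l hl => ?_) ?_
  · split_ifs with hlR
    · unfold coarse
      rw [zero_add, zero_add]
      have e1 : (r + l) ^ (-t) ≤ l ^ (-s) * R ^ (s - t) :=
        (rpow_neg_anti hl (by linarith) (by linarith)).trans (rpow_neg_trade hl hlR (by linarith))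
      have e2 : (r + l) ^ (-s) ≤ l ^ (-s) * R ^ (s - t) := by
        refine (rpow_neg_anti hl (by linarith) (by linarith)).trans ?_
        exact le_mul_of_one_le_right (by positivity) (Real.one_le_rpow hR1 (by linarith))
      have e3 : (1 + z + l) ^ (-β) ≤ R ^ (-β) := rpow_neg_anti hR0 (by linarith) (by linarith)
      have e4 : R ^ (s - t - β) = R ^ (s - t) * R ^ (-β) := by
        rw [← Real.rpow_add hR0]; congr 1
      calc _ ≤ (l ^ (-s) * R ^ (s - t) + l ^ (-s) * R ^ (s - t)) * R ^ (-β) :=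
            mul_le_mul (add_le_add e1 e2) e3 (by positivity) (by positivity)
        _ = _ := by rw [e4]; ring
    · refine (coarse_le_far he le_rfl hr hz (by linarith)).trans (le_of_eq ?_)
      congr 2; ring
  · have e1 : R ^ (s - t - β) * R ^ (1 - s) = R ^ (1 - t - β) := by
      rw [← Real.rpow_add hR0]; congr 1; ring
    have e2 : -(t + β - 1) = 1 - t - β := by ring
    rw [e2]
    have hP : 0 ≤ R ^ (1 - t - β) := by positivity
    have i1 : R ^ (1 - t - β) / (1 - s) ≤ R ^ (1 - t - β) / θ := by
      gcongr; linarith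
    have i2 : R ^ (1 - t - β) / (t + β - 1) ≤ R ^ (1 - t - β) :=
      div_le_self hP (by linarith)
    calc _ = 2 * (R ^ (s - t - β) * R ^ (1 - s) / (1 - s)) +
          2 * (R ^ (1 - t - β) / (t + β - 1)) := by ring
      _ ≤ 2 * (R ^ (1 - t - β) / θ) + 2 * R ^ (1 - t - β) := by rw [e1]; gcongr
      _ = _ := by ring

/-- Without the weight `l` the tail is `l^{-(t+β)}`, with `t + β > 2`, so no factor `1/(t+β-2)`
appears. If `r < 1+z` then `1+z` is comparable with `1+r+z` and the previous bound applies.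
Otherwise the radial factor is frozen at `r^{-t}` and only `(1+z+l)^{-β}` is integrated. -/
theorem intBound_gradient (he : Exponents θ t s β) (hr : 0 ≤ r) (hz : 0 ≤ z) :
    IntBound (fun l => coarse t s β 0 r z l)
      ((8 / θ + 8) * ((1 + r + z) ^ (-t) * (1 + z) ^ (1 - β))) := by
  obtain ⟨h0, h1, h2, h3, h4, h5, h6, -⟩ := id he
  have hρ0 : 0 < 1 + r + z := by linarith
  obtain ⟨R, hR⟩ : ∃ R, R = 1 + z := ⟨_, rfl⟩
  have hR1 : 1 ≤ R := by linarith
  have hR0 : 0 < R := by linarith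
  rcases lt_or_ge r (1 + z) with h | h
  · refine (intBound_coarse he hr hz).mono (fun _ _ => le_rfl) ?_
    rw [← hR]
    have e1 : R ^ (1 - t - β) = R ^ (-t) * R ^ (1 - β) := by
      rw [← Real.rpow_add hR0]; congr 1; ring
    have e2 : R ^ (-t) ≤ 4 * (1 + r + z) ^ (-t) :=
      rpow_neg_le_of_half hρ0 (by linarith) (by linarith) (by linarith)
    calc _ ≤ (2 / θ + 2) * ((4 * (1 + r + z) ^ (-t)) * R ^ (1 - β)) := by rw [e1]; gcongr
      _ = _ := by ring
  · rw [← hR] at h ⊢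
    have hr1 : 1 ≤ r := by linarith
    have hr0 : 0 < r := by linarith
    refine (intBound_two_powers (A := 2 * (r ^ (-t) * R ^ (-β))) (B := 2 * r ^ (-t)) (a := 0)
      (b := β - 1) (by linarith) (by linarith) hR0).mono (fun l hl => ?_) ?_
    · have e1 : (r + l) ^ (-t) ≤ r ^ (-t) := rpow_neg_anti hr0 (by linarith) (by linarith)
      have e2 : (r + l) ^ (-s) ≤ r ^ (-t) :=
        (rpow_neg_anti hr0 (by linarith) (by linarith)).trans (rpow_neg_exp_anti hr1 h2)
      unfold coarse
      rw [zero_add, zero_add]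
      split_ifs with hlR
      · have e3 : (1 + z + l) ^ (-β) ≤ R ^ (-β) := rpow_neg_anti hR0 (by linarith) (by linarith)
        rw [neg_zero, Real.rpow_zero, mul_one, ← mul_assoc]
        exact mul_le_mul (by linarith) e3 (by positivity) (by positivity)
      · have e3 : (1 + z + l) ^ (-β) ≤ l ^ (-β) := rpow_neg_anti hl (by linarith) (by linarith)
        have e4 : -1 - (β - 1) = -β := by ring
        rw [e4]
        exact mul_le_mul (by linarith) e3 (by positivity) (by positivity)
    · have e1 : R ^ (1 - β) = R ^ (-β) * R ^ (1 : ℝ) := by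
        rw [← Real.rpow_add hR0]; congr 1; ring
      have e2 : r ^ (-t) ≤ 4 * (1 + r + z) ^ (-t) :=
        rpow_neg_le_of_half hρ0 (by linarith) (by linarith) (by linarith)
      have e3 : -(β - 1) = 1 - β := by ring
      have hP : 0 ≤ R ^ (1 - β) := by positivity
      have i1 : R ^ (1 - β) / (β - 1) ≤ R ^ (1 - β) / θ := by gcongr; linarith
      calc _ = 2 * r ^ (-t) * (R ^ (-β) * R ^ (1 : ℝ)) +
            2 * r ^ (-t) * (R ^ (1 - β) / (β - 1)) := by rw [e3, sub_zero]; ring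
        _ ≤ 2 * r ^ (-t) * R ^ (1 - β) + 2 * r ^ (-t) * (R ^ (1 - β) / θ) := by
            rw [← e1]; gcongr
        _ = (2 / θ + 2) * (r ^ (-t) * R ^ (1 - β)) := by ring
        _ ≤ (2 / θ + 2) * ((4 * (1 + r + z) ^ (-t)) * R ^ (1 - β)) := by gcongr
        _ = _ := by ring

/-- The integral controlling the radial derivative. -/
theorem intBound_radial (he : Exponents θ t s β) (hr : 0 ≤ r) (hz : 0 ≤ z) :
    IntBound (fun l => l * coarse t s β 1 r z l)
      ((8 / θ + 8) * (1 + r + z) ^ (1 - t - β)) := by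
  obtain ⟨h0, h1, h2, h3, h4, h5, h6, h7⟩ := id he
  have hρ0 : 0 < 1 + r + z := by linarith
  have hfin : ∀ x : ℝ, 0 < x → (1 + r + z) / 2 ≤ x → (2 / θ + 2) * x ^ (1 - t - β) ≤
      (8 / θ + 8) * (1 + r + z) ^ (1 - t - β) := by
    intro x hx hx2
    have e : x ^ (-(t + β - 1)) ≤ 4 * (1 + r + z) ^ (-(t + β - 1)) :=
      rpow_neg_le_of_half hρ0 hx2 (by linarith) (by linarith)
    rw [show -(t + β - 1) = 1 - t - β by ring] at e
    calc _ ≤ (2 / θ + 2) * (4 * (1 + r + z) ^ (1 - t - β)) := by gcongr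
      _ = _ := by ring
  rcases lt_or_ge r (1 + z) with h | h
  · refine (intBound_coarse he hr hz).mono (fun l hl => ?_)
      (hfin _ (by linarith) (by linarith))
    have hrl : 0 < r + l := by linarith
    -- For `r < 1+z` the weight `l` cancels the extra power of `r+l`, and the integral without
    -- derivative is already sharp. For larger `r` the extra power is frozen at `1/r` below the
    -- scale `r`.
    have key : ∀ α : ℝ, l * (r + l) ^ (-(1 + α)) ≤ (r + l) ^ (-(0 + α)) := fun α => by
      rw [neg_add, Real.rpow_add hrl, Real.rpow_neg_one, zero_add, ← mul_assoc]
      refine mul_le_of_le_one_left (by positivity) ?_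
      rw [← div_eq_mul_inv, div_le_one hrl]
      linarith
    unfold coarse
    rw [← mul_assoc, mul_add]
    exact mul_le_mul_of_nonneg_right (add_le_add (key t) (key s)) (by positivity)
  · have hr1 : 1 ≤ r := by linarith
    have hr0 : 0 < r := by linarith
    refine (intBound_two_powers (A := 2 * r ^ (-(1 + t))) (B := 2) (a := β - 1)
      (b := t + β - 1) (by linarith) (by linarith) hr0).mono (fun l hl => ?_) ?_
    · split_ifs with hlr
      · have e1 : (r + l) ^ (-(1 + t)) ≤ r ^ (-(1 + t)) :=
          rpow_neg_anti hr0 (by linarith) (by linarith)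
        have e2 : (r + l) ^ (-(1 + s)) ≤ r ^ (-(1 + t)) :=
          (rpow_neg_anti hr0 (by linarith) (by linarith)).trans
            (rpow_neg_exp_anti hr1 (by linarith))
        have e3 : (1 + z + l) ^ (-β) ≤ l ^ (-β) := rpow_neg_anti hl (by linarith) (by linarith)
        have e : l ^ (-(β - 1)) = l * l ^ (-β) := by
          rw [neg_sub, sub_eq_add_neg, Real.rpow_add hl, Real.rpow_one]
        rw [e, mul_left_comm]
        refine mul_le_mul_of_nonneg_left ?_ hl.le
        exact mul_le_mul (by linarith) e3 (by positivity) (by positivity)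
      · have h1 := mul_le_mul_of_nonneg_left
          (coarse_le_far he zero_le_one hr hz (l := l) (by linarith)) hl.le
        refine h1.trans (le_of_eq ?_)
        have e : l ^ (-1 - (t + β - 1)) = l * l ^ (-(1 + t + β)) := by
          rw [show -1 - (t + β - 1) = 1 + -(1 + t + β) by ring, Real.rpow_add hl, Real.rpow_one]
        rw [e]; ring
    · refine le_trans ?_ (hfin r hr0 (by linarith))
      have e1 : r ^ (-(1 + t)) * r ^ (1 - (β - 1)) = r ^ (1 - t - β) := by
        rw [← Real.rpow_add hr0]; congr 1; ring
      have e2 : -(t + β - 1) = 1 - t - β := by ring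
      rw [e2]
      have hP : 0 ≤ r ^ (1 - t - β) := by positivity
      have i1 : r ^ (1 - t - β) / (1 - (β - 1)) ≤ r ^ (1 - t - β) / θ := by
        gcongr; linarith
      have i2 : r ^ (1 - t - β) / (t + β - 1) ≤ r ^ (1 - t - β) := div_le_self hP (by linarith)
      calc _ = 2 * (r ^ (-(1 + t)) * r ^ (1 - (β - 1)) / (1 - (β - 1))) +
            2 * (r ^ (1 - t - β) / (t + β - 1)) := by ring
        _ ≤ 2 * (r ^ (1 - t - β) / θ) + 2 * r ^ (1 - t - β) := by rw [e1]; gcongr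
        _ = _ := by ring

/-- The integral is of order `r^{-α}/α`; the lower bound `θ ≤ α` keeps the constant uniform. -/
theorem intBound_one_add (hr : 0 < r) (hθ : 0 < θ) {α M : ℝ} (hα : θ ≤ α) (hM : 0 ≤ M) :
    IntBound (fun l => M * (r + l) ^ (-(1 + α))) ((1 / θ + 1) * (M * r ^ (-α))) := by
  have hα0 : 0 < α := by linarith
  refine (intBound_two_powers (A := M * r ^ (-(1 + α))) (B := M) (a := 0) (b := α) (by linarith)
    hα0 hr).mono (fun l hl => ?_) ?_
  · split_ifs with h
    · rw [neg_zero, Real.rpow_zero, mul_one]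
      exact mul_le_mul_of_nonneg_left (rpow_neg_anti hr (by linarith) (by linarith)) hM
    · rw [show -1 - α = -(1 + α) by ring]
      exact mul_le_mul_of_nonneg_left (rpow_neg_anti hl (by linarith) (by linarith)) hM
  · have e : r ^ (-(1 + α)) * r ^ (1 - 0 : ℝ) = r ^ (-α) := by
      rw [← Real.rpow_add hr]; congr 1; ring
    have hP : 0 ≤ r ^ (-α) := by positivity
    have i1 : r ^ (-α) / α ≤ r ^ (-α) / θ := by gcongr
    calc _ = M * (r ^ (-(1 + α)) * r ^ (1 - 0 : ℝ)) + M * (r ^ (-α) / α) := by ring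
      _ ≤ M * r ^ (-α) + M * (r ^ (-α) / θ) := by rw [e]; gcongr
      _ = _ := by ring

/-- The Hessian integral away from the axis `r = 0`. -/
theorem intBound_hessian_coarse (he : Exponents θ t s β) (hr : 1 / 2 ≤ r) (hz : 0 ≤ z) :
    IntBound (fun l => coarse t s β 1 r z l) (3 * (1 / θ + 1) * (r ^ (-t) * (1 + z) ^ (-β))) := by
  obtain ⟨h0, h1, h2, h3, h4, h5, h6, h7⟩ := id he
  have hr0 : 0 < r := by linarith
  have hR0 : 0 < 1 + z := by linarith
  have hM : 0 ≤ (1 + z) ^ (-β) := by positivity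
  refine ((intBound_one_add hr0 h0 h1 hM).add
    (intBound_one_add hr0 h0 (h1.trans h2) hM)).mono (fun l hl => ?_) ?_
  · have e3 : (1 + z + l) ^ (-β) ≤ (1 + z) ^ (-β) := rpow_neg_anti hR0 (by linarith) (by linarith)
    unfold coarse
    rw [← mul_add, mul_comm]
    exact mul_le_mul_of_nonneg_right e3 (by positivity)
  -- Away from the axis the two powers are comparable in this direction, because `0 ≤ s - t ≤ 1` and
  -- `r ≥ 1/2`.
  · have e : r ^ (-s) ≤ 2 * r ^ (-t) := by
      have e1 : r ^ (-s) = r ^ (-t) * r ^ (-(s - t)) := by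
        rw [← Real.rpow_add hr0]; congr 1; ring
      have e2 : r ^ (-(s - t)) ≤ 2 := by
        refine (rpow_neg_anti (by norm_num : (0 : ℝ) < 1 / 2) hr (by linarith)).trans ?_
        rw [one_div, Real.inv_rpow (by norm_num), Real.rpow_neg (by norm_num), inv_inv]
        calc (2 : ℝ) ^ (s - t) ≤ 2 ^ (1 : ℝ) :=
              Real.rpow_le_rpow_of_exponent_le (by norm_num) (by linarith)
          _ = 2 := Real.rpow_one 2
      rw [e1, mul_comm]
      exact mul_le_mul_of_nonneg_right e2 (by positivity)
    calc _ ≤ (1 / θ + 1) * ((1 + z) ^ (-β) * r ^ (-t)) +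
          (1 / θ + 1) * ((1 + z) ^ (-β) * (2 * r ^ (-t))) := by gcongr
      _ = _ := by ring

/-- The Hessian integral near the origin. -/
theorem intBound_hessian_fine (he : Exponents θ t s β) (hr : 0 < r) (hz : 0 ≤ z) :
    IntBound (fun l => (r + l) ^ (-(1 + t)) * (1 + z + l) ^ (-β) + (r + l) ^ (-(1 + s)) * 1)
      ((1 / θ + 1) * (r ^ (-t) * (1 + z) ^ (-β) + r ^ (-s))) := by
  obtain ⟨h0, h1, h2, h3, h4, h5, h6, h7⟩ := id he
  have hR0 : 0 < 1 + z := by linarith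
  have hM : 0 ≤ (1 + z) ^ (-β) := by positivity
  refine ((intBound_one_add hr h0 h1 hM).add
    (intBound_one_add hr h0 (h1.trans h2) zero_le_one)).mono (fun l hl => ?_) (le_of_eq (by ring))
  have e3 : (1 + z + l) ^ (-β) ≤ (1 + z) ^ (-β) := rpow_neg_anti hR0 (by linarith) (by linarith)
  rw [mul_one, one_mul, mul_comm]
  exact add_le_add (mul_le_mul_of_nonneg_right e3 (by positivity)) le_rfl

/-- The Hessian integral near the axis `r = 0` away from the origin. -/
theorem intBound_hessian_axis (he : Exponents θ t s β) (hr : 0 < r) (hr1 : r ≤ 1) (hz : 3 / 4 ≤ z) :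
    IntBound (fun l => min (coarse t s β 1 r z l)
      ((r + l) ^ (-(1 + t)) * (1 + z + l) ^ (-β) + (r + l) ^ (-(1 + s)) * (l / z) ^ 2))
      (8 * (1 / θ + 1) * (r ^ (-t) * (1 + z) ^ (-β))) := by
  obtain ⟨h0, h1, h2, h3, h4, h5, h6, h7⟩ := id he
  have hz0 : 0 < z := by linarith
  have hR0 : 0 < 1 + z := by linarith
  have hM : 0 ≤ (1 + z) ^ (-β) := by positivity
  have hs0 : 0 < s := by linarith
  -- The regular part is integrated as before. The singular part is split at scale one: below it the
  -- gain `(l/z)²` replaces `l^{-1-s}` by `l^{1-s}`, with `z^{-2}` at most a multiple of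
  -- `(1+z)^{-β}`; above it the coarse bound already carries `(1+z)^{-β}`.
  refine ((intBound_one_add hr h0 h1 hM).add
    (intBound_two_powers (A := (z ^ 2)⁻¹) (B := (1 + z) ^ (-β)) (a := s - 1) (b := s) (ρ := 1)
      (by linarith) hs0 one_pos)).mono (fun l hl => ?_) ?_
  · have e3 : (1 + z + l) ^ (-β) ≤ (1 + z) ^ (-β) := rpow_neg_anti hR0 (by linarith) (by linarith)
    have e4 : (r + l) ^ (-(1 + s)) ≤ l ^ (-(1 + s)) := rpow_neg_anti hl (by linarith) (by linarith)
    have e5 : (r + l) ^ (-(1 + t)) * (1 + z + l) ^ (-β) ≤ (1 + z) ^ (-β) * (r + l) ^ (-(1 + t)) := by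
      rw [mul_comm]
      exact mul_le_mul_of_nonneg_right e3 (by positivity)
    split_ifs with h
    · refine (min_le_right _ _).trans (add_le_add e5 ?_)
      have e6 : (z ^ 2)⁻¹ * l ^ (-(s - 1)) = l ^ (-(1 + s)) * (l / z) ^ 2 := by
        rw [show -(s - 1) = -(1 + s) + 2 by ring, Real.rpow_add hl, div_pow]
        norm_cast
        field_simp
      rw [e6]
      exact mul_le_mul_of_nonneg_right e4 (by positivity)
    · refine (min_le_left _ _).trans ?_
      unfold coarse
      rw [add_mul]
      refine add_le_add e5 ?_
      rw [mul_comm, show -1 - s = -(1 + s) by ring]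
      exact mul_le_mul e3 e4 (by positivity) hM
  · have hz2 : (z ^ 2)⁻¹ ≤ 6 * (1 + z) ^ (-β) := by
      have e1 : (1 + z) ^ (-(2 : ℝ)) ≤ (1 + z) ^ (-β) :=
        rpow_neg_exp_anti (by linarith) (by linarith)
      have e2 : (z ^ 2)⁻¹ ≤ 6 * (1 + z) ^ (-(2 : ℝ)) := by
        rw [Real.rpow_neg hR0.le, inv_le_iff_one_le_mul₀ (by positivity)]
        norm_cast
        rw [mul_assoc, ← div_eq_inv_mul, mul_div_assoc', le_div_iff₀ (by positivity)]
        nlinarith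
      linarith
    have hone : 1 ≤ r ^ (-t) := Real.one_le_rpow_of_pos_of_le_one_of_nonpos hr hr1 (by linarith)
    have hMr : (1 + z) ^ (-β) ≤ r ^ (-t) * (1 + z) ^ (-β) := le_mul_of_one_le_left hM hone
    rw [Real.one_rpow, Real.one_rpow]
    have i1 : 1 / s ≤ 1 / θ := by gcongr; linarith
    have i2 : 1 / (1 - (s - 1)) ≤ 1 :=
      (div_le_one (by linarith)).2 (by linarith)
    have hθ' : 0 ≤ 1 / θ := by positivity
    have i3 : (z ^ 2)⁻¹ * (1 / (1 - (s - 1))) ≤ 6 * (1 + z) ^ (-β) * 1 := by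
      refine mul_le_mul hz2 i2 ?_ (by positivity)
      exact div_nonneg zero_le_one (by linarith)
    have i4 : (1 + z) ^ (-β) * (1 / s) ≤ (1 + z) ^ (-β) * (1 / θ) := by gcongr
    have i5 : (1 + z) ^ (-β) * (1 / θ) ≤ r ^ (-t) * (1 + z) ^ (-β) * (1 / θ) := by gcongr
    have i6 : 0 ≤ r ^ (-t) * (1 + z) ^ (-β) * (1 / θ) := by positivity
    nlinarith

end

end

section

variable {d : ℕ}

/-! ### The potential as an integral over scales -/

theorem measurable_smear {h f : Space d → ℝ} (hh : Measurable h) (hf : Measurable f) (X : Space d) :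
    StronglyMeasurable fun l => smear h f l X := by
  have : Measurable fun p : ℝ × Space d => h p.2 * f (X + p.1 • p.2) := by fun_prop
  exact this.stronglyMeasurable.integral_prod_right

/-- The substitution `v = l^{-2}` turns the integral into one for the Gamma function. With `ρ =
|X-Y|` this writes the Newtonian kernel as a superposition of Gaussians over scales. Integrability
again follows from the nonzero value. -/
theorem integrableOn_and_integral_scale_kernel {ρ : ℝ} (hρ : 0 < ρ) :
    IntegrableOn (fun l : ℝ => l / 2 * (l ^ (d + 4))⁻¹ * Real.exp (-(ρ ^ 2 / l ^ 2))) (Ioi 0) ∧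
    ∫ l in Ioi (0 : ℝ), l / 2 * (l ^ (d + 4))⁻¹ * Real.exp (-(ρ ^ 2 / l ^ 2)) =
      1 / 4 * Real.Gamma (((d : ℝ) + 2) / 2) * (ρ ^ (d + 2))⁻¹ := by
  have ha : (0 : ℝ) < ((d : ℝ) + 2) / 2 := by positivity
  have hb : 0 < ρ ^ 2 := by positivity
  obtain ⟨g, hg⟩ : ∃ g : ℝ → ℝ, g = fun v => v ^ (((d : ℝ) + 2) / 2 - 1) * Real.exp (-(ρ ^ 2 * v)) :=
    ⟨_, rfl⟩
  have hpt : ∀ l ∈ Ioi (0 : ℝ), l / 2 * (l ^ (d + 4))⁻¹ * Real.exp (-(ρ ^ 2 / l ^ 2)) =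
      1 / 4 * ((|(-2 : ℝ)| * l ^ ((-2 : ℝ) - 1)) • g (l ^ (-2 : ℝ))) := by
    intro l hl
    have hl0 : 0 < l := hl
    have e1 : l ^ (-2 : ℝ) = (l ^ 2)⁻¹ := by
      rw [Real.rpow_neg hl0.le]; norm_cast
    have e2 : (l ^ (-2 : ℝ)) ^ (((d : ℝ) + 2) / 2 - 1) = l ^ (-(d : ℝ)) := by
      rw [← Real.rpow_mul hl0.le]; congr 1; ring
    have e3 : l ^ ((-2 : ℝ) - 1) = (l ^ 3)⁻¹ := by
      rw [show (-2 : ℝ) - 1 = -3 by norm_num, Real.rpow_neg hl0.le]; norm_cast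
    rw [hg]
    simp only [smul_eq_mul]
    rw [e2, e1, e3, Real.rpow_neg hl0.le, Real.rpow_natCast, ← div_eq_mul_inv (ρ ^ 2), abs_neg, abs_two]
    field_simp
    ring
  have hint : ∫ v in Ioi (0 : ℝ), g v = (1 / ρ ^ 2) ^ (((d : ℝ) + 2) / 2) * Real.Gamma (((d : ℝ) + 2) / 2) := by
    rw [hg]; exact Real.integral_rpow_mul_exp_neg_mul_Ioi ha hb
  have hpow : (1 / ρ ^ 2) ^ (((d : ℝ) + 2) / 2) = (ρ ^ (d + 2))⁻¹ := by
    rw [one_div, Real.inv_rpow hb.le, ← Real.rpow_natCast ρ 2, ← Real.rpow_mul hρ.le,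
      ← Real.rpow_natCast ρ (d + 2)]
    congr 2
    push_cast
    ring
  have hval := integral_comp_rpow_Ioi g (show (-2 : ℝ) ≠ 0 by norm_num)
  have htot : ∫ l in Ioi (0 : ℝ), l / 2 * (l ^ (d + 4))⁻¹ * Real.exp (-(ρ ^ 2 / l ^ 2)) =
      1 / 4 * Real.Gamma (((d : ℝ) + 2) / 2) * (ρ ^ (d + 2))⁻¹ := by
    rw [setIntegral_congr_fun measurableSet_Ioi hpt, integral_const_mul, hval, hint, hpow]
    ring
  refine ⟨?_, htot⟩
  refine not_imp_comm.1 integral_undef ?_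
  rw [htot]
  have := Real.Gamma_pos_of_pos ha
  positivity

/-- The unit ball has volume `π^{(d+4)/2}/Γ((d+4)/2+1)`, and two steps of the Gamma recursion cancel
`(d+4)(d+2)`. What remains is the constant of the scale integral times `π^{-(d+4)/2}`, the
normalization of the Gaussian to mass one. -/
theorem betaConst_eq : betaConst d =
    Real.pi ^ (-(((d : ℝ) + 4) / 2)) * (1 / 4 * Real.Gamma (((d : ℝ) + 2) / 2)) := by
  have hd : (0 : ℝ) ≤ d := Nat.cast_nonneg d
  have hG : Real.Gamma (((d : ℝ) + 4) / 2 + 1) =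
      ((d : ℝ) + 4) / 2 * (((d : ℝ) + 2) / 2 * Real.Gamma (((d : ℝ) + 2) / 2)) := by
    rw [Real.Gamma_add_one (by positivity), show ((d : ℝ) + 4) / 2 = ((d : ℝ) + 2) / 2 + 1 by ring,
      Real.Gamma_add_one (by positivity)]
  have hGpos : 0 < Real.Gamma (((d : ℝ) + 2) / 2) := Real.Gamma_pos_of_pos (by positivity)
  have hv : volume.real (Metric.ball (0 : EuclideanSpace ℝ (Fin (d + 4))) 1) =
      Real.pi ^ (((d : ℝ) + 4) / 2) / Real.Gamma (((d : ℝ) + 4) / 2 + 1) := by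
    have : Nonempty (Fin (d + 4)) := ⟨0⟩
    rw [measureReal_def, EuclideanSpace.volume_ball]
    simp only [ENNReal.ofReal_one, one_pow, one_mul, Fintype.card_fin, Nat.cast_add, Nat.cast_ofNat]
    rw [ENNReal.toReal_ofReal]
    · congr 1
      rw [Real.sqrt_eq_rpow, ← Real.rpow_natCast, ← Real.rpow_mul Real.pi_pos.le]
      congr 1
      push_cast
      ring
    · rw [hG]; positivity
  have hpi := Real.pi_pos
  rw [betaConst, hv, hG, Real.rpow_neg hpi.le]
  have : 0 < Real.pi ^ (((d : ℝ) + 4) / 2) := by positivity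
  field_simp
  norm_num

theorem integral_affine (F : Space d → ℝ) {l : ℝ} (hl : 0 < l) (X : Space d) :
    ∫ Y : Space d, F Y = l ^ (d + 4) * ∫ Z : Space d, F (X + l • Z) := by
  rw [← integral_add_left_eq_self F X]
  exact integral_comp_dilation (fun Y => F (X + Y)) hl

theorem integrable_affine {F : Space d → ℝ} {l : ℝ} (hl : 0 < l) (X : Space d)
    (h : Integrable fun Z : Space d => F (X + l • Z)) : Integrable F := by
  have h1 : Integrable fun Y : Space d => F (X + Y) :=
    (integrable_comp_smul_iff volume (fun Y : Space d => F (X + Y)) hl.ne').1 h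
  simpa using h1.comp_add_left (-X)

theorem len_sq (X : Space d) : len X ^ 2 = sqLen X :=
  Real.sq_sqrt (sqLen_nonneg X)

theorem len_pos {X : Space d} (h : X ≠ 0) : 0 < len X := by
  refine Real.sqrt_pos.2 (lt_of_le_of_ne (by positivity) fun h0 => h ?_)
  have h1 : ‖X.1‖ ^ 2 = 0 := by nlinarith [sq_nonneg ‖X.1‖, sq_nonneg ‖X.2‖]
  have h2 : ‖X.2‖ ^ 2 = 0 := by nlinarith [sq_nonneg ‖X.1‖, sq_nonneg ‖X.2‖]
  exact Prod.ext (by simpa using h1) (by simpa using h2)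

/-- The Newtonian potential of `f` is the integral of its Gaussian averages over all scales. -/
theorem integrable_newton_and_eq {f : Space d → ℝ} (hf : GaussInt f) (hf0 : ∀ Y, 0 ≤ f Y)
    (X : Space d) (hI : IntegrableOn (fun l => l / 2 * smear gker f l X) (Ioi 0)) :
    Integrable (fun Y : Space d => (len (X - Y) ^ (d + 2))⁻¹ * f Y) ∧
      betaConst d * ∫ Y : Space d, (len (X - Y) ^ (d + 2))⁻¹ * f Y =
        Real.pi ^ (-(((d : ℝ) + 4) / 2)) * ∫ l in Ioi 0, l / 2 * smear gker f l X := by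
  have hm := hf.measurable
  obtain ⟨F, hF⟩ : ∃ F : ℝ × Space d → ℝ, F = fun p =>
      p.1 / 2 * (p.1 ^ (d + 4))⁻¹ * Real.exp (-(len (X - p.2) ^ 2 / p.1 ^ 2)) * f p.2 := ⟨_, rfl⟩
  have hlen : Continuous (len (d := d)) := by unfold len; fun_prop
  have hFm : Measurable F := by rw [hF]; fun_prop
  have hsub : ∀ l : ℝ, 0 < l → ∀ Z : Space d, F (l, X + l • Z) =
      l / 2 * (l ^ (d + 4))⁻¹ * (gker Z * f (X + l • Z)) := by
    intro l hl Z
    rw [hF]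
    have : sqLen (X - (X + l • Z)) = l ^ 2 * sqLen Z := by
      rw [← sqLen_smul, sub_add_cancel_left]
      simp [sqLen]
    simp only [len_sq, this, gker]
    rw [mul_div_cancel_left₀ _ (by positivity)]
    ring
  have hFi : ∀ l : ℝ, 0 < l → Integrable fun Y => F (l, Y) := by
    intro l hl
    refine integrable_affine hl X ?_
    simp only [hsub l hl]
    exact (gaussKer_gker.integrable hf hl X).const_mul _
  have hFint : ∀ l : ℝ, 0 < l → ∫ Y, F (l, Y) = l / 2 * smear gker f l X := by
    intro l hl
    rw [integral_affine _ hl X]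
    simp only [hsub l hl]
    rw [integral_const_mul, smear]
    field_simp
  have hF0 : ∀ l : ℝ, 0 < l → ∀ Y, 0 ≤ F (l, Y) := by
    intro l hl Y
    rw [hF]
    have := hf0 Y
    positivity
  -- Since `F` is nonnegative for `l > 0`, integrability of the average over scales gives
  -- integrability on the product. Fubini in the other order then yields both the convergence of the
  -- Newtonian integral and its value.
  have hprod : Integrable F ((volume.restrict (Ioi 0)).prod volume) := by
    rw [integrable_prod_iff hFm.aestronglyMeasurable]
    refine ⟨(ae_restrict_iff' measurableSet_Ioi).2 (.of_forall fun l hl => hFi l hl), ?_⟩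
    refine hI.congr ((ae_restrict_iff' measurableSet_Ioi).2 (.of_forall fun l hl => ?_))
    have : ∀ Y, ‖F (l, Y)‖ = F (l, Y) := fun Y => Real.norm_of_nonneg (hF0 l hl Y)
    simp only [this]
    exact (hFint l hl).symm
  have hae : ∀ᵐ Y : Space d, Y ≠ X := by
    have h1 : ∀ᵐ y : EuclideanSpace ℝ (Fin (d + 1)), y ≠ X.1 := by rw [ae_iff]; simp
    filter_upwards [Measure.quasiMeasurePreserving_fst.ae h1] with Y hY h
    exact hY (congrArg Prod.fst h)
  have hin : ∀ Y : Space d, Y ≠ X → ∫ l in Ioi 0, F (l, Y) =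
      1 / 4 * Real.Gamma (((d : ℝ) + 2) / 2) * ((len (X - Y) ^ (d + 2))⁻¹ * f Y) := by
    intro Y hY
    have h := (integrableOn_and_integral_scale_kernel (d := d)
      (len_pos (sub_ne_zero.2 hY.symm))).2
    rw [hF]
    simp only
    rw [integral_mul_const, h]
    ring
  have hGpos : 0 < 1 / 4 * Real.Gamma (((d : ℝ) + 2) / 2) := by
    have := Real.Gamma_pos_of_pos (show (0 : ℝ) < ((d : ℝ) + 2) / 2 by positivity)
    positivity
  have hi2 : Integrable fun Y : Space d =>
      1 / 4 * Real.Gamma (((d : ℝ) + 2) / 2) * ((len (X - Y) ^ (d + 2))⁻¹ * f Y) :=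
    hprod.integral_prod_right.congr (hae.mono hin)
  refine ⟨(integrable_const_mul_iff (IsUnit.mk0 _ hGpos.ne') _).1 hi2, ?_⟩
  have hswap := integral_integral_swap (f := fun l Y => F (l, Y)) hprod
  rw [setIntegral_congr_fun measurableSet_Ioi hFint, integral_congr_ae (hae.mono hin),
    integral_const_mul] at hswap
  rw [betaConst_eq, mul_assoc, ← hswap]

end

section

variable {d : ℕ}

/-! ### The potential and its derivatives -/

/-- The potential of the source `w`, up to normalization. -/
noncomputable def pot (w : ℝ × ℝ → ℝ) (X : Space d) : ℝ :=
  ∫ l in Ioi 0, l / 2 * smear gker (lift w) l X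

/-- The first derivatives of the potential. -/
noncomputable def potOne (w : ℝ × ℝ → ℝ) (v X : Space d) : ℝ :=
  ∫ l in Ioi 0, 1 / 2 * smear (gkerOne v) (lift w) l X

/-- The second derivatives of the potential. -/
noncomputable def potTwo (w : ℝ × ℝ → ℝ) (v u X : Space d) : ℝ :=
  ∫ l in Ioi 0, 1 / (2 * l) * smear (gkerTwo v u) (lift w) l X

theorem smear_neg (h f : Space d → ℝ) (l : ℝ) (X : Space d) :
    smear (fun Z => -h Z) f l X = -smear h f l X := by
  unfold smear
  rw [← integral_neg]
  simp only [neg_mul]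

theorem GaussKer.neg {A : ℝ} {h : Space d → ℝ} (hh : GaussKer A h) : GaussKer A (fun Z => -h Z) :=
  ⟨hh.continuous.neg, fun Z => by rw [abs_neg]; exact hh.le Z⟩

theorem gkerTwo_comm (v u : Space d) : gkerTwo v u = gkerTwo u v := by
  ext Z
  rw [gkerTwo, gkerTwo, dot_comm v u]
  ring

theorem potTwo_comm (w : ℝ × ℝ → ℝ) (v u X : Space d) : potTwo w v u X = potTwo w u v X := by
  rw [potTwo, gkerTwo_comm, potTwo]

section

variable {θ t s β C : ℝ} {w : ℝ × ℝ → ℝ}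

/-- Gives a majorant independent of the point, as needed to differentiate under the scale integral.
-/
theorem coarse_le_origin (he : Exponents θ t s β) {r z l : ℝ} (hr : 0 ≤ r) (hz : 0 ≤ z)
    (hl : 0 < l) : coarse t s β 0 r z l ≤ coarse t s β 0 0 0 l := by
  obtain ⟨h0, h1, h2, h3, h4, h5, -, -⟩ := he
  unfold coarse
  rw [zero_add, zero_add, zero_add, add_zero]
  have e1 : (r + l) ^ (-t) ≤ l ^ (-t) := rpow_neg_anti hl (by linarith) (by linarith)
  have e2 : (r + l) ^ (-s) ≤ l ^ (-s) := rpow_neg_anti hl (by linarith) (by linarith)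
  have e3 : (1 + z + l) ^ (-β) ≤ (1 + l) ^ (-β) :=
    rpow_neg_anti (by linarith) (by linarith) (by linarith)
  exact mul_le_mul (add_le_add e1 e2) e3 (by positivity) (by positivity)

theorem Source.integrableOn_pot (hd : 3 ≤ d) (hw : Source t s β C w) (he : Exponents θ t s β)
    (X : Space d) : IntegrableOn (fun l => l / 2 * smear gker (lift w) l X) (Ioi 0) := by
  obtain ⟨K, hK, hKb⟩ := exists_abs_smear_le_coarse hd
  refine ((intBound_potential he (norm_nonneg X.1) (norm_nonneg X.2)).const_mul
    (c := 1 / 2 * (K * (1 * C))) (by have := hw.nonneg_const; positivity)).integrableOn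
    ((measurable_id.div_const 2).stronglyMeasurable.mul (measurable_smear
      gaussKer_gker.continuous.measurable hw.measurable_lift X)).aestronglyMeasurable fun l hl => ?_
  rw [abs_mul, abs_of_pos (by positivity : 0 < l / 2)]
  have := mul_le_mul_of_nonneg_left (hKb he le_rfl zero_le_one hw.nonneg_const gaussKer_gker
    hw.lift_le_fine hl X) (by positivity : 0 ≤ l / 2)
  linarith

/-- The factor `1/l` from the kernel reduces the weight `l/2` to `1/2`, and the bound at the origin
dominates the integrand at all points. No restriction to the complement of the axes is needed for
first derivatives. -/
theorem Source.dirDeriv_pot (hd : 3 ≤ d) (hw : Source t s β C w) (he : Exponents θ t s β)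
    {v : Space d} (hv : SubUnit v) : DirDeriv v (pot w) (potOne w v) := by
  intro X
  obtain ⟨K, hK, hKb⟩ := exists_abs_smear_le_coarse hd
  have hC := hw.nonneg_const
  obtain ⟨G, hG, hle, -⟩ := (intBound_gradient he le_rfl le_rfl).const_mul
    (c := 1 / 2 * (K * (4 * C))) (by positivity)
  have hf := hw.gaussInt_lift hd he
  have hder : ∀ l : ℝ, 0 < l → DirDeriv v (smear gker (lift w) l)
      (fun X => 1 / l * smear (gkerOne v) (lift w) l X) := by
    intro l hl Y
    refine (hasDerivAt_smear gaussKer_gker hv.gaussKer_gkerOne.neg (dirDeriv_gker v) hf hl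
      Y).congr_deriv ?_
    rw [smear_neg]; ring
  have key := hasDerivAt_integral_of_dominated_loc_of_deriv_le (μ := volume.restrict (Ioi (0 : ℝ)))
    (s := Metric.ball 0 1) (x₀ := (0 : ℝ)) (bound := G)
    (F := fun (s : ℝ) l => l / 2 * smear gker (lift w) l (X + s • v))
    (F' := fun (s : ℝ) l => 1 / 2 * smear (gkerOne v) (lift w) l (X + s • v))
    (Metric.ball_mem_nhds _ one_pos)
    (.of_forall fun s => ((measurable_id.div_const 2).stronglyMeasurable.mul (measurable_smear
      gaussKer_gker.continuous.measurable hw.measurable_lift _)).aestronglyMeasurable)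
    (by simp only [zero_smul, add_zero]; exact hw.integrableOn_pot hd he X)
    (((measurable_smear hv.gaussKer_gkerOne.continuous.measurable
      hw.measurable_lift _).const_mul _).aestronglyMeasurable) ?_ hG ?_
  · simpa [pot, potOne] using key.2
  · refine (ae_restrict_iff' measurableSet_Ioi).2 (.of_forall fun l hl s _ => ?_)
    have hl0 : 0 < l := hl
    refine le_trans ?_ (hle l hl)
    beta_reduce
    rw [norm_mul, Real.norm_of_nonneg (by norm_num : (0 : ℝ) ≤ 1 / 2), mul_assoc]
    refine mul_le_mul_of_nonneg_left ?_ (by norm_num)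
    refine (hKb he le_rfl zero_le_one hC hv.gaussKer_gkerOne hw.lift_le_fine hl0 _).trans ?_
    exact mul_le_mul_of_nonneg_left (coarse_le_origin he (norm_nonneg _) (norm_nonneg _) hl0)
      (by positivity)
  · refine (ae_restrict_iff' measurableSet_Ioi).2 (.of_forall fun l hl s _ => ?_)
    have hl0 : 0 < l := hl
    refine (((hder l hl0).hasDerivAt X s).const_mul (l / 2)).congr_deriv ?_
    field_simp

theorem Source.continuous_potOne (hd : 3 ≤ d) (hw : Source t s β C w) (he : Exponents θ t s β)
    {v : Space d} (hv : SubUnit v) : Continuous (potOne w v) := by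
  obtain ⟨K, hK, hKb⟩ := exists_abs_smear_le_coarse hd
  have hC := hw.nonneg_const
  obtain ⟨G, hG, hle, -⟩ := (intBound_gradient he le_rfl le_rfl).const_mul
    (c := 1 / 2 * (K * (4 * C))) (by positivity)
  have hf := hw.gaussInt_lift hd he
  unfold potOne
  refine continuous_of_dominated (fun X => ((measurable_smear
    hv.gaussKer_gkerOne.continuous.measurable hw.measurable_lift _).const_mul _).aestronglyMeasurable)
    (bound := G) (fun X => ?_) hG ?_
  · refine (ae_restrict_iff' measurableSet_Ioi).2 (.of_forall fun l hl => ?_)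
    have hl0 : 0 < l := hl
    refine le_trans ?_ (hle l hl)
    beta_reduce
    rw [norm_mul, Real.norm_of_nonneg (by norm_num : (0 : ℝ) ≤ 1 / 2), mul_assoc]
    refine mul_le_mul_of_nonneg_left ?_ (by norm_num)
    refine (hKb he le_rfl zero_le_one hC hv.gaussKer_gkerOne hw.lift_le_fine hl0 _).trans ?_
    exact mul_le_mul_of_nonneg_left (coarse_le_origin he (norm_nonneg _) (norm_nonneg _) hl0)
      (by positivity)
  · refine (ae_restrict_iff' measurableSet_Ioi).2 (.of_forall fun l hl => ?_)
    exact (continuous_smear hv.gaussKer_gkerOne hf hl).const_mul _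

/-- Moving the second derivative of the kernel to the source. -/
theorem Source.smear_gkerTwo (hd : 3 ≤ d) (hw : Source t s β C w) (he : Exponents θ t s β)
    {v u : Space d} (hv : SubUnit v) (hu : SubUnit u) {l : ℝ} (hl : 0 < l) (X : Space d) :
    smear (gkerTwo v u) (lift w) l X = l * smear (gkerOne v) (dirLift w u) l X := by
  have h := hw.smear_deriv hd he hu hv.gaussKer_gkerOne (hv.gaussKer_gkerTwo hu).neg
    (dirDeriv_gkerOne v u) (differentiable_gkerOne v) hl X
  rw [smear_neg] at h
  linarith

theorem Source.smear_gkerOne (hd : 3 ≤ d) (hw : Source t s β C w) (he : Exponents θ t s β)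
    {v : Space d} (hv : SubUnit v) {l : ℝ} (hl : 0 < l) (X : Space d) :
    smear (gkerOne v) (lift w) l X = l * smear gker (dirLift w v) l X := by
  have h := hw.smear_deriv hd he hv gaussKer_gker hv.gaussKer_gkerOne.neg
    (dirDeriv_gker v) differentiable_gker hl X
  rw [smear_neg] at h
  linarith

/-- With both derivatives on the kernel the weight `1/(2l)` is too singular at zero. For `l ≤ 1` one
derivative is moved to the source, whose smeared gradient is locally bounded off the axes; for `l >
1` both stay on the kernel. -/
theorem Source.exists_bound_gkerTwo (hd : 3 ≤ d) (hw : Source t s β C w) (he : Exponents θ t s β)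
    {v u : Space d} (hv : SubUnit v) (hu : SubUnit u) {X₀ : Space d} (hX : X₀ ∈ offAxes d) :
    ∃ G : ℝ → ℝ, IntegrableOn G (Ioi 0) ∧ ∀ᶠ X in 𝓝 X₀, ∀ l : ℝ, 0 < l →
      |1 / (2 * l) * smear (gkerTwo v u) (lift w) l X| ≤ G l := by
  obtain ⟨K, hK, hKb⟩ := exists_abs_smear_le_coarse hd
  obtain ⟨K', hK', hKb'⟩ := exists_abs_smear_dirLift_le hd
  have hC := hw.nonneg_const
  have hr : 0 < ‖X₀.1‖ := norm_pos_iff.2 hX.1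
  have hz : 0 < ‖X₀.2‖ := norm_pos_iff.2 hX.2
  obtain ⟨M, hM⟩ : ∃ M : Space d → ℝ, M = fun X =>
    (‖X.1‖ ^ (-t) + ‖X.1‖ ^ (-s)) * (1 + ‖X.1‖⁻¹ + ‖X.2‖⁻¹) := ⟨_, rfl⟩
  have hMc : ContinuousAt M X₀ := by
    rw [hM]
    have c1 : ContinuousAt (fun X : Space d => ‖X.1‖) X₀ := by fun_prop
    have c2 : ContinuousAt (fun X : Space d => ‖X.2‖) X₀ := by fun_prop
    exact ((c1.rpow_const (.inl hr.ne')).add (c1.rpow_const (.inl hr.ne'))).mul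
      ((continuousAt_const.add (c1.inv₀ hr.ne')).add (c2.inv₀ hz.ne'))
  obtain ⟨h0, h1, h2, h3, h4, h5, h6, h7⟩ := id he
  obtain ⟨G, hG, hle, -⟩ := intBound_two_powers (A := 1 / 2 * (K' * (4 * (C * C)) * (M X₀ + 1)))
    (B := K * (16 * C)) (a := 0) (b := t + β - 1) (ρ := 1) (by norm_num) (by linarith) one_pos
  refine ⟨G, hG, ?_⟩
  filter_upwards [hMc.eventually_lt_const (lt_add_one (M X₀)), isOpen_offAxes.mem_nhds hX]
    with X hX1 hX2 l hl
  refine le_trans ?_ (hle l hl)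
  beta_reduce
  rw [abs_mul, abs_of_pos (by positivity : 0 < 1 / (2 * l))]
  split_ifs with hl1
  · rw [hw.smear_gkerTwo hd he hv hu hl X, abs_mul, abs_of_pos hl, neg_zero, Real.rpow_zero, mul_one]
    have hb := hKb' he hw hu hv.gaussKer_gkerOne hl X hX2
    have hb2 : |smear (gkerOne v) (dirLift w u) l X| ≤ K' * (4 * (C * C)) * (M X₀ + 1) := by
      refine hb.trans (mul_le_mul_of_nonneg_left ?_ (by positivity))
      rw [hM] at hX1
      rw [hM]
      exact hX1.le
    calc _ = 1 / 2 * |smear (gkerOne v) (dirLift w u) l X| := by field_simp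
      _ ≤ _ := by gcongr
  · have hl1' : 1 ≤ l := (not_le.1 hl1).le
    have hb := (hKb he le_rfl zero_le_one hC (hv.gaussKer_gkerTwo hu) hw.lift_le_fine hl X).trans
      (mul_le_mul_of_nonneg_left (coarse_le_far he le_rfl (norm_nonneg _) (norm_nonneg _) hl1')
        (by positivity))
    have e : l ^ (-1 - (t + β - 1)) = l ^ (-(0 + t + β)) := by congr 1; ring
    rw [e]
    have hP : 0 ≤ l ^ (-(0 + t + β)) := by positivity
    calc _ ≤ 1 / (2 * l) * (K * (16 * C) * (2 * l ^ (-(0 + t + β)))) := by gcongr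
      _ ≤ 1 / (2 * 1) * (K * (16 * C) * (2 * l ^ (-(0 + t + β)))) := by gcongr
      _ = _ := by ring

theorem measurable_potTwo_integrand (hw : Source t s β C w) {v u : Space d} (hv : SubUnit v)
    (hu : SubUnit u) (X : Space d) : StronglyMeasurable fun l : ℝ =>
      1 / (2 * l) * smear (gkerTwo v u) (lift w) l X :=
  (Measurable.stronglyMeasurable (by fun_prop)).mul (measurable_smear
    (hv.gaussKer_gkerTwo hu).continuous.measurable hw.measurable_lift X)

theorem Source.integrableOn_potTwo (hd : 3 ≤ d) (hw : Source t s β C w) (he : Exponents θ t s β)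
    {v u : Space d} (hv : SubUnit v) (hu : SubUnit u) {X : Space d} (hX : X ∈ offAxes d) :
    IntegrableOn (fun l => 1 / (2 * l) * smear (gkerTwo v u) (lift w) l X) (Ioi 0) := by
  obtain ⟨G, hG, hle⟩ := hw.exists_bound_gkerTwo hd he hv hu hX
  exact hG.mono' (measurable_potTwo_integrand hw hv hu X).aestronglyMeasurable
    ((ae_restrict_iff' measurableSet_Ioi).2 (.of_forall fun l hl => hle.self_of_nhds l hl))

theorem Source.hasDerivAt_potOne (hd : 3 ≤ d) (hw : Source t s β C w) (he : Exponents θ t s β)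
    {v u : Space d} (hv : SubUnit v) (hu : SubUnit u) {X : Space d} (hX : X ∈ offAxes d) :
    HasDerivAt (fun s : ℝ => potOne w v (X + s • u)) (potTwo w v u X) 0 := by
  obtain ⟨K, hK, hKb⟩ := exists_abs_smear_le_coarse hd
  have hC := hw.nonneg_const
  obtain ⟨G, hG, hle⟩ := hw.exists_bound_gkerTwo hd he hv hu hX
  have hf := hw.gaussInt_lift hd he
  have hder : ∀ l : ℝ, 0 < l → DirDeriv u (smear (gkerOne v) (lift w) l)
      (fun X => 1 / l * smear (gkerTwo v u) (lift w) l X) := by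
    intro l hl Y
    refine (hasDerivAt_smear hv.gaussKer_gkerOne (hv.gaussKer_gkerTwo hu).neg (dirDeriv_gkerOne v u)
      hf hl Y).congr_deriv ?_
    rw [smear_neg]; ring
  have hline : Tendsto (fun s : ℝ => X + s • u) (𝓝 0) (𝓝 X) := by
    have : ContinuousAt (fun s : ℝ => X + s • u) 0 := by fun_prop
    simpa [ContinuousAt] using this
  have key := hasDerivAt_integral_of_dominated_loc_of_deriv_le (μ := volume.restrict (Ioi (0 : ℝ)))
    -- The majorant holds only near `X`; the parameters for which it holds form a neighbourhood of
    -- zero.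
    (s := {s : ℝ | ∀ l : ℝ, 0 < l →
      |1 / (2 * l) * smear (gkerTwo v u) (lift w) l (X + s • u)| ≤ G l}) (x₀ := (0 : ℝ)) (bound := G)
    (F := fun (s : ℝ) l => 1 / 2 * smear (gkerOne v) (lift w) l (X + s • u))
    (F' := fun (s : ℝ) l => 1 / (2 * l) * smear (gkerTwo v u) (lift w) l (X + s • u))
    (hline.eventually hle)
    (.of_forall fun s => ((measurable_smear hv.gaussKer_gkerOne.continuous.measurable
      hw.measurable_lift _).const_mul _).aestronglyMeasurable) ?_
    (measurable_potTwo_integrand hw hv hu _).aestronglyMeasurable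
    ((ae_restrict_iff' measurableSet_Ioi).2 (.of_forall fun l hl s hs => hs l hl)) hG
    ((ae_restrict_iff' measurableSet_Ioi).2 (.of_forall fun l hl s _ => ?_))
  · simpa [potOne, potTwo] using key.2
  · simp only [zero_smul, add_zero]
    refine ((intBound_gradient he (norm_nonneg X.1) (norm_nonneg X.2)).const_mul
      (c := 1 / 2 * (K * (4 * C))) (by positivity)).integrableOn ((measurable_smear
      hv.gaussKer_gkerOne.continuous.measurable hw.measurable_lift _).const_mul _).aestronglyMeasurable
      fun l hl => ?_
    rw [abs_mul, abs_of_pos (by norm_num : (0 : ℝ) < 1 / 2), mul_assoc]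
    exact mul_le_mul_of_nonneg_left (hKb he le_rfl zero_le_one hC hv.gaussKer_gkerOne
      hw.lift_le_fine hl _) (by norm_num)
  · have hl0 : 0 < l := hl
    refine (((hder l hl0).hasDerivAt X s).const_mul (1 / 2)).congr_deriv ?_
    field_simp

theorem Source.continuousAt_potTwo (hd : 3 ≤ d) (hw : Source t s β C w) (he : Exponents θ t s β)
    {v u : Space d} (hv : SubUnit v) (hu : SubUnit u) {X : Space d} (hX : X ∈ offAxes d) :
    ContinuousAt (potTwo w v u) X := by
  obtain ⟨G, hG, hle⟩ := hw.exists_bound_gkerTwo hd he hv hu hX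
  unfold potTwo
  refine continuousAt_of_dominated (bound := G) (.of_forall fun Y =>
    (measurable_potTwo_integrand hw hv hu Y).aestronglyMeasurable) ?_ hG ?_
  · filter_upwards [hle] with Y hY
    exact (ae_restrict_iff' measurableSet_Ioi).2 (.of_forall fun l hl => hY l hl)
  · refine (ae_restrict_iff' measurableSet_Ioi).2 (.of_forall fun l hl => ?_)
    exact ((continuous_smear (hv.gaussKer_gkerTwo hu) (hw.gaussInt_lift hd he) hl).const_mul
      _).continuousAt

theorem Source.abs_lift_avg_le (hd : 3 ≤ d) (hw : Source t s β C w) (he : Exponents θ t s β)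
    {X : Space d} (hX : X ∈ offAxes d) :
    ∃ K : ℝ, ∀ l : ℝ, 0 < l → avg (fun Y => |lift w Y|) l X ≤ K := by
  obtain ⟨K, hK, hav⟩ := exists_avg_powProd_le hd
  obtain ⟨h0, h1, h2, h3, h4, h5, h6, h7⟩ := id he
  obtain ⟨g1, a1⟩ := hav t 0 0 (by linarith) (by linarith) le_rfl le_rfl (by norm_num)
  obtain ⟨g2, a2⟩ := hav s 0 0 (by linarith) (by linarith) le_rfl le_rfl (by norm_num)
  have hC := hw.nonneg_const
  have hr : 0 < ‖X.1‖ := norm_pos_iff.2 hX.1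
  have hG := (g1.add g2).const_mul C
  refine ⟨C * (K * ‖X.1‖ ^ (-t) + K * ‖X.1‖ ^ (-s)), fun l hl => ?_⟩
  have hle : avg (fun Y => |lift w Y|) l X ≤
      avg (fun Y => C * (powProd t 0 0 Y + powProd s 0 0 Y)) l X := by
    refine integral_mono ((hw.gaussInt_lift hd he).abs.integrable l hl X) (hG.integrable l hl X)
      fun Z => mul_le_mul_of_nonneg_left ?_ (Real.exp_pos _).le
    beta_reduce
    rw [abs_of_nonneg (hw.lift_nonneg _)]
    by_cases hY : X + l • Z ∈ offAxes d
    · rw [lift, indicator_of_mem hY]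
      simpa [powProd, radii] using hw.upper_crude (by linarith) (radii_mem hY)
    · rw [lift, indicator_of_notMem hY]
      exact mul_nonneg hC (add_nonneg (powProd_nonneg le_rfl _) (powProd_nonneg le_rfl _))
  refine hle.trans ?_
  rw [avg_const_mul, avg_add g1 g2 hl]
  have b1 := a1 l X hl
  have b2 := a2 l X hl
  rw [neg_zero, Real.rpow_zero, mul_one] at b1 b2
  have e1 : (‖X.1‖ + l) ^ (-t) ≤ ‖X.1‖ ^ (-t) := rpow_neg_anti hr (by linarith) (by linarith)
  have e2 : (‖X.1‖ + l) ^ (-s) ≤ ‖X.1‖ ^ (-s) := rpow_neg_anti hr (by linarith) (by linarith)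
  gcongr
  · exact b1.trans (by gcongr)
  · exact b2.trans (by gcongr)

/-- The Laplacian of the potential is minus the source. -/
theorem Source.sum_potTwo (hd : 3 ≤ d) (hw : Source t s β C w) (he : Exponents θ t s β)
    {X : Space d} (hX : X ∈ offAxes d) :
    ∑ i, potTwo w (basisVec i) (basisVec i) X =
      -(w (radii X) * Real.pi ^ (((d : ℝ) + 4) / 2)) := by
  have hf := hw.gaussInt_lift hd he
  have hint : ∀ i, IntegrableOn (fun l => 1 / (2 * l) *
      smear (gkerTwo (basisVec i) (basisVec i)) (lift w) l X) (Ioi 0) := fun i =>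
    hw.integrableOn_potTwo hd he (subUnit_basisVec i) (subUnit_basisVec i) hX
  have e1 : ∑ i, potTwo w (basisVec i) (basisVec i) X =
      ∫ l in Ioi 0, ∑ i, 1 / (2 * l) * smear (gkerTwo (basisVec i) (basisVec i)) (lift w) l X := by
    rw [integral_finsetSum _ fun i _ => hint i]
    rfl
  have e2 : EqOn (fun l => ∑ i, 1 / (2 * l) *
      smear (gkerTwo (basisVec i) (basisVec i)) (lift w) l X)
      (fun l => 1 / (2 * l) * smear gkerLap (lift w) l X) (Ioi 0) := fun l hl => by
    simp only
    rw [← Finset.mul_sum, smear_sum_gkerTwo hf hl]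
  have i2 : IntegrableOn (fun l => 1 / (2 * l) * smear gkerLap (lift w) l X) (Ioi 0) :=
    IntegrableOn.congr_fun (integrable_finsetSum _ fun i _ => hint i) e2 measurableSet_Ioi
  -- At `l = 0` the average degenerates to a constant integrand, and its value is also the limit as
  -- `l` tends to zero.
  have hzero : smear gker (lift w) 0 X = lift w X * ∫ Z : Space d, gker Z := by
    simp only [smear, zero_smul, add_zero]
    rw [integral_mul_const, mul_comm]
  obtain ⟨K, hK⟩ := hw.abs_lift_avg_le hd he hX
  have hK0 : 0 ≤ K := (integral_nonneg fun Z => by positivity).trans (hK 1 one_pos)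
  have hcont : ContinuousWithinAt (fun l => smear gker (lift w) l X) (Ici 0) 0 := by
    rw [← continuousWithinAt_Ioi_iff_Ici, ContinuousWithinAt, hzero]
    refine tendsto_smear_zero hf (hw.continuousAt_lift hX) (K := K) fun l hl hl1 => ?_
    exact (hK l hl).trans (le_mul_of_one_le_right hK0 ((one_le_inv₀ hl).2 hl1.le))
  obtain ⟨K', hK', hKb⟩ := exists_abs_smear_le_coarse hd
  have hC := hw.nonneg_const
  have hinf : Tendsto (fun l => smear gker (lift w) l X) atTop (𝓝 0) := by
    have h1 : Tendsto (fun l : ℝ => K' * (1 * C) * (2 * l ^ (-(0 + t + β)))) atTop (𝓝 0) := by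
      have := ((tendsto_rpow_neg_atTop (y := 0 + t + β) (by linarith [he.sum_gt])).const_mul
        2).const_mul (K' * (1 * C))
      simpa using this
    refine squeeze_zero_norm' ?_ h1
    filter_upwards [eventually_ge_atTop 1] with l hl
    exact (hKb he le_rfl zero_le_one hC gaussKer_gker hw.lift_le_fine (by linarith) X).trans
      (mul_le_mul_of_nonneg_left (coarse_le_far he le_rfl (norm_nonneg _) (norm_nonneg _) hl)
        (by positivity))
  -- By the heat equation the integrand is the derivative in `l` of the Gaussian average, which runs
  -- from the source times the Gaussian mass at `l = 0` to zero at infinity.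
  have hftc := integral_Ioi_of_hasDerivAt_of_tendsto hcont
    (fun l hl => hasDerivAt_smear_scale hf hl X) i2 hinf
  rw [e1, setIntegral_congr_fun measurableSet_Ioi e2, hftc, hzero, integral_gker, lift,
    indicator_of_mem hX, zero_sub]

end

end

section

variable {d : ℕ}

/-! ### Bounds for the potential and its derivatives -/

theorem exists_pot_le (hd : 3 ≤ d) {θ : ℝ} (hθ : 0 < θ) : ∃ K : ℝ, 0 < K ∧ ∀ {t s β C : ℝ}
    {w : ℝ × ℝ → ℝ}, Exponents θ t s β → Source t s β C w → ∀ X : Space d,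
      pot w X ≤ K * C / (t + β - 2) * (1 + ‖X.1‖ + ‖X.2‖) ^ (2 - t - β) := by
  obtain ⟨K, hK, hKb⟩ := exists_abs_smear_le_coarse hd
  refine ⟨K / 2 * (8 / θ + 2), by positivity, fun {t s β C w} he hw X => ?_⟩
  have hC := hw.nonneg_const
  have := ((intBound_potential he (norm_nonneg X.1) (norm_nonneg X.2)).const_mul
    (c := K * C / 2) (by positivity)).integral_le (hw.integrableOn_pot hd he X) fun l hl => by
      have := (le_abs_self _).trans (hKb he le_rfl zero_le_one hC gaussKer_gker hw.lift_le_fine hl X)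
      have h2 := mul_le_mul_of_nonneg_left this (by positivity : 0 ≤ l / 2)
      linarith
  refine this.trans (le_of_eq ?_)
  ring

/-- The derivative stays on the Gaussian, so any direction is allowed. In contrast to the potential,
there is no factor `1/(t+β-2)`. -/
theorem exists_abs_potOne_le (hd : 3 ≤ d) {θ : ℝ} (hθ : 0 < θ) : ∃ K : ℝ, 0 < K ∧ ∀ {t s β C : ℝ}
    {w : ℝ × ℝ → ℝ}, Exponents θ t s β → Source t s β C w → ∀ {v : Space d}, SubUnit v →
    ∀ X : Space d, |potOne w v X| ≤
      K * C * ((1 + ‖X.1‖ + ‖X.2‖) ^ (-t) * (1 + ‖X.2‖) ^ (1 - β)) := by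
  obtain ⟨K, hK, hKb⟩ := exists_abs_smear_le_coarse hd
  refine ⟨2 * K * (8 / θ + 8), by positivity, fun {t s β C w} he hw {v} hv X => ?_⟩
  have hC := hw.nonneg_const
  have := ((intBound_gradient he (norm_nonneg X.1) (norm_nonneg X.2)).const_mul
    (c := 2 * K * C) (by positivity)).abs_integral_le
    (f := fun l => 1 / 2 * smear (gkerOne v) (lift w) l X) fun l hl => by
      have := hKb he le_rfl zero_le_one hC hv.gaussKer_gkerOne hw.lift_le_fine hl X
      rw [abs_mul, abs_of_pos (by norm_num : (0 : ℝ) < 1 / 2)]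
      linarith
  refine this.trans (le_of_eq ?_)
  ring

/-- Moving a radial derivative to the source gains a full power of `1+r+z` over the size of the
potential, also where `r` is much larger than `z` and the general gradient bound is weaker. -/
theorem exists_abs_potOne_radial_le (hd : 3 ≤ d) {θ : ℝ} (hθ : 0 < θ) : ∃ K : ℝ, 0 < K ∧
    ∀ {t s β C : ℝ} {w : ℝ × ℝ → ℝ}, Exponents θ t s β → Source t s β C w → ∀ {v : Space d},
    SubUnit v → v.2 = 0 → ∀ X : Space d, |potOne w v X| ≤
      K * (C * C) * (1 + ‖X.1‖ + ‖X.2‖) ^ (1 - t - β) := by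
  obtain ⟨K, hK, hKb⟩ := exists_abs_smear_le_coarse hd
  refine ⟨K / 2 * (8 / θ + 8), by positivity, fun {t s β C w} he hw {v} hv hv2 X => ?_⟩
  have hC := hw.nonneg_const
  have := ((intBound_radial he (norm_nonneg X.1) (norm_nonneg X.2)).const_mul
    (c := K / 2 * (C * C)) (by positivity)).abs_integral_le
    (f := fun l => 1 / 2 * smear (gkerOne v) (lift w) l X) fun l hl => by
      have := hKb he zero_le_one le_rfl (mul_nonneg hC hC) gaussKer_gker
        (hw.dirLift_le_fine hv hv2) hl X
      rw [abs_mul, abs_of_pos (by norm_num : (0 : ℝ) < 1 / 2), hw.smear_gkerOne hd he hv hl X,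
        abs_mul, abs_of_pos hl]
      have h2 := mul_le_mul_of_nonneg_left this (by positivity : 0 ≤ l / 2)
      linarith
  refine this.trans (le_of_eq ?_)
  ring

theorem Source.abs_potTwo_integrand (hd : 3 ≤ d) {θ t s β C : ℝ} {w : ℝ × ℝ → ℝ}
    (hw : Source t s β C w) (he : Exponents θ t s β) {v u : Space d} (hv : SubUnit v)
    (hu : SubUnit u) {l : ℝ} (hl : 0 < l) (X : Space d) :
    |1 / (2 * l) * smear (gkerTwo v u) (lift w) l X| =
      1 / 2 * |smear (gkerOne v) (dirLift w u) l X| := by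
  rw [hw.smear_gkerTwo hd he hv hu hl X, abs_mul, abs_mul, abs_of_pos hl,
    abs_of_pos (by positivity : 0 < 1 / (2 * l))]
  field_simp

/-- The derivative along `u`, which has no `η`-component, goes to the source and costs `1/|ξ|`; the
one along `v` stays on the Gaussian. Their powers of `l` cancel the weight `1/(2l)`. -/
theorem exists_abs_potTwo_le (hd : 3 ≤ d) {θ : ℝ} (hθ : 0 < θ) : ∃ K : ℝ, 0 < K ∧
    ∀ {t s β C : ℝ} {w : ℝ × ℝ → ℝ}, Exponents θ t s β → Source t s β C w → ∀ {v u : Space d},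
    SubUnit v → SubUnit u → u.2 = 0 → ∀ X ∈ offAxes d, |potTwo w v u X| ≤
      K * (C * C) * (‖X.1‖ ^ (-t) * (1 + ‖X.2‖) ^ (-β) + ‖X.1‖ ^ (-s)) := by
  obtain ⟨K, hK, hKb⟩ := exists_abs_smear_le_fine hd
  refine ⟨2 * K * (1 / θ + 1), by positivity, fun {t s β C w} he hw {v u} hv hu hu2 X hX => ?_⟩
  have hC := hw.nonneg_const
  have := ((intBound_hessian_fine he (norm_pos_iff.2 hX.1) (norm_nonneg X.2)).const_mul
    (c := 2 * K * (C * C)) (by positivity)).abs_integral_le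
    (f := fun l => 1 / (2 * l) * smear (gkerTwo v u) (lift w) l X) fun l hl => by
      have := hKb he zero_le_one le_rfl (mul_nonneg hC hC) hv.gaussKer_gkerOne
        (hw.measurable_dirLift u) (hw.dirLift_le_fine hu hu2) hl X 1 (.inl rfl)
      rw [hw.abs_potTwo_integrand hd he hv hu hl]
      linarith
  refine this.trans (le_of_eq ?_)
  ring

/-- Outside the unit ball the singular term `r^{-s}` disappears: either `r ≥ 1/2`, where it is
comparable with `r^{-t}`, or `z ≥ 3/4`, where the slab carrying the singularity is reached only
through the tail of the Gaussian. -/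
theorem exists_abs_potTwo_far_le (hd : 3 ≤ d) {θ : ℝ} (hθ : 0 < θ) : ∃ K : ℝ, 0 < K ∧
    ∀ {t s β C : ℝ} {w : ℝ × ℝ → ℝ}, Exponents θ t s β → Source t s β C w → ∀ {v u : Space d},
    SubUnit v → SubUnit u → u.2 = 0 → ∀ X ∈ offAxes d, 1 < ‖X.1‖ ^ 2 + ‖X.2‖ ^ 2 →
      |potTwo w v u X| ≤ K * (C * C) * (‖X.1‖ ^ (-t) * (1 + ‖X.2‖) ^ (-β)) := by
  obtain ⟨K, hK, hKb⟩ := exists_abs_smear_le_fine hd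
  obtain ⟨K', hK', hKb'⟩ := exists_abs_smear_le_coarse hd
  obtain ⟨J, hJ⟩ : ∃ J, J = 2 * (K + K') := ⟨_, rfl⟩
  have hJ0 : 0 < J := by rw [hJ]; positivity
  refine ⟨J * (8 * (1 / θ + 1)), by positivity, fun {t s β C w} he hw {v u} hv hu hu2 X hX hfar => ?_⟩
  have hC := hw.nonneg_const
  have hr := norm_pos_iff.2 hX.1
  have hz := norm_pos_iff.2 hX.2
  have hco : ∀ l, 0 < l → |1 / (2 * l) * smear (gkerTwo v u) (lift w) l X| ≤
      J * (C * C) * coarse t s β 1 ‖X.1‖ ‖X.2‖ l := fun l hl => by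
    have := hKb' he zero_le_one le_rfl (mul_nonneg hC hC) hv.gaussKer_gkerOne
      (hw.dirLift_le_fine hu hu2) hl X
    rw [hw.abs_potTwo_integrand hd he hv hu hl]
    have h3 := coarse_nonneg (t := t) (s := s) (β := β) (k := 1) hr.le hz.le hl.le
    have h4 : 0 ≤ K * (C * C) * coarse t s β 1 ‖X.1‖ ‖X.2‖ l := by positivity
    rw [hJ]
    linarith
  have hP : 0 ≤ ‖X.1‖ ^ (-t) * (1 + ‖X.2‖) ^ (-β) := by positivity
  rcases le_total (1 / 2) ‖X.1‖ with h | h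
  · have := ((intBound_hessian_coarse he h hz.le).const_mul
      (c := J * (C * C)) (by positivity)).abs_integral_le hco
    refine this.trans ?_
    calc _ = J * (3 * (1 / θ + 1)) * (C * C) * (‖X.1‖ ^ (-t) * (1 + ‖X.2‖) ^ (-β)) := by ring
      _ ≤ _ := by gcongr; norm_num
  · have hz2 : 3 / 4 ≤ ‖X.2‖ := by nlinarith
    have := ((intBound_hessian_axis he hr (by linarith) hz2).const_mul
      (c := J * (C * C)) (by positivity)).abs_integral_le
      (f := fun l => 1 / (2 * l) * smear (gkerTwo v u) (lift w) l X) fun l hl => by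
        rw [mul_min_of_nonneg _ _ (by positivity)]
        refine le_min (hco l hl) ?_
        have := hKb he zero_le_one le_rfl (mul_nonneg hC hC) hv.gaussKer_gkerOne
          (hw.measurable_dirLift u) (hw.dirLift_le_fine hu hu2) hl X _ (.inr ⟨hz2, rfl⟩)
        rw [hw.abs_potTwo_integrand hd he hv hu hl]
        have h4 : 0 ≤ K' * (C * C) * ((‖X.1‖ + l) ^ (-(1 + t)) * (1 + ‖X.2‖ + l) ^ (-β) +
          (‖X.1‖ + l) ^ (-(1 + s)) * (l / ‖X.2‖) ^ 2) := by positivity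
        rw [hJ]
        linarith
    refine this.trans (le_of_eq ?_)
    ring

theorem Source.smear_gker_nonneg {t s β C : ℝ} {w : ℝ × ℝ → ℝ} (hw : Source t s β C w) (l : ℝ)
    (X : Space d) : 0 ≤ smear gker (lift w) l X :=
  integral_nonneg fun _ => mul_nonneg (Real.exp_pos _).le (hw.lift_nonneg _)

/-- The excess over the value at the origin is bounded without the factor `1/(t+β-2)`. Scales up to
`ρ = 1+r+z` contribute a bounded amount; at larger scales the mean value theorem gains `ρ/l`, which
makes the tail uniformly integrable. This is what keeps the normalized potential below `a₁`. -/
theorem exists_pot_sub_le (hd : 3 ≤ d) {θ : ℝ} (hθ : 0 < θ) : ∃ K : ℝ, 0 < K ∧ ∀ {t s β C : ℝ}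
    {w : ℝ × ℝ → ℝ}, Exponents θ t s β → Source t s β C w → ∀ X : Space d,
      pot w X ≤ pot w (0 : Space d) + K * C := by
  obtain ⟨K, hK, hKb⟩ := exists_abs_smear_le_coarse hd
  refine ⟨K / 2 * (8 / θ + 8), by positivity, fun {t s β C w} he hw X => ?_⟩
  have hC := hw.nonneg_const
  obtain ⟨h0, h1, h2, h3, h4, h5, h6, h7⟩ := id he
  obtain ⟨ρ, hρ⟩ : ∃ ρ, ρ = 1 + ‖X.1‖ + ‖X.2‖ := ⟨_, rfl⟩
  have hρ1 : 1 ≤ ρ := by rw [hρ]; linarith [norm_nonneg X.1, norm_nonneg X.2]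
  have hρ0 : 0 < ρ := by linarith
  -- The segment from the origin to `X` is `s v` with `0 ≤ s ≤ ρ`, where `v` has components of
  -- length at most one, so the kernel bounds apply to the direction `v`.
  obtain ⟨v, hv⟩ : ∃ v : Space d, v = ρ⁻¹ • X := ⟨_, rfl⟩
  have hX : ρ • v = X := by rw [hv, smul_smul, mul_inv_cancel₀ hρ0.ne', one_smul]
  have hvs : SubUnit v := by
    rw [hv]
    constructor
    · rw [Prod.smul_fst, norm_smul, norm_inv, Real.norm_of_nonneg hρ0.le, inv_mul_le_iff₀ hρ0, hρ]
      linarith [norm_nonneg X.1, norm_nonneg X.2]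
    · rw [Prod.smul_snd, norm_smul, norm_inv, Real.norm_of_nonneg hρ0.le, inv_mul_le_iff₀ hρ0, hρ]
      linarith [norm_nonneg X.1, norm_nonneg X.2]
  have hf := hw.gaussInt_lift hd he
  have hder : ∀ l : ℝ, 0 < l → DirDeriv v (smear gker (lift w) l)
      (fun X => 1 / l * smear (gkerOne v) (lift w) l X) := by
    intro l hl Y
    refine (hasDerivAt_smear gaussKer_gker hvs.gaussKer_gkerOne.neg (dirDeriv_gker v) hf hl
      Y).congr_deriv ?_
    rw [smear_neg]; ring
  have hmv : ∀ l : ℝ, 1 ≤ l → smear gker (lift w) l X - smear gker (lift w) l (0 : Space d) ≤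
      8 * K * C * ρ * l ^ (-1 - (t + β)) := fun l hl => by
    have hl0 : 0 < l := by linarith
    have hb : ∀ Y : Space d, ‖1 / l * smear (gkerOne v) (lift w) l Y‖ ≤
        8 * K * C * l ^ (-1 - (t + β)) := fun Y => by
      have := (hKb he le_rfl zero_le_one hC hvs.gaussKer_gkerOne hw.lift_le_fine hl0 Y).trans
        (mul_le_mul_of_nonneg_left (coarse_le_far he le_rfl (norm_nonneg _) (norm_nonneg _) hl)
        (by positivity))
      rw [norm_mul, Real.norm_of_nonneg (by positivity), sub_eq_add_neg, Real.rpow_add hl0,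
        Real.rpow_neg_one, Real.norm_eq_abs]
      rw [zero_add] at this
      have e : -(t + β) = -(t + β) := rfl
      calc _ ≤ 1 / l * (K * (4 * C) * (2 * l ^ (-(t + β)))) := by gcongr
        _ = _ := by ring
    have := Convex.norm_image_sub_le_of_norm_hasDerivWithin_le
      (f := fun s : ℝ => smear gker (lift w) l (0 + s • v)) (s := univ) (x := 0) (y := ρ)
      (fun x _ => ((hder l hl0).hasDerivAt 0 x).hasDerivWithinAt) (fun x _ => hb _) convex_univ
      (mem_univ _) (mem_univ _)
    simp only [zero_add, hX, zero_smul, sub_zero] at this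
    rw [Real.norm_of_nonneg hρ0.le] at this
    calc _ ≤ _ := le_abs_self _
      _ ≤ _ := this
      _ = _ := by ring
  have hint := (hw.integrableOn_pot hd he X).sub (hw.integrableOn_pot hd he 0)
  have key := ((intBound_near_far he (norm_nonneg X.1) (norm_nonneg X.2) (B := 8 * ρ)
    (b := t + β - 1) (by linarith)).const_mul (c := K * C / 2) (by positivity)).integral_le hint
    fun l hl => by
      rw [← hρ]
      simp only [Pi.sub_apply]
      rw [← mul_sub]
      split_ifs with hlρ
      · have a1 := (le_abs_self _).trans
          (hKb he le_rfl zero_le_one hC gaussKer_gker hw.lift_le_fine hl X)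
        have a2 := hw.smear_gker_nonneg l (0 : Space d)
        calc _ ≤ l / 2 * (K * (1 * C) * coarse t s β 0 ‖X.1‖ ‖X.2‖ l) := by gcongr; linarith
          _ = _ := by ring
      · have hl1 : 1 ≤ l := by linarith [not_le.1 hlρ]
        have e : l ^ (-1 - (t + β - 1)) = l * l ^ (-1 - (t + β)) := by
          rw [← Real.rpow_one_add' hl.le (by linarith)]; congr 1; ring
        rw [e]
        calc _ ≤ l / 2 * (8 * K * C * ρ * l ^ (-1 - (t + β))) := by gcongr; exact hmv l hl1
          _ = _ := by ring
  have e1 : ∫ l in Ioi 0, ((fun l => l / 2 * smear gker (lift w) l X) -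
      (fun l => l / 2 * smear gker (lift w) l (0 : Space d))) l = pot w X - pot w (0 : Space d) :=
    integral_sub (hw.integrableOn_pot hd he X) (hw.integrableOn_pot hd he 0)
  rw [e1, ← hρ] at key
  have b1 : ρ ^ (2 - t - β) ≤ 1 := Real.rpow_le_one_of_one_le_of_nonpos hρ1 (by linarith)
  have b2 : ρ * (ρ ^ (-(t + β - 1)) / (t + β - 1)) ≤ 1 := by
    rw [← mul_div_assoc, ← Real.rpow_one_add' hρ0.le (by linarith), div_le_one (by linarith)]
    exact (Real.rpow_le_one_of_one_le_of_nonpos hρ1 (by linarith)).trans (by linarith)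
  have b3 : K * C / 2 * (8 / θ * ρ ^ (2 - t - β) + 8 * ρ * (ρ ^ (-(t + β - 1)) / (t + β - 1))) ≤
      K * C / 2 * (8 / θ * 1 + 8 * 1) := by
    rw [mul_assoc 8 ρ]
    gcongr
  linarith

/-- Only large scales are needed. For `l > 100ρ` a fixed portion of the Gaussian mass around `X`
lies in the sector where the source is bounded below, so the average is at least a multiple of
`l^{-(t+β)}`. Integration of `l^{1-t-β}` produces the same factor `1/(t+β-2)` as in the upper bound.
-/
theorem exists_le_pot (hd : 3 ≤ d) : ∃ K : ℝ, 0 < K ∧ ∀ {θ t s β C c : ℝ}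
    {w : ℝ × ℝ → ℝ}, Exponents θ t s β → Source t s β C w → 0 ≤ c →
    (∀ r z : ℝ, 2 < z → z < r → r < 2 * z → c * (r ^ (-t) * z ^ (-β)) ≤ w (r, z)) →
    ∀ X : Space d, K * c / (t + β - 2) * (1 + ‖X.1‖ + ‖X.2‖) ^ (2 - t - β) ≤ pot w X := by
  -- Radii `3/2` and `1` lie inside the sector `z < r < 2z`, with enough room for an error `1/10` in
  -- `Z` and a displacement of `X` by at most `l/100`.
  obtain ⟨Z₀, hZ₁, hZ₂⟩ : ∃ Z₀ : Space d, ‖Z₀.1‖ = 3 / 2 ∧ ‖Z₀.2‖ = 1 :=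
    ⟨(EuclideanSpace.single 0 (3 / 2), EuclideanSpace.single 0 1), by simp, by simp⟩
  obtain ⟨m, hm⟩ : ∃ m, m = ∫ Z in Metric.ball Z₀ (1 / 10), gker Z := ⟨_, rfl⟩
  have hm0 : 0 < m := by
    rw [hm, setIntegral_pos_iff_support_of_nonneg_ae
      (f := gker) (.of_forall fun Z => (Real.exp_pos _).le) integrable_gker.integrableOn]
    have : Function.support (gker (d := d)) = univ := by
      ext Z; simp [gker, (Real.exp_pos _).ne']
    rw [this, univ_inter]
    exact Metric.measure_ball_pos _ _ (by norm_num)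
  refine ⟨m / 1600, by positivity, fun {θ t s β C c w} he hw hc hlow X => ?_⟩
  obtain ⟨h0, h1, h2, h3, h4, h5, h6, h7⟩ := id he
  obtain ⟨ρ, hρ⟩ : ∃ ρ, ρ = 1 + ‖X.1‖ + ‖X.2‖ := ⟨_, rfl⟩
  have n1 := norm_nonneg X.1
  have n2 := norm_nonneg X.2
  have hρ1 : 1 ≤ ρ := by rw [hρ]; linarith
  have hf := hw.gaussInt_lift hd he
  have hsm : ∀ l, 100 * ρ < l → c / 8 * m * l ^ (-(t + β)) ≤ smear gker (lift w) l X := by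
    intro l hl
    have hl0 : 0 < l := by linarith
    have hpt : ∀ Z ∈ Metric.ball Z₀ (1 / 10), c / 8 * l ^ (-(t + β)) ≤ lift w (X + l • Z) := by
      intro Z hZ
      rw [Metric.mem_ball, dist_eq_norm, Prod.norm_def, max_lt_iff, Prod.fst_sub, Prod.snd_sub] at hZ
      have a1 := abs_le.1 ((abs_norm_sub_norm_le Z.1 Z₀.1).trans hZ.1.le)
      have a2 := abs_le.1 ((abs_norm_sub_norm_le Z.2 Z₀.2).trans hZ.2.le)
      rw [hZ₁] at a1
      rw [hZ₂] at a2
      have b1 := abs_le.1 (abs_norm_sub_norm_le (X.1 + l • Z.1) (l • Z.1))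
      have b2 := abs_le.1 (abs_norm_sub_norm_le (X.2 + l • Z.2) (l • Z.2))
      rw [add_sub_cancel_right, norm_smul, Real.norm_of_nonneg hl0.le] at b1 b2
      have c1 : l * ‖Z.1‖ ≤ l * (8 / 5) := by gcongr; linarith
      have c2 : l * (7 / 5) ≤ l * ‖Z.1‖ := by gcongr; linarith
      have c3 : l * ‖Z.2‖ ≤ l * (11 / 10) := by gcongr; linarith
      have c4 : l * (9 / 10) ≤ l * ‖Z.2‖ := by gcongr; linarith
      have hY : X + l • Z ∈ offAxes d := by
        constructor
        · exact norm_pos_iff.1 (by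
            change 0 < ‖X.1 + l • Z.1‖
            linarith)
        · exact norm_pos_iff.1 (by
            change 0 < ‖X.2 + l • Z.2‖
            linarith)
      rw [lift, indicator_of_mem hY]
      have d1 : ‖X.1 + l • Z.1‖ ≤ 2 * l := by linarith
      have d2 : ‖X.2 + l • Z.2‖ ≤ 2 * l := by linarith
      have d3 : 0 < ‖X.1 + l • Z.1‖ := by linarith
      have d4 : 0 < ‖X.2 + l • Z.2‖ := by linarith
      refine le_trans ?_ (hlow ‖X.1 + l • Z.1‖ ‖X.2 + l • Z.2‖ (by linarith) (by linarith)
        (by linarith))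
      have e1 : (2 * l) ^ (-t) * (2 * l) ^ (-β) ≤
          ‖X.1 + l • Z.1‖ ^ (-t) * ‖X.2 + l • Z.2‖ ^ (-β) :=
        mul_le_mul (rpow_neg_anti d3 d1 (by linarith)) (rpow_neg_anti d4 d2 (by linarith))
          (by positivity) (by positivity)
      -- The constant is `2^{-3}`, since `t + β ≤ 3`.
      have e2 : 1 / 8 * l ^ (-(t + β)) ≤ (2 * l) ^ (-t) * (2 * l) ^ (-β) := by
        rw [← Real.rpow_add (by positivity), ← neg_add, Real.mul_rpow (by norm_num) hl0.le]
        gcongr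
        have : (2 : ℝ) ^ (-3 : ℝ) ≤ 2 ^ (-(t + β)) :=
          Real.rpow_le_rpow_of_exponent_le (by norm_num) (by linarith)
        refine le_trans (le_of_eq ?_) this
        rw [Real.rpow_neg (by norm_num)]
        norm_num
      calc c / 8 * l ^ (-(t + β)) = c * (1 / 8 * l ^ (-(t + β))) := by ring
        _ ≤ _ := mul_le_mul_of_nonneg_left (e2.trans e1) hc
    have hI := gaussKer_gker.integrable hf hl0 X
    calc c / 8 * m * l ^ (-(t + β)) = ∫ Z in Metric.ball Z₀ (1 / 10),
          gker Z * (c / 8 * l ^ (-(t + β))) := by rw [integral_mul_const, hm]; ring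
      _ ≤ ∫ Z in Metric.ball Z₀ (1 / 10), gker Z * lift w (X + l • Z) :=
          setIntegral_mono_on (integrable_gker.integrableOn.mul_const _) hI.integrableOn
            Metric.isOpen_ball.measurableSet
            fun Z hZ => mul_le_mul_of_nonneg_left (hpt Z hZ) (Real.exp_pos _).le
      _ ≤ _ := setIntegral_le_integral hI (.of_forall fun Z =>
          mul_nonneg (Real.exp_pos _).le (hw.lift_nonneg _))
  have hpos : 0 < 100 * ρ := by linarith
  have hI := hw.integrableOn_pot hd he X
  have hlt : 1 - (t + β) < -1 := by linarith
  have hle : ∫ l in Ioi (100 * ρ), c * m / 16 * l ^ (1 - (t + β)) ≤ pot w X := by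
    calc _ ≤ ∫ l in Ioi (100 * ρ), l / 2 * smear gker (lift w) l X := by
          refine setIntegral_mono_on ((integrableOn_Ioi_rpow_of_lt hlt hpos).const_mul _)
            (hI.mono_set (Ioi_subset_Ioi hpos.le)) measurableSet_Ioi fun l hl => ?_
          have hl0 : 0 < l := hpos.trans hl
          have e : l ^ (1 - (t + β)) = l * l ^ (-(t + β)) := by
            rw [sub_eq_add_neg, Real.rpow_add hl0, Real.rpow_one]
          rw [e]
          have := mul_le_mul_of_nonneg_left (hsm l hl) (by positivity : 0 ≤ l / 2)
          linarith
      _ ≤ _ := setIntegral_mono_set hI ((ae_restrict_iff' measurableSet_Ioi).2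
          (.of_forall fun l (hl : 0 < l) => mul_nonneg (by positivity) (hw.smear_gker_nonneg l X)))
          (Ioi_subset_Ioi hpos.le).eventuallyLE
  rw [integral_const_mul, integral_Ioi_rpow_of_lt hlt hpos] at hle
  refine le_trans ?_ hle
  rw [← hρ]
  have e3 : (100 * ρ) ^ (1 - (t + β) + 1) = 100 ^ (2 - t - β) * ρ ^ (2 - t - β) := by
    rw [← Real.mul_rpow (by norm_num) (by linarith)]; congr 1; ring
  have e4 : -(100 * ρ) ^ (1 - (t + β) + 1) / (1 - (t + β) + 1) =
      100 ^ (2 - t - β) * ρ ^ (2 - t - β) / (t + β - 2) := by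
    rw [e3, ← neg_div_neg_eq, neg_neg]; congr 1; ring
  rw [e4]
  have e5 : 1 / 100 ≤ (100 : ℝ) ^ (2 - t - β) := by
    have : (100 : ℝ) ^ (-1 : ℝ) ≤ 100 ^ (2 - t - β) :=
      Real.rpow_le_rpow_of_exponent_le (by norm_num) (by linarith)
    rw [Real.rpow_neg_one] at this
    linarith
  have e6 : 0 < t + β - 2 := by linarith
  have e7 : 0 ≤ c * m / 16 * (ρ ^ (2 - t - β) / (t + β - 2)) := by positivity
  calc _ = c * m / 16 * (ρ ^ (2 - t - β) / (t + β - 2)) * (1 / 100) := by ring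
    _ ≤ c * m / 16 * (ρ ^ (2 - t - β) / (t + β - 2)) * 100 ^ (2 - t - β) := by gcongr
    _ = _ := by ring

end

section

/-! ### Functions of two variables with continuous partial derivatives -/

theorem hasFDerivAt_of_partials {f g₁ g₂ : ℝ × ℝ → ℝ} {U : Set (ℝ × ℝ)} (hU : IsOpen U)
    (h₁ : ∀ p ∈ U, HasDerivAt (fun s => f (s, p.2)) (g₁ p) p.1)
    (h₂ : ∀ p ∈ U, HasDerivAt (fun s => f (p.1, s)) (g₂ p) p.2) (c₁ : ContinuousOn g₁ U)
    (c₂ : ContinuousOn g₂ U) {p : ℝ × ℝ} (hp : p ∈ U) :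
    HasFDerivAt f (g₁ p • ContinuousLinearMap.fst ℝ ℝ ℝ + g₂ p • ContinuousLinearMap.snd ℝ ℝ ℝ) p := by
  have hn := hU.mem_nhds hp
  have key := hasStrictFDerivAt_uncurry_coprod (𝕜 := ℝ) (u := p) (f := fun a b => f (a, b))
    (f₁ := fun a b => ContinuousLinearMap.toSpanSingleton ℝ (g₁ (a, b)))
    (f₂ := fun a b => ContinuousLinearMap.toSpanSingleton ℝ (g₂ (a, b)))
    (by filter_upwards [hn] with v hv using (h₁ v hv).hasFDerivAt)
    (by filter_upwards [hn] with v hv using (h₂ v hv).hasFDerivAt)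
    ((ContinuousLinearMap.toSpanSingletonCLE (𝕜 := ℝ) (E := ℝ)).continuous.continuousAt.comp
      (c₁.continuousAt hn))
    ((ContinuousLinearMap.toSpanSingletonCLE (𝕜 := ℝ) (E := ℝ)).continuous.continuousAt.comp
      (c₂.continuousAt hn))
  refine key.hasFDerivAt.congr_fderiv ?_
  ext <;> simp [Function.HasUncurry.uncurry]

/-- Only directional derivatives of the potential have been computed; this assembles them into
smoothness in `(r, z)`. -/
theorem contDiffOn_of_partials {n : ℕ} {f g₁ g₂ : ℝ × ℝ → ℝ} {U : Set (ℝ × ℝ)} (hU : IsOpen U)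
    (h₁ : ∀ p ∈ U, HasDerivAt (fun s => f (s, p.2)) (g₁ p) p.1)
    (h₂ : ∀ p ∈ U, HasDerivAt (fun s => f (p.1, s)) (g₂ p) p.2) (c₁ : ContDiffOn ℝ n g₁ U)
    (c₂ : ContDiffOn ℝ n g₂ U) : ContDiffOn ℝ (n + 1) f U := by
  have hd := fun p hp => hasFDerivAt_of_partials hU h₁ h₂ c₁.continuousOn c₂.continuousOn (p := p) hp
  rw [contDiffOn_succ_iff_fderiv_of_isOpen hU]
  refine ⟨fun p hp => (hd p hp).differentiableAt.differentiableWithinAt, by simp, ?_⟩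
  refine ContDiffOn.congr ?_ fun p hp => (hd p hp).fderiv
  exact (c₁.smul contDiffOn_const).add (c₂.smul contDiffOn_const)

variable {d : ℕ}

/-! ### Rotation invariance of the potential -/

/-- The point of `Space d` on two fixed axes with prescribed coordinates. -/
noncomputable def ray (p : ℝ × ℝ) : Space d := (EuclideanSpace.single 0 p.1, EuclideanSpace.single 0 p.2)

/-- The potential as a function of the two radii. -/
noncomputable def radial (d : ℕ) (w : ℝ × ℝ → ℝ) (p : ℝ × ℝ) : ℝ := pot w (ray p : Space d)

theorem ray_add_inl (r z s : ℝ) : (ray (r + s, z) : Space d) = ray (r, z) + s • basisVec (.inl 0) := by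
  apply Prod.ext
  · ext i; by_cases h : i = 0 <;> simp [ray, basisVec, h]
  · simp [ray, basisVec]

theorem ray_add_inr (r z s : ℝ) : (ray (r, z + s) : Space d) = ray (r, z) + s • basisVec (.inr 0) := by
  apply Prod.ext
  · simp [ray, basisVec]
  · ext i; by_cases h : i = 0 <;> simp [ray, basisVec, h]

@[fun_prop]
theorem continuous_ray : Continuous (ray (d := d)) := by
  have e : (ray (d := d)) = fun p => p.1 • basisVec (.inl 0) + p.2 • basisVec (.inr 0) := by
    ext p : 1
    have h := ray_add_inl (d := d) 0 p.2 p.1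
    have h2 := ray_add_inr (d := d) 0 0 p.2
    rw [zero_add] at h h2
    have h3 : (ray (0, 0) : Space d) = 0 := by simp [ray]
    rw [h3, zero_add] at h2
    rw [← h2, ← add_comm]
    exact h
  rw [e]
  fun_prop

theorem norm_ray_fst (p : ℝ × ℝ) : ‖(ray p : Space d).1‖ = |p.1| := by simp [ray]

theorem norm_ray_snd (p : ℝ × ℝ) : ‖(ray p : Space d).2‖ = |p.2| := by simp [ray]

theorem radii_ray {p : ℝ × ℝ} (hp : p ∈ closedQuadrant) : radii (ray p : Space d) = p := by
  rw [radii, norm_ray_fst, norm_ray_snd, abs_of_nonneg hp.1, abs_of_nonneg hp.2]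

theorem quadrant_subset : quadrant ⊆ closedQuadrant := fun _ hp => ⟨hp.1.le, hp.2.le⟩

theorem ray_mem_offAxes {p : ℝ × ℝ} (hp : p ∈ quadrant) : (ray p : Space d) ∈ offAxes d :=
  ⟨norm_pos_iff.1 (by rw [norm_ray_fst]; exact abs_pos.2 hp.1.ne'),
    norm_pos_iff.1 (by rw [norm_ray_snd]; exact abs_pos.2 hp.2.ne')⟩

/-- The reflection in the hyperplane orthogonal to `x - y` exchanges vectors of equal length. -/
theorem exists_isometry_map {n : ℕ} {x y : EuclideanSpace ℝ (Fin n)} (h : ‖x‖ = ‖y‖) :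
    ∃ A : EuclideanSpace ℝ (Fin n) ≃ₗᵢ[ℝ] EuclideanSpace ℝ (Fin n), A x = y :=
  ⟨_, Submodule.reflection_sub h⟩

theorem lift_congr_norm (w : ℝ × ℝ → ℝ) {X Y : Space d} (h₁ : ‖X.1‖ = ‖Y.1‖) (h₂ : ‖X.2‖ = ‖Y.2‖) :
    lift w X = lift w Y := by
  have hiff : X ∈ offAxes d ↔ Y ∈ offAxes d := by
    change X.1 ≠ 0 ∧ X.2 ≠ 0 ↔ Y.1 ≠ 0 ∧ Y.2 ≠ 0
    rw [← norm_ne_zero_iff (a := X.1), ← norm_ne_zero_iff (a := X.2), h₁, h₂, norm_ne_zero_iff,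
      norm_ne_zero_iff]
  have hr : radii X = radii Y := by rw [radii, radii, h₁, h₂]
  by_cases hX : X ∈ offAxes d
  · rw [lift, indicator_of_mem hX, indicator_of_mem (hiff.1 hX), hr]
  · rw [lift, indicator_of_notMem hX, indicator_of_notMem (hiff.not.1 hX)]

theorem smear_gker_congr_norm (w : ℝ × ℝ → ℝ) (l : ℝ) {X Y : Space d} (h₁ : ‖X.1‖ = ‖Y.1‖)
    (h₂ : ‖X.2‖ = ‖Y.2‖) : smear gker (lift w) l X = smear gker (lift w) l Y := by
  obtain ⟨A, hA⟩ := exists_isometry_map h₁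
  obtain ⟨B, hB⟩ := exists_isometry_map h₂
  have hmp : MeasurePreserving (Prod.map A B) (volume : Measure (Space d)) volume :=
    A.measurePreserving.prod B.measurePreserving
  have hemb : MeasurableEmbedding (Prod.map A B : Space d → Space d) :=
    (A.toHomeomorph.prodCongr B.toHomeomorph).measurableEmbedding
  unfold smear
  rw [← hmp.integral_comp hemb fun Z => gker Z * lift w (Y + l • Z)]
  refine integral_congr_ae (.of_forall fun Z => ?_)
  have e1 : gker (Prod.map A B Z : Space d) = gker Z := by simp [gker, sqLen]
  have e2 : lift w (Y + l • (Prod.map A B Z : Space d)) = lift w (X + l • Z) := by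
    have hY : Y + l • (Prod.map A B Z : Space d) = (A (X.1 + l • Z.1), B (X.2 + l • Z.2)) := by
      rw [map_add, map_add, map_smul, map_smul, hA, hB]
      rfl
    rw [hY]
    exact lift_congr_norm w (A.norm_map _) (B.norm_map _)
  simp only [e1, e2]

theorem pot_congr_norm (w : ℝ × ℝ → ℝ) {X Y : Space d} (h₁ : ‖X.1‖ = ‖Y.1‖)
    (h₂ : ‖X.2‖ = ‖Y.2‖) : pot w X = pot w Y := by
  unfold pot
  simp only [smear_gker_congr_norm w _ h₁ h₂]

theorem pot_eq_radial (w : ℝ × ℝ → ℝ) (X : Space d) : pot w X = radial d w (‖X.1‖, ‖X.2‖) :=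
  pot_congr_norm w (by simp [norm_ray_fst]) (by simp [norm_ray_snd])

/-! ### Derivatives in the two radii -/

theorem DirDeriv.radial_fst {F F' : Space d → ℝ} (H : DirDeriv (basisVec (.inl 0)) F F')
    (p : ℝ × ℝ) : HasDerivAt (fun s => F (ray (s, p.2))) (F' (ray p)) p.1 := by
  have h := (H.hasDerivAt (ray (0, p.2)) p.1)
  rw [← ray_add_inl, zero_add] at h
  exact h.congr_of_eventuallyEq (.of_forall fun s => by
    change F _ = F _
    rw [← ray_add_inl, zero_add])

theorem DirDeriv.radial_snd {F F' : Space d → ℝ} (H : DirDeriv (basisVec (.inr 0)) F F')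
    (p : ℝ × ℝ) : HasDerivAt (fun s => F (ray (p.1, s))) (F' (ray p)) p.2 := by
  have h := (H.hasDerivAt (ray (p.1, 0)) p.2)
  rw [← ray_add_inr, zero_add] at h
  exact h.congr_of_eventuallyEq (.of_forall fun s => by
    change F _ = F _
    rw [← ray_add_inr, zero_add])

theorem hasDerivAt_ray_fst {F : Space d → ℝ} {F' : ℝ} {p : ℝ × ℝ}
    (H : HasDerivAt (fun s : ℝ => F (ray p + s • basisVec (.inl 0))) F' 0) :
    HasDerivAt (fun s => F (ray (s, p.2))) F' p.1 := by
  have h : HasDerivAt (fun s : ℝ => F (ray p + (s - p.1) • basisVec (.inl 0))) (F' * 1) p.1 := by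
    refine HasDerivAt.comp (h₂ := fun s : ℝ => F (ray p + s • basisVec (.inl 0)))
      (h := fun s => s - p.1) p.1 ?_ ((hasDerivAt_id p.1).sub_const _)
    rw [sub_self]; exact H
  rw [mul_one] at h
  refine h.congr_of_eventuallyEq (.of_forall fun s => ?_)
  change F _ = F _
  rw [← ray_add_inl p.1 p.2, add_sub_cancel]

theorem hasDerivAt_ray_snd {F : Space d → ℝ} {F' : ℝ} {p : ℝ × ℝ}
    (H : HasDerivAt (fun s : ℝ => F (ray p + s • basisVec (.inr 0))) F' 0) :
    HasDerivAt (fun s => F (ray (p.1, s))) F' p.2 := by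
  have h : HasDerivAt (fun s : ℝ => F (ray p + (s - p.2) • basisVec (.inr 0))) (F' * 1) p.2 := by
    refine HasDerivAt.comp (h₂ := fun s : ℝ => F (ray p + s • basisVec (.inr 0)))
      (h := fun s => s - p.2) p.2 ?_ ((hasDerivAt_id p.2).sub_const _)
    rw [sub_self]; exact H
  rw [mul_one] at h
  refine h.congr_of_eventuallyEq (.of_forall fun s => ?_)
  change F _ = F _
  rw [← ray_add_inr p.1 p.2, add_sub_cancel]

section

variable {θ t s β C : ℝ} {w : ℝ × ℝ → ℝ}

/-- The first partial derivatives of the radial potential. -/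
noncomputable def radialOne (w : ℝ × ℝ → ℝ) (i : Fin (d + 1) ⊕ Fin 3) (p : ℝ × ℝ) : ℝ :=
  potOne w (basisVec i) (ray p)

/-- The second partial derivatives of the radial potential. -/
noncomputable def radialTwo (w : ℝ × ℝ → ℝ) (i j : Fin (d + 1) ⊕ Fin 3) (p : ℝ × ℝ) : ℝ :=
  potTwo w (basisVec i) (basisVec j) (ray p)

theorem Source.hasDerivAt_radial_fst (hd : 3 ≤ d) (hw : Source t s β C w) (he : Exponents θ t s β)
    (p : ℝ × ℝ) : HasDerivAt (fun r => radial d w (r, p.2)) (radialOne (d := d) w (.inl 0) p) p.1 :=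
  (hw.dirDeriv_pot hd he (subUnit_basisVec _)).radial_fst p

theorem Source.hasDerivAt_radial_snd (hd : 3 ≤ d) (hw : Source t s β C w) (he : Exponents θ t s β)
    (p : ℝ × ℝ) : HasDerivAt (fun z => radial d w (p.1, z)) (radialOne (d := d) w (.inr 0) p) p.2 :=
  (hw.dirDeriv_pot hd he (subUnit_basisVec _)).radial_snd p

theorem Source.hasDerivAt_radialOne_fst (hd : 3 ≤ d) (hw : Source t s β C w)
    (he : Exponents θ t s β) (i : Fin (d + 1) ⊕ Fin 3) {p : ℝ × ℝ} (hp : p ∈ quadrant) :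
    HasDerivAt (fun r => radialOne w i (r, p.2)) (radialTwo w i (.inl 0) p) p.1 :=
  hasDerivAt_ray_fst (hw.hasDerivAt_potOne hd he (subUnit_basisVec _) (subUnit_basisVec _)
    (ray_mem_offAxes hp))

theorem Source.hasDerivAt_radialOne_snd (hd : 3 ≤ d) (hw : Source t s β C w)
    (he : Exponents θ t s β) (i : Fin (d + 1) ⊕ Fin 3) {p : ℝ × ℝ} (hp : p ∈ quadrant) :
    HasDerivAt (fun z => radialOne w i (p.1, z)) (radialTwo w i (.inr 0) p) p.2 :=
  hasDerivAt_ray_snd (hw.hasDerivAt_potOne hd he (subUnit_basisVec _) (subUnit_basisVec _)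
    (ray_mem_offAxes hp))

theorem Source.continuous_radialOne (hd : 3 ≤ d) (hw : Source t s β C w)
    (he : Exponents θ t s β) (i : Fin (d + 1) ⊕ Fin 3) : Continuous (radialOne w i) :=
  (hw.continuous_potOne hd he (subUnit_basisVec i)).comp continuous_ray

theorem Source.continuousOn_radialTwo (hd : 3 ≤ d) (hw : Source t s β C w)
    (he : Exponents θ t s β) (i j : Fin (d + 1) ⊕ Fin 3) : ContinuousOn (radialTwo w i j) quadrant :=
  fun _ hp => ((hw.continuousAt_potTwo hd he (subUnit_basisVec i) (subUnit_basisVec j)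
    (ray_mem_offAxes hp)).comp continuous_ray.continuousAt).continuousWithinAt

theorem Source.contDiff_radial (hd : 3 ≤ d) (hw : Source t s β C w) (he : Exponents θ t s β) :
    ContDiff ℝ 1 (radial d w) := by
  rw [← contDiffOn_univ]
  have := contDiffOn_of_partials (n := 0) isOpen_univ
    (fun p _ => hw.hasDerivAt_radial_fst hd he p) (fun p _ => hw.hasDerivAt_radial_snd hd he p)
    (contDiffOn_zero.2 (hw.continuous_radialOne hd he _).continuousOn)
    (contDiffOn_zero.2 (hw.continuous_radialOne hd he _).continuousOn)
  simpa using this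

theorem Source.contDiffOn_radial (hd : 3 ≤ d) (hw : Source t s β C w) (he : Exponents θ t s β) :
    ContDiffOn ℝ 2 (radial d w) quadrant := by
  have h1 : ∀ i, ContDiffOn ℝ ((1 : ℕ) : WithTop ℕ∞) (radialOne (d := d) w i) quadrant := fun i => by
    have := contDiffOn_of_partials (n := 0) isOpen_quadrant
      (fun p hp => hw.hasDerivAt_radialOne_fst hd he i hp)
      (fun p hp => hw.hasDerivAt_radialOne_snd hd he i hp)
      (contDiffOn_zero.2 (hw.continuousOn_radialTwo hd he _ _))
      (contDiffOn_zero.2 (hw.continuousOn_radialTwo hd he _ _))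
    simpa using this
  have := contDiffOn_of_partials (n := 1) isOpen_quadrant
    (fun p _ => hw.hasDerivAt_radial_fst hd he p) (fun p _ => hw.hasDerivAt_radial_snd hd he p)
    (h1 _) (h1 _)
  have e : ((1 : ℕ) : WithTop ℕ∞) + 1 = 2 := by norm_num
  rwa [e] at this

theorem Source.dr_radial (hd : 3 ≤ d) (hw : Source t s β C w) (he : Exponents θ t s β) :
    dr (radial d w) = radialOne (d := d) w (.inl 0) :=
  funext fun p => (hw.hasDerivAt_radial_fst hd he p).deriv

theorem Source.dz_radial (hd : 3 ≤ d) (hw : Source t s β C w) (he : Exponents θ t s β) :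
    dz (radial d w) = radialOne (d := d) w (.inr 0) :=
  funext fun p => (hw.hasDerivAt_radial_snd hd he p).deriv

theorem Source.dr_radialOne (hd : 3 ≤ d) (hw : Source t s β C w) (he : Exponents θ t s β)
    (i : Fin (d + 1) ⊕ Fin 3) {p : ℝ × ℝ} (hp : p ∈ quadrant) :
    dr (radialOne w i) p = radialTwo w i (.inl 0) p :=
  (hw.hasDerivAt_radialOne_fst hd he i hp).deriv

theorem Source.dz_radialOne (hd : 3 ≤ d) (hw : Source t s β C w) (he : Exponents θ t s β)
    (i : Fin (d + 1) ⊕ Fin 3) {p : ℝ × ℝ} (hp : p ∈ quadrant) :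
    dz (radialOne w i) p = radialTwo w i (.inr 0) p :=
  (hw.hasDerivAt_radialOne_snd hd he i hp).deriv

theorem norm_add_smul_of_inner_eq_zero {n : ℕ} {x v : EuclideanSpace ℝ (Fin n)}
    (h : inner ℝ x v = 0) (hv : ‖v‖ = 1) (s : ℝ) : ‖x + s • v‖ = √(‖x‖ ^ 2 + s ^ 2) := by
  rw [← Real.sqrt_sq (norm_nonneg (x + s • v)), norm_add_sq_real, inner_smul_right, h, norm_smul, hv]
  simp

theorem hasDerivAt_sqrt_add_sq {r : ℝ} (hr : 0 < r) (s : ℝ) :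
    HasDerivAt (fun s => √(r ^ 2 + s ^ 2)) (s / √(r ^ 2 + s ^ 2)) s := by
  have h := (((hasDerivAt_pow 2 s).const_add (r ^ 2)).sqrt (by positivity))
  refine h.congr_deriv ?_
  have : 0 < √(r ^ 2 + s ^ 2) := Real.sqrt_pos.2 (by positivity)
  field_simp
  norm_num

/-- If the first derivative is an odd multiple of a continuous function, the second derivative at
the origin is the value of that function. -/
theorem hasDerivAt_mul_self_zero {g : ℝ → ℝ} (hg : ContinuousAt g 0) :
    HasDerivAt (fun s => g s * s) (g 0) 0 := by
  rw [hasDerivAt_iff_tendsto_slope_zero]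
  refine (hg.tendsto.mono_left nhdsWithin_le_nhds).congr' ?_
  filter_upwards [self_mem_nhdsWithin] with s hs
  have : s ≠ 0 := hs
  simp
  field_simp

/-- Along a line orthogonal to `ξ` the radius is `√(r²+s²)`, so the first derivative is `s` times a
continuous function whose value at `s = 0` is `∂_r/r`. This produces the first-order term of the
equation, and conversely bounds `∂_r/r` by a second derivative of the potential. -/
theorem Source.radialTwo_transverse_fst (hd : 3 ≤ d) (hw : Source t s β C w)
    (he : Exponents θ t s β) {j : Fin (d + 1)} (hj : j ≠ 0) {p : ℝ × ℝ} (hp : p ∈ quadrant) :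
    radialTwo w (.inl j) (.inl j) p = radialOne (d := d) w (.inl 0) p / p.1 := by
  have hv := subUnit_basisVec (d := d) (.inl j)
  have h2 := hw.hasDerivAt_potOne hd he hv hv (ray_mem_offAxes hp)
  obtain ⟨X, hX⟩ : ∃ X : Space d, X = ray p := ⟨_, rfl⟩
  have hn : ∀ s : ℝ, ‖(X + s • (basisVec (.inl j) : Space d)).1‖ = √(p.1 ^ 2 + s ^ 2) := fun s => by
    have : (X + s • (basisVec (.inl j) : Space d)).1 =
      X.1 + s • EuclideanSpace.single j (1 : ℝ) := rfl
    rw [this, norm_add_smul_of_inner_eq_zero _ (by simp), hX, norm_ray_fst, sq_abs]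
    rw [hX]
    simp [ray, EuclideanSpace.inner_single_right, hj]
  have hn2 : ∀ s : ℝ, ‖(X + s • (basisVec (.inl j) : Space d)).2‖ = p.2 := fun s => by
    have : (X + s • (basisVec (.inl j) : Space d)).2 = X.2 := by simp [basisVec]
    rw [this, hX, norm_ray_snd, abs_of_pos hp.2]
  have e : ∀ s : ℝ, potOne w (basisVec (.inl j)) (X + s • (basisVec (.inl j) : Space d)) =
      radialOne (d := d) w (.inl 0) (√(p.1 ^ 2 + s ^ 2), p.2) / √(p.1 ^ 2 + s ^ 2) * s := fun s => by
    have h3 := (hw.dirDeriv_pot hd he hv).hasDerivAt X s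
    have h4 := (hw.hasDerivAt_radial_fst hd he (√(p.1 ^ 2 + s ^ 2), p.2)).comp s
      (hasDerivAt_sqrt_add_sq hp.1 s)
    have h5 := h3.congr_of_eventuallyEq (f₁ := (fun r => radial d w (r, p.2)) ∘
      fun s => √(p.1 ^ 2 + s ^ 2)) (.of_forall fun s => by
        simp only [Function.comp_apply]
        rw [pot_eq_radial, hn, hn2])
    rw [h5.unique h4]
    ring
  have h6 : HasDerivAt (fun s : ℝ => potOne w (basisVec (.inl j))
      (X + s • (basisVec (.inl j) : Space d))) (radialOne (d := d) w (.inl 0) p / p.1) 0 := by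
    simp only [e]
    have hc : ContinuousAt (fun s : ℝ => radialOne (d := d) w (.inl 0) (√(p.1 ^ 2 + s ^ 2), p.2) /
        √(p.1 ^ 2 + s ^ 2)) 0 := by
      have hsq : Continuous fun s : ℝ => √(p.1 ^ 2 + s ^ 2) := by fun_prop
      refine ContinuousAt.div ?_ hsq.continuousAt ?_
      · exact ((hw.continuous_radialOne hd he _).comp (hsq.prodMk continuous_const)).continuousAt
      · have := hp.1; positivity
    refine (hasDerivAt_mul_self_zero hc).congr_deriv ?_
    simp [Real.sqrt_sq hp.1.le]
  rw [hX] at h6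
  exact h2.unique h6

theorem Source.radialTwo_transverse_snd (hd : 3 ≤ d) (hw : Source t s β C w)
    (he : Exponents θ t s β) {j : Fin 3} (hj : j ≠ 0) {p : ℝ × ℝ} (hp : p ∈ quadrant) :
    radialTwo (d := d) w (.inr j) (.inr j) p = radialOne (d := d) w (.inr 0) p / p.2 := by
  have hv := subUnit_basisVec (d := d) (.inr j)
  have h2 := hw.hasDerivAt_potOne hd he hv hv (ray_mem_offAxes hp)
  obtain ⟨X, hX⟩ : ∃ X : Space d, X = ray p := ⟨_, rfl⟩
  have hn : ∀ s : ℝ, ‖(X + s • (basisVec (.inr j) : Space d)).2‖ = √(p.2 ^ 2 + s ^ 2) := fun s => by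
    have : (X + s • (basisVec (.inr j) : Space d)).2 =
      X.2 + s • EuclideanSpace.single j (1 : ℝ) := rfl
    rw [this, norm_add_smul_of_inner_eq_zero _ (by simp), hX, norm_ray_snd, sq_abs]
    rw [hX]
    simp [ray, EuclideanSpace.inner_single_right, hj]
  have hn2 : ∀ s : ℝ, ‖(X + s • (basisVec (.inr j) : Space d)).1‖ = p.1 := fun s => by
    have : (X + s • (basisVec (.inr j) : Space d)).1 = X.1 := by simp [basisVec]
    rw [this, hX, norm_ray_fst, abs_of_pos hp.1]
  have e : ∀ s : ℝ, potOne w (basisVec (.inr j)) (X + s • (basisVec (.inr j) : Space d)) =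
      radialOne (d := d) w (.inr 0) (p.1, √(p.2 ^ 2 + s ^ 2)) / √(p.2 ^ 2 + s ^ 2) * s := fun s => by
    have h3 := (hw.dirDeriv_pot hd he hv).hasDerivAt X s
    have h4 := (hw.hasDerivAt_radial_snd hd he (p.1, √(p.2 ^ 2 + s ^ 2))).comp s
      (hasDerivAt_sqrt_add_sq hp.2 s)
    have h5 := h3.congr_of_eventuallyEq (f₁ := (fun z => radial d w (p.1, z)) ∘
      fun s => √(p.2 ^ 2 + s ^ 2)) (.of_forall fun s => by
        simp only [Function.comp_apply]
        rw [pot_eq_radial, hn, hn2])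
    rw [h5.unique h4]
    ring
  have h6 : HasDerivAt (fun s : ℝ => potOne w (basisVec (.inr j))
      (X + s • (basisVec (.inr j) : Space d))) (radialOne (d := d) w (.inr 0) p / p.2) 0 := by
    simp only [e]
    have hc : ContinuousAt (fun s : ℝ => radialOne (d := d) w (.inr 0) (p.1, √(p.2 ^ 2 + s ^ 2)) /
        √(p.2 ^ 2 + s ^ 2)) 0 := by
      have hsq : Continuous fun s : ℝ => √(p.2 ^ 2 + s ^ 2) := by fun_prop
      refine ContinuousAt.div ?_ hsq.continuousAt ?_
      · exact ((hw.continuous_radialOne hd he _).comp (continuous_const.prodMk hsq)).continuousAt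
      · have := hp.2; positivity
    refine (hasDerivAt_mul_self_zero hc).congr_deriv ?_
    simp [Real.sqrt_sq hp.2.le]
  rw [hX] at h6
  exact h2.unique h6

/-- The Poisson equation in the two radii. -/
theorem Source.radial_equation (hd : 3 ≤ d) (hw : Source t s β C w) (he : Exponents θ t s β)
    {p : ℝ × ℝ} (hp : p ∈ quadrant) :
    radialTwo (d := d) w (.inl 0) (.inl 0) p + d / p.1 * radialOne (d := d) w (.inl 0) p +
      radialTwo (d := d) w (.inr 0) (.inr 0) p + 2 / p.2 * radialOne (d := d) w (.inr 0) p =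
      -(w p * Real.pi ^ (((d : ℝ) + 4) / 2)) := by
  -- In the Laplacian, `d` transverse directions each contribute `∂_r/r` and two contribute `∂_z/z`.
  have h := hw.sum_potTwo hd he (ray_mem_offAxes hp)
  rw [radii_ray (quadrant_subset hp), Fintype.sum_sum_type, Fin.sum_univ_succ, Fin.sum_univ_succ] at h
  have e1 : ∀ j : Fin d, potTwo w (basisVec (.inl j.succ)) (basisVec (.inl j.succ)) (ray p) =
      radialOne (d := d) w (.inl 0) p / p.1 := fun j =>
    hw.radialTwo_transverse_fst hd he (Fin.succ_ne_zero j) hp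
  have e2 : ∀ j : Fin 2, potTwo w (basisVec (.inr j.succ)) (basisVec (.inr j.succ)) (ray p : Space d) =
      radialOne (d := d) w (.inr 0) p / p.2 := fun j =>
    hw.radialTwo_transverse_snd hd he (Fin.succ_ne_zero j) hp
  simp only [e1, e2, Finset.sum_const, Finset.card_univ, Fintype.card_fin, nsmul_eq_mul] at h
  rw [← h]
  simp only [radialTwo]
  push_cast
  ring

end

end

section

variable {d : ℕ}

/-! ### Bounds for the Hessian -/

/-- The size of the second derivatives. -/
noncomputable def hessWeight (t s β : ℝ) (p : ℝ × ℝ) : ℝ :=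
  p.1 ^ (-t) * (1 + p.2) ^ (-β) + if p.1 ^ 2 + p.2 ^ 2 ≤ 1 then p.1 ^ (-s) else 0

theorem hessWeight_nonneg {t s β : ℝ} {p : ℝ × ℝ} (hp : p ∈ quadrant) : 0 ≤ hessWeight t s β p := by
  have h1 := hp.1
  have h2 := hp.2
  unfold hessWeight
  split_ifs <;> positivity

section

variable {θ t s β C : ℝ} {w : ℝ × ℝ → ℝ}

/-- For `z ≤ 1/2` the weight loses nothing essential when the decay in `z` is dropped; outside the
unit ball one then has `r ≥ 1/2`, where `r^{-s}` is at most `2 r^{-t}`. -/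
theorem Exponents.add_rpow_le_hessWeight (he : Exponents θ t s β) {p : ℝ × ℝ} (hp : p ∈ quadrant)
    (hz : p.2 ≤ 1 / 2) : p.1 ^ (-t) + p.1 ^ (-s) ≤ 8 * hessWeight t s β p := by
  obtain ⟨h0, h1, h2, h3, h4, h5, -, -⟩ := he
  have hr := hp.1
  have hz0 := hp.2
  have e1 : 4 / 9 ≤ (1 + p.2) ^ (-β) := by
    calc (4 / 9 : ℝ) = (3 / 2) ^ (-2 : ℝ) := by
          rw [Real.rpow_neg (by norm_num)]; norm_num
      _ ≤ (3 / 2) ^ (-β) := Real.rpow_le_rpow_of_exponent_le (by norm_num) (by linarith)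
      _ ≤ _ := rpow_neg_anti (by linarith) (by linarith) (by linarith)
  have hP : 0 < p.1 ^ (-t) := by positivity
  have e2 : p.1 ^ (-t) * (4 / 9) ≤ p.1 ^ (-t) * (1 + p.2) ^ (-β) := by gcongr
  have hS : 0 < p.1 ^ (-s) := by positivity
  unfold hessWeight
  split_ifs with h
  · linarith
  · have hr2 : 1 / 2 ≤ p.1 := by nlinarith
    have e3 : p.1 ^ (-s) ≤ p.1 ^ (-t) * 2 := by
      have : p.1 ^ (-s) = p.1 ^ (-t) * p.1 ^ (-(s - t)) := by
        rw [← Real.rpow_add hr]; congr 1; ring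
      rw [this]
      gcongr
      calc p.1 ^ (-(s - t)) ≤ (1 / 2) ^ (-(s - t)) :=
            rpow_neg_anti (by norm_num) hr2 (by linarith)
        _ ≤ (1 / 2) ^ (-1 : ℝ) :=
            Real.rpow_le_rpow_of_exponent_ge (by norm_num) (by norm_num) (by linarith)
        _ = 2 := by rw [Real.rpow_neg_one]; norm_num
    linarith

theorem Source.le_hessWeight (hw : Source t s β C w) (he : Exponents θ t s β) {p : ℝ × ℝ}
    (hp : p ∈ quadrant) : w p ≤ 8 * C * hessWeight t s β p := by
  have hC := hw.nonneg_const
  have hr := hp.1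
  have hz := hp.2
  rcases lt_or_ge p.2 (1 / 2) with h | h
  · have h1 := hw.upper_crude (by linarith [he.pos, he.le_β]) hp
    have h2 := mul_le_mul_of_nonneg_left (he.add_rpow_le_hessWeight hp h.le) hC
    linarith
  · have h1 := hw.upper p hp
    rw [if_neg (not_lt.2 h), add_zero] at h1
    have h2 : p.1 ^ (-t) * (1 + p.2) ^ (-β) ≤ hessWeight t s β p := by
      unfold hessWeight
      split_ifs
      · have : 0 < p.1 ^ (-s) := by positivity
        linarith
      · linarith
    have h3 := mul_le_mul_of_nonneg_left h2 hC
    have h4 := mul_nonneg hC (hessWeight_nonneg (t := t) (s := s) (β := β) hp)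
    linarith

/-- The first bound is the final one. The second does not depend on `z` and is used at an unknown
intermediate point by the mean value argument for `∂_z/z`. -/
theorem exists_abs_potTwo_le_hessWeight (hd : 3 ≤ d) (hθ : 0 < θ) : ∃ K : ℝ, 0 < K ∧
    ∀ {t s β C : ℝ} {w : ℝ × ℝ → ℝ}, Exponents θ t s β → Source t s β C w → ∀ {v u : Space d},
    SubUnit v → SubUnit u → u.2 = 0 → ∀ {p : ℝ × ℝ}, p ∈ quadrant →
      |potTwo w v u (ray p)| ≤ K * (C * C) * hessWeight t s β p ∧
      |potTwo w v u (ray p)| ≤ K * (C * C) * (p.1 ^ (-t) + p.1 ^ (-s)) := by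
  obtain ⟨K, hK, hKb⟩ := exists_abs_potTwo_le hd hθ
  obtain ⟨K', hK', hKb'⟩ := exists_abs_potTwo_far_le hd hθ
  refine ⟨K + K', by positivity, fun {t s β C w} he hw {v u} hv hu hu2 {p} hp => ?_⟩
  have hC := hw.nonneg_const
  have hr := hp.1
  have hz := hp.2
  have b1 := hKb he hw hv hu hu2 _ (ray_mem_offAxes hp)
  have b2 := hKb' he hw hv hu hu2 _ (ray_mem_offAxes hp)
  rw [norm_ray_fst, norm_ray_snd, abs_of_pos hr, abs_of_pos hz] at b1 b2
  have hP : 0 ≤ p.1 ^ (-t) * (1 + p.2) ^ (-β) := by positivity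
  have hS : 0 ≤ p.1 ^ (-s) := by positivity
  have hCC := mul_nonneg hC hC
  constructor
  · unfold hessWeight
    split_ifs with h
    · refine b1.trans ?_
      gcongr
      linarith
    · refine (b2 (not_le.1 h)).trans ?_
      rw [add_zero]
      gcongr
      linarith
  · refine b1.trans ?_
    have hβ : (1 + p.2) ^ (-β) ≤ 1 :=
      Real.rpow_le_one_of_one_le_of_nonpos (by linarith) (by linarith [he.pos, he.le_β])
    have : p.1 ^ (-t) * (1 + p.2) ^ (-β) ≤ p.1 ^ (-t) * 1 := by gcongr
    rw [mul_one] at this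
    calc _ ≤ K * (C * C) * (p.1 ^ (-t) + p.1 ^ (-s)) := by gcongr
      _ ≤ _ := by gcongr; linarith

/-- For `z ≥ 1/2` the gradient bound suffices. For smaller `z` a derivative in `η` cannot be moved
to the source; instead the equation expresses `∂_z(z² ∂_z)` as `-z²` times the source, `∂_r²` and
`(d/r)∂_r`, all of which are already controlled uniformly in `z`. -/
theorem exists_abs_radialOne_div_le (hd : 3 ≤ d) (hθ : 0 < θ) : ∃ K : ℝ, 0 < K ∧
    ∀ {t s β C : ℝ} {w : ℝ × ℝ → ℝ}, Exponents θ t s β → Source t s β C w → 1 ≤ C →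
    ∀ {p : ℝ × ℝ}, p ∈ quadrant →
      |radialOne (d := d) w (.inr 0) p / p.2| ≤ K * (C * C) * hessWeight t s β p := by
  obtain ⟨K, hK, hKb⟩ := exists_abs_potOne_le hd hθ
  obtain ⟨K', hK', hKb'⟩ := exists_abs_potTwo_le_hessWeight (d := d) hd hθ
  obtain ⟨P, hP⟩ : ∃ P, P = Real.pi ^ (((d : ℝ) + 4) / 2) := ⟨_, rfl⟩
  have hP0 : 0 < P := by rw [hP]; exact Real.rpow_pos_of_pos Real.pi_pos _
  obtain ⟨J, hJ⟩ : ∃ J, J = P + (d + 1) * K' := ⟨_, rfl⟩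
  have hJ0 : 0 < J := by rw [hJ]; positivity
  refine ⟨3 * K + J * 8, by positivity, fun {t s β C w} he hw hC1 {p} hp => ?_⟩
  have hC := hw.nonneg_const
  have hr := hp.1
  have hz := hp.2
  have hH := hessWeight_nonneg (t := t) (s := s) (β := β) hp
  have hCC : C ≤ C * C := by nlinarith
  rcases le_total (1 / 2) p.2 with h | h
  · have b1 := hKb he hw (subUnit_basisVec (d := d) (.inr 0)) (ray p)
    rw [norm_ray_fst, norm_ray_snd, abs_of_pos hr, abs_of_pos hz] at b1
    have e1 : (1 + p.1 + p.2) ^ (-t) ≤ p.1 ^ (-t) :=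
      rpow_neg_anti hr (by linarith) (by linarith [he.pos, he.le_t])
    have e2 : (1 + p.2) ^ (1 - β) ≤ 3 * (1 + p.2) ^ (-β) * p.2 := by
      rw [sub_eq_add_neg, Real.rpow_add (by linarith), Real.rpow_one]
      have : 0 < (1 + p.2) ^ (-β) := by positivity
      nlinarith
    have h2 : p.1 ^ (-t) * (1 + p.2) ^ (-β) ≤ hessWeight t s β p := by
      unfold hessWeight
      split_ifs
      · have : 0 < p.1 ^ (-s) := by positivity
        linarith
      · linarith
    rw [abs_div, abs_of_pos hz, div_le_iff₀ hz]
    calc _ ≤ _ := b1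
      _ ≤ K * C * (p.1 ^ (-t) * (3 * (1 + p.2) ^ (-β) * p.2)) := by gcongr
      _ = 3 * K * C * (p.1 ^ (-t) * (1 + p.2) ^ (-β)) * p.2 := by ring
      _ ≤ 3 * K * (C * C) * hessWeight t s β p * p.2 := by gcongr
      _ ≤ _ := by gcongr; linarith
  · obtain ⟨g, hg⟩ : ∃ g, g = fun ζ => radialOne (d := d) w (.inr 0) (p.1, ζ) := ⟨_, rfl⟩
    have hgc : Continuous g := by
      rw [hg]
      exact (hw.continuous_radialOne hd he _).comp (continuous_const.prodMk continuous_id)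
    have hgd : ∀ ζ, 0 < ζ → HasDerivAt g (radialTwo (d := d) w (.inr 0) (.inr 0) (p.1, ζ)) ζ :=
      fun ζ hζ => by
        rw [hg]
        exact hw.hasDerivAt_radialOne_snd hd he (.inr 0) (p := (p.1, ζ)) ⟨hr, hζ⟩
    -- The function `ζ² g(ζ)` vanishes at zero, so its slope on `[0, z]` is `z² (g(z)/z)`, while its
    -- derivative at `c < z` is at most `z²` times the `z`-independent weight.
    obtain ⟨c, hc, hceq⟩ := exists_hasDerivAt_eq_slope (fun ζ => ζ ^ 2 * g ζ)
      (fun ζ => 2 * ζ * g ζ + ζ ^ 2 * radialTwo (d := d) w (.inr 0) (.inr 0) (p.1, ζ)) hz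
      ((continuous_pow 2).mul hgc).continuousOn fun ζ hζ => by
        refine ((hasDerivAt_pow 2 ζ).mul (hgd ζ hζ.1)).congr_deriv ?_
        push_cast
        ring
    have hc0 := hc.1
    have hq : ((p.1, c) : ℝ × ℝ) ∈ quadrant := ⟨hr, hc0⟩
    have heq := hw.radial_equation hd he hq
    rw [← hP] at heq
    have hgc' : radialOne (d := d) w (.inr 0) (p.1, c) = g c := by rw [hg]
    rw [hgc'] at heq
    simp only at heq hceq
    obtain ⟨N, hN⟩ : ∃ N, N = p.1 ^ (-t) + p.1 ^ (-s) := ⟨_, rfl⟩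
    have hN0 : 0 < N := by rw [hN]; positivity
    have b1 := (hKb' he hw (subUnit_basisVec (d := d) (.inl 0)) (subUnit_basisVec (.inl 0)) rfl hq).2
    -- A direction transverse to the ray, used to bound `∂_r/r` as a second derivative.
    have j0 : (⟨1, by omega⟩ : Fin (d + 1)) ≠ 0 := by simp [Fin.ext_iff]
    have b2 := (hKb' he hw (subUnit_basisVec (d := d) (.inl ⟨1, by omega⟩))
      (subUnit_basisVec (.inl ⟨1, by omega⟩)) rfl hq).2
    have b3 := hw.upper_crude (by linarith [he.pos, he.le_β]) hq
    have b4 := (hw.pos _ hq).le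
    have e2 := hw.radialTwo_transverse_fst hd he j0 hq
    rw [radialTwo] at e2
    rw [e2] at b2
    simp only at b1 b2 b3
    rw [← hN] at b1 b2 b3
    change |radialTwo (d := d) w (.inl 0) (.inl 0) (p.1, c)| ≤ _ at b1
    have hder : |2 * c * g c + c ^ 2 * radialTwo (d := d) w (.inr 0) (.inr 0) (p.1, c)| ≤
        p.2 ^ 2 * (J * (C * C) * N) := by
      have e3 : 2 * c * g c + c ^ 2 * radialTwo (d := d) w (.inr 0) (.inr 0) (p.1, c) =
          -(c ^ 2 * (w (p.1, c) * P + radialTwo (d := d) w (.inl 0) (.inl 0) (p.1, c) +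
            d * (radialOne (d := d) w (.inl 0) (p.1, c) / p.1))) := by
        have : radialTwo (d := d) w (.inr 0) (.inr 0) (p.1, c) = -(w (p.1, c) * P) -
            radialTwo (d := d) w (.inl 0) (.inl 0) (p.1, c) -
            d / p.1 * radialOne (d := d) w (.inl 0) (p.1, c) - 2 / c * g c := by linarith
        rw [this]
        field_simp
        ring
      rw [e3, abs_neg, abs_mul, abs_of_nonneg (sq_nonneg c)]
      have e4 : |w (p.1, c) * P + radialTwo (d := d) w (.inl 0) (.inl 0) (p.1, c) +
            d * (radialOne (d := d) w (.inl 0) (p.1, c) / p.1)| ≤ J * (C * C) * N := by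
        refine (abs_add_three _ _ _).trans ?_
        rw [abs_mul, abs_of_nonneg b4, abs_of_pos hP0, abs_mul, Nat.abs_cast, hJ]
        have a1 : w (p.1, c) * P ≤ C * C * N * P := by
          gcongr
          exact b3.trans (by gcongr)
        have a2 : (d : ℝ) * |radialOne (d := d) w (.inl 0) (p.1, c) / p.1| ≤
          d * (K' * (C * C) * N) := by gcongr
        linarith
      have e5 : c ^ 2 ≤ p.2 ^ 2 := by
        have := hc.2
        gcongr
      gcongr
    rw [hceq] at hder
    have e6 : ((fun ζ => ζ ^ 2 * g ζ) p.2 - (fun ζ => ζ ^ 2 * g ζ) 0) / (p.2 - 0) =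
        p.2 ^ 2 * (radialOne (d := d) w (.inr 0) p / p.2) := by
      simp only [hg, Prod.mk.eta]
      ring
    simp only at e6
    rw [e6, abs_mul, abs_of_pos (by positivity : 0 < p.2 ^ 2)] at hder
    have e7 := le_of_mul_le_mul_left hder (by positivity)
    refine e7.trans ?_
    have e8 := he.add_rpow_le_hessWeight hp h
    rw [← hN] at e8
    calc _ ≤ J * (C * C) * (8 * hessWeight t s β p) := by gcongr
      _ = J * 8 * (C * C) * hessWeight t s β p := by ring
      _ ≤ _ := by gcongr; linarith

/-- The Hessian of the radial potential. -/
theorem exists_abs_radialTwo_le (hd : 3 ≤ d) (hθ : 0 < θ) : ∃ K : ℝ, 0 < K ∧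
    ∀ {t s β C : ℝ} {w : ℝ × ℝ → ℝ}, Exponents θ t s β → Source t s β C w → 1 ≤ C →
    ∀ {p : ℝ × ℝ}, p ∈ quadrant → ∀ {i j : Fin (d + 1) ⊕ Fin 3}, (i = .inl 0 ∨ i = .inr 0) →
      (j = .inl 0 ∨ j = .inr 0) → |radialTwo w i j p| ≤ K * (C * C) * hessWeight t s β p := by
  obtain ⟨K, hK, hKb⟩ := exists_abs_radialOne_div_le (d := d) hd hθ
  obtain ⟨K', hK', hKb'⟩ := exists_abs_potTwo_le_hessWeight (d := d) hd hθ
  obtain ⟨P, hP⟩ : ∃ P, P = Real.pi ^ (((d : ℝ) + 4) / 2) := ⟨_, rfl⟩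
  have hP0 : 0 < P := by rw [hP]; exact Real.rpow_pos_of_pos Real.pi_pos _
  refine ⟨8 * P + (d + 1) * K' + 2 * K, by positivity, fun {t s β C w} he hw hC1 {p} hp => ?_⟩
  have hC := hw.nonneg_const
  have hr := hp.1
  have hz := hp.2
  have hH := hessWeight_nonneg (t := t) (s := s) (β := β) hp
  have hCC : C ≤ C * C := by nlinarith
  have hK'le : K' ≤ 8 * P + (d + 1) * K' + 2 * K := by
    have : 0 ≤ (d : ℝ) * K' := by positivity
    linarith
  have hfst : ∀ i : Fin (d + 1) ⊕ Fin 3, ∀ j : Fin (d + 1),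
      |radialTwo w i (.inl j) p| ≤ K' * (C * C) * hessWeight t s β p := fun i j =>
    (hKb' he hw (subUnit_basisVec i) (subUnit_basisVec (.inl j)) rfl hp).1
  have hle : K' * (C * C) * hessWeight t s β p ≤
      (8 * P + (d + 1) * K' + 2 * K) * (C * C) * hessWeight t s β p := by gcongr
  rintro i j hi (rfl | rfl)
  · exact (hfst i 0).trans hle
  · rcases hi with rfl | rfl
    · rw [radialTwo, potTwo_comm]
      exact (hfst (.inr 0) 0).trans hle
    -- Only `∂_z²` has no radial direction; it is solved for from the equation.
    · have heq := hw.radial_equation hd he hp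
      rw [← hP] at heq
      have j0 : (⟨1, by omega⟩ : Fin (d + 1)) ≠ 0 := by simp [Fin.ext_iff]
      have b1 := hfst (.inl 0) 0
      have b2 := hfst (.inl ⟨1, by omega⟩) ⟨1, by omega⟩
      rw [hw.radialTwo_transverse_fst hd he j0 hp] at b2
      have b3 := hKb he hw hC1 hp
      have b4 := hw.le_hessWeight he hp
      have b5 := (hw.pos _ hp).le
      have a1 : w p * P ≤ 8 * (C * C) * hessWeight t s β p * P := by
        gcongr
        exact b4.trans (by gcongr)
      have e : radialTwo (d := d) w (.inr 0) (.inr 0) p = -(w p * P +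
          (radialTwo (d := d) w (.inl 0) (.inl 0) p +
          (d * (radialOne (d := d) w (.inl 0) p / p.1) +
          2 * (radialOne (d := d) w (.inr 0) p / p.2)))) := by
        have e1 : (d : ℝ) / p.1 * radialOne (d := d) w (.inl 0) p =
          d * (radialOne (d := d) w (.inl 0) p / p.1) := by ring
        have e2 : 2 / p.2 * radialOne (d := d) w (.inr 0) p =
          2 * (radialOne (d := d) w (.inr 0) p / p.2) := by ring
        linarith
      have a2 : (d : ℝ) * |radialOne (d := d) w (.inl 0) p / p.1| ≤
        d * (K' * (C * C) * hessWeight t s β p) := by gcongr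
      rw [e, abs_neg]
      refine (abs_add_le _ _).trans ((add_le_add_right ((abs_add_le _ _).trans
        (add_le_add_right (abs_add_le _ _) _)) _).trans ?_)
      rw [abs_mul, abs_of_nonneg b5, abs_of_pos hP0, abs_mul, Nat.abs_cast, abs_mul,
        abs_of_pos (by norm_num : (0 : ℝ) < 2)]
      linarith

end

end

section

/-! ### Uniqueness by the maximum principle -/

/-- A positive second derivative would make the point a local minimum as well, hence `f` locally
constant, which is a contradiction. -/
theorem deriv_deriv_nonpos_of_isLocalMax {f : ℝ → ℝ} {x : ℝ} (h : IsLocalMax f x)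
    (hf : ContinuousAt f x) : deriv (deriv f) x ≤ 0 := by
  by_contra hpos
  have hmin := isLocalMin_of_deriv_deriv_pos (not_le.1 hpos) h.deriv_eq_zero hf
  have hc : f =ᶠ[𝓝 x] fun _ => f x := by
    filter_upwards [h, hmin] with y h1 h2 using le_antisymm h1 h2
  have := hc.deriv.deriv_eq
  simp [this] at hpos

section

variable {φ : ℝ × ℝ → ℝ} {p : ℝ × ℝ}

theorem hasDerivAt_dr_of_differentiableAt (h : DifferentiableAt ℝ φ p) :
    HasDerivAt (fun s => φ (s, p.2)) (dr φ p) p.1 ∧ dr φ p = fderiv ℝ φ p (1, 0) := by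
  have h1 : HasDerivAt (fun s : ℝ => (s, p.2)) (1, 0) p.1 :=
    (hasDerivAt_id p.1).prodMk (hasDerivAt_const _ _)
  have h2 := HasFDerivAt.comp_hasDerivAt (f := fun s : ℝ => (s, p.2)) p.1 h.hasFDerivAt h1
  exact ⟨h2.differentiableAt.hasDerivAt, h2.deriv⟩

theorem hasDerivAt_dz_of_differentiableAt (h : DifferentiableAt ℝ φ p) :
    HasDerivAt (fun s => φ (p.1, s)) (dz φ p) p.2 ∧ dz φ p = fderiv ℝ φ p (0, 1) := by
  have h1 : HasDerivAt (fun s : ℝ => (p.1, s)) (0, 1) p.2 :=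
    (hasDerivAt_const _ _).prodMk (hasDerivAt_id p.2)
  have h2 := HasFDerivAt.comp_hasDerivAt (f := fun s : ℝ => (p.1, s)) p.2 h.hasFDerivAt h1
  exact ⟨h2.differentiableAt.hasDerivAt, h2.deriv⟩

theorem differentiableAt_of_contDiffOn_quadrant {n : ℕ} (h : ContDiffOn ℝ (n + 1) φ quadrant)
    (hp : p ∈ quadrant) : DifferentiableAt ℝ φ p :=
  (h.contDiffAt (quadrant_mem_nhds hp)).differentiableAt (by simp)

theorem differentiableAt_dr (h : ContDiffOn ℝ 2 φ quadrant) (hp : p ∈ quadrant) :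
    DifferentiableAt ℝ (dr φ) p := by
  have h' : ContDiffOn ℝ ((1 : ℕ) + 1) φ quadrant := by norm_num; exact h
  have h1 : ContDiffAt ℝ 1 (fderiv ℝ φ) p :=
    (h.contDiffAt (quadrant_mem_nhds hp)).fderiv_right (by norm_num)
  refine ((h1.differentiableAt (by simp)).clm_apply
    (differentiableAt_const ((1, 0) : ℝ × ℝ))).congr_of_eventuallyEq ?_
  filter_upwards [quadrant_mem_nhds hp] with q hq
  exact (hasDerivAt_dr_of_differentiableAt (differentiableAt_of_contDiffOn_quadrant h' hq)).2

theorem differentiableAt_dz (h : ContDiffOn ℝ 2 φ quadrant) (hp : p ∈ quadrant) :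
    DifferentiableAt ℝ (dz φ) p := by
  have h' : ContDiffOn ℝ ((1 : ℕ) + 1) φ quadrant := by norm_num; exact h
  have h1 : ContDiffAt ℝ 1 (fderiv ℝ φ) p :=
    (h.contDiffAt (quadrant_mem_nhds hp)).fderiv_right (by norm_num)
  refine ((h1.differentiableAt (by simp)).clm_apply
    (differentiableAt_const ((0, 1) : ℝ × ℝ))).congr_of_eventuallyEq ?_
  filter_upwards [quadrant_mem_nhds hp] with q hq
  exact (hasDerivAt_dz_of_differentiableAt (differentiableAt_of_contDiffOn_quadrant h' hq)).2

end

/-- The inequality between the derivatives of `u` at an interior maximum of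
`u(r) + ε log r + const`. -/
theorem deriv_le_of_isLocalMax_add_log {f f' : ℝ → ℝ} {f'' ε c x : ℝ} (hx : 0 < x)
    (h : IsLocalMax (fun s => f s + ε * (Real.log s + c)) x)
    (h1 : ∀ᶠ s in 𝓝 x, HasDerivAt f (f' s) s) (h2 : HasDerivAt f' f'' x) :
    f' x = -(ε / x) ∧ f'' ≤ ε / x ^ 2 := by
  have hd : ∀ᶠ s in 𝓝 x, HasDerivAt (fun s => f s + ε * (Real.log s + c)) (f' s + ε * s⁻¹) s := by
    filter_upwards [h1, lt_mem_nhds hx] with s hs hs0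
    exact hs.add (((Real.hasDerivAt_log hs0.ne').add_const c).const_mul ε)
  have e1 : deriv (fun s => f s + ε * (Real.log s + c)) =ᶠ[𝓝 x] fun s => f' s + ε * s⁻¹ := by
    filter_upwards [hd] with s hs using hs.deriv
  have e2 : HasDerivAt (fun s => f' s + ε * s⁻¹) (f'' + ε * (-(x ^ 2)⁻¹)) x :=
    h2.add ((hasDerivAt_inv hx.ne').const_mul ε)
  have h3 := h.deriv_eq_zero
  rw [hd.self_of_nhds.deriv] at h3
  have h4 := deriv_deriv_nonpos_of_isLocalMax h hd.self_of_nhds.continuousAt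
  rw [e1.deriv_eq, e2.deriv] at h4
  constructor
  · rw [div_eq_mul_inv]; linarith
  · rw [div_eq_mul_inv]; linarith

/-- If `u = φ - ψ` were positive at `p₀`, then `u + ε (log r + log z)` would have an interior
maximum: the logarithms exclude the axes and decay excludes large `r + z`. There the equation gives
`u_rr + u_zz = dε/r² + 2ε/z²`, while maximality gives at most `ε/r² + ε/z²`. -/
theorem le_of_isDecayingSolution {d : ℕ} (hd : 2 ≤ d) {a : ℝ} {Ω φ ψ : ℝ × ℝ → ℝ}
    (hφ : IsDecayingSolution d a Ω φ) (hψ : IsDecayingSolution d a Ω ψ) {p₀ : ℝ × ℝ}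
    (hp₀ : p₀ ∈ quadrant) : φ p₀ ≤ ψ p₀ := by
  by_contra hlt
  obtain ⟨u, hu⟩ : ∃ u, u = fun p => φ p - ψ p := ⟨_, rfl⟩
  obtain ⟨m, hm⟩ : ∃ m, m = u p₀ := ⟨_, rfl⟩
  have hm0 : 0 < m := by rw [hm, hu]; exact sub_pos.2 (not_le.1 hlt)
  have hr₀ := hp₀.1
  have hz₀ := hp₀.2
  have hdec : Tendsto u (comap (fun p : ℝ × ℝ => p.1 + p.2) atTop ⊓ 𝓟 closedQuadrant) (𝓝 0) := by
    have := hφ.decay.sub hψ.decay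
    rw [sub_zero] at this
    rw [hu]; exact this
  obtain ⟨R₀, hR₀⟩ : ∃ R₀ : ℝ, ∀ p ∈ closedQuadrant, R₀ ≤ p.1 + p.2 → u p < m / 4 := by
    have h := hdec.eventually_lt_const (show (0 : ℝ) < m / 4 by positivity)
    rw [eventually_inf_principal, eventually_comap] at h
    obtain ⟨R₀, h⟩ := eventually_atTop.1 h
    exact ⟨R₀, fun p hp hR => h _ hR p rfl hp⟩
  obtain ⟨R, hR1, hR2, hR3⟩ : ∃ R : ℝ, 1 ≤ R ∧ R₀ ≤ R ∧ p₀.1 + p₀.2 < R :=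
    ⟨max 1 (max R₀ (p₀.1 + p₀.2 + 1)), le_max_left _ _, (le_max_left _ _).trans (le_max_right _ _),
      lt_of_lt_of_le (by linarith) ((le_max_right _ _).trans (le_max_right _ _))⟩
  have hlogR := Real.log_nonneg hR1
  -- With `ε = m/(4L)` the barrier lowers the value at `p₀` by at most `m/4`, to `3m/4`, and raises
  -- any value in the truncated triangle by at most `m/4`.
  obtain ⟨L, hL⟩ : ∃ L, L = 1 + 2 * Real.log R + |Real.log p₀.1 + Real.log p₀.2| := ⟨_, rfl⟩
  have hL0 : 0 < L := by rw [hL]; positivity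
  obtain ⟨ε, hε⟩ : ∃ ε, ε = m / (4 * L) := ⟨_, rfl⟩
  have hε0 : 0 < ε := by rw [hε]; positivity
  have hεL : ε * L = m / 4 := by rw [hε]; field_simp
  have huc : ContinuousOn u closedQuadrant := by
    rw [hu]; exact hφ.contDiffOn_closed.continuousOn.sub hψ.contDiffOn_closed.continuousOn
  have hTc : IsCompact (Icc (0 : ℝ) R ×ˢ Icc (0 : ℝ) R) := isCompact_Icc.prod isCompact_Icc
  obtain ⟨B, hB⟩ : ∃ B, ∀ p ∈ Icc (0 : ℝ) R ×ˢ Icc (0 : ℝ) R, u p ≤ B := by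
    obtain ⟨B, hB⟩ := hTc.bddAbove_image (huc.mono fun p hp => ⟨hp.1.1, hp.2.1⟩)
    exact ⟨B, fun p hp => hB (mem_image_of_mem _ hp)⟩
  -- So close to an axis the logarithm pushes the perturbed function below `m/2`.
  obtain ⟨η, hη0, hη1, hη2, hη3⟩ : ∃ η : ℝ, 0 < η ∧ η < p₀.1 ∧ η < p₀.2 ∧
      B + ε * (Real.log η + Real.log R) < m / 2 := by
    have h1 : Tendsto (fun η => B + ε * (Real.log η + Real.log R)) (𝓝[>] 0) atBot :=
      tendsto_atBot_add_const_left _ _ ((tendsto_atBot_add_const_right _ _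
        Real.tendsto_log_nhdsGT_zero).const_mul_atBot hε0)
    have h2 := h1.eventually (eventually_lt_atBot (m / 2))
    have h3 : ∀ᶠ η in 𝓝[>] (0 : ℝ), η < p₀.1 := nhdsWithin_le_nhds (gt_mem_nhds hr₀)
    have h4 : ∀ᶠ η in 𝓝[>] (0 : ℝ), η < p₀.2 := nhdsWithin_le_nhds (gt_mem_nhds hz₀)
    obtain ⟨η, a1, a2, a3, a4⟩ := (h2.and (h3.and (h4.and self_mem_nhdsWithin))).exists
    exact ⟨η, a4, a2, a3, a1⟩
  obtain ⟨F, hF⟩ : ∃ F : ℝ × ℝ → ℝ, F = fun p => u p + ε * (Real.log p.1 + Real.log p.2) := ⟨_, rfl⟩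
  obtain ⟨T, hT⟩ : ∃ T : Set (ℝ × ℝ), T = {p | η ≤ p.1 ∧ η ≤ p.2 ∧ p.1 + p.2 ≤ R} := ⟨_, rfl⟩
  have hTsub : T ⊆ Icc (0 : ℝ) R ×ˢ Icc (0 : ℝ) R := by
    rw [hT]
    rintro p ⟨b1, b2, b3⟩
    exact ⟨⟨by linarith, by linarith⟩, ⟨by linarith, by linarith⟩⟩
  have hTq : T ⊆ quadrant := by
    rw [hT]
    rintro p ⟨b1, b2, b3⟩
    exact ⟨by linarith, by linarith⟩
  have hTcpt : IsCompact T := by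
    refine hTc.of_isClosed_subset ?_ hTsub
    rw [hT]
    exact (isClosed_le continuous_const continuous_fst).inter
      ((isClosed_le continuous_const continuous_snd).inter
        (isClosed_le (continuous_fst.add continuous_snd) continuous_const))
  have hFc : ContinuousOn F T := by
    rw [hF]
    refine (huc.mono (hTq.trans quadrant_subset)).add (continuousOn_const.mul (.add ?_ ?_))
    · exact continuous_fst.continuousOn.log fun p hp => (hTq hp).1.ne'
    · exact continuous_snd.continuousOn.log fun p hp => (hTq hp).2.ne'
  have hp₀T : p₀ ∈ T := by rw [hT]; exact ⟨hη1.le, hη2.le, hR3.le⟩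
  obtain ⟨q, hqT, hqmax⟩ := hTcpt.exists_isMaxOn ⟨p₀, hp₀T⟩ hFc
  have hFp₀ : 3 * m / 4 ≤ F p₀ := by
    have h1 : -|Real.log p₀.1 + Real.log p₀.2| ≤ Real.log p₀.1 + Real.log p₀.2 := neg_abs_le _
    have h2 : -L ≤ Real.log p₀.1 + Real.log p₀.2 := by rw [hL]; linarith
    have h3 := mul_le_mul_of_nonneg_left h2 hε0.le
    rw [hF]
    simp only
    rw [← hm]
    linarith
  have hFq : 3 * m / 4 ≤ F q := hFp₀.trans (hqmax hp₀T)
  have hq := hTq hqT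
  have hqR := hTsub hqT
  have hl1 : Real.log q.1 ≤ Real.log R := Real.log_le_log hq.1 hqR.1.2
  have hl2 : Real.log q.2 ≤ Real.log R := Real.log_le_log hq.2 hqR.2.2
  have hBq := hB q hqR
  have hεl : ε * (Real.log q.1 + Real.log q.2) ≤ m / 4 := by
    rw [← hεL]
    refine mul_le_mul_of_nonneg_left ?_ hε0.le
    rw [hL]
    linarith [abs_nonneg (Real.log p₀.1 + Real.log p₀.2)]
  rw [hT] at hqT
  obtain ⟨t1, t2, t3⟩ := hqT
  rw [hF] at hFq
  simp only at hFq
  -- The value at the maximum is at least `3m/4`, whereas on each of the three sides of the triangle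
  -- it is below `m/2`.
  have s1 : η < q.1 := lt_of_le_of_ne t1 fun h => by
    rw [← h] at hFq
    have : ε * (Real.log η + Real.log q.2) ≤ ε * (Real.log η + Real.log R) := by gcongr
    linarith
  have s2 : η < q.2 := lt_of_le_of_ne t2 fun h => by
    rw [← h] at hFq
    have : ε * (Real.log q.1 + Real.log η) ≤ ε * (Real.log η + Real.log R) := by
      rw [add_comm]; gcongr
    linarith
  have s3 : q.1 + q.2 < R := lt_of_le_of_ne t3 fun h => by
    have := hR₀ q (quadrant_subset hq) (by rw [h]; exact hR2)
    linarith
  have hmax1 : IsLocalMax (fun s => u (s, q.2) + ε * (Real.log s + Real.log q.2)) q.1 := by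
    filter_upwards [lt_mem_nhds s1, gt_mem_nhds (show q.1 < R - q.2 by linarith)] with s a1 a2
    have := hqmax (show (s, q.2) ∈ T by rw [hT]; exact ⟨a1.le, s2.le, by simp only; linarith⟩)
    rw [hF] at this
    exact this
  have hmax2 : IsLocalMax (fun s => u (q.1, s) + ε * (Real.log s + Real.log q.1)) q.2 := by
    filter_upwards [lt_mem_nhds s2, gt_mem_nhds (show q.2 < R - q.1 by linarith)] with s a1 a2
    have := hqmax (show (q.1, s) ∈ T by rw [hT]; exact ⟨s1.le, a1.le, by simp only; linarith⟩)
    rw [hF] at this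
    simp only at this
    rw [add_comm (Real.log s), add_comm (Real.log q.2)]
    exact this
  have hdiff : ∀ {χ : ℝ × ℝ → ℝ}, ContDiffOn ℝ 2 χ quadrant → ∀ p ∈ quadrant,
      DifferentiableAt ℝ χ p := fun {χ} h p hp =>
    (h.contDiffAt (quadrant_mem_nhds hp)).differentiableAt (by simp)
  obtain ⟨i1, i2⟩ := deriv_le_of_isLocalMax_add_log hq.1 hmax1
    (f' := fun s => dr φ (s, q.2) - dr ψ (s, q.2))
    (by
      filter_upwards [lt_mem_nhds hq.1] with s hs
      have hsq : (s, q.2) ∈ quadrant := ⟨hs, hq.2⟩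
      rw [hu]
      exact (hasDerivAt_dr_of_differentiableAt (hdiff hφ.contDiffOn _ hsq)).1.sub
        (hasDerivAt_dr_of_differentiableAt (hdiff hψ.contDiffOn _ hsq)).1)
    ((hasDerivAt_dr_of_differentiableAt (differentiableAt_dr hφ.contDiffOn hq)).1.sub
      (hasDerivAt_dr_of_differentiableAt (differentiableAt_dr hψ.contDiffOn hq)).1)
  obtain ⟨i3, i4⟩ := deriv_le_of_isLocalMax_add_log hq.2 hmax2
    (f' := fun s => dz φ (q.1, s) - dz ψ (q.1, s))
    (by
      filter_upwards [lt_mem_nhds hq.2] with s hs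
      have hsq : (q.1, s) ∈ quadrant := ⟨hq.1, hs⟩
      rw [hu]
      exact (hasDerivAt_dz_of_differentiableAt (hdiff hφ.contDiffOn _ hsq)).1.sub
        (hasDerivAt_dz_of_differentiableAt (hdiff hψ.contDiffOn _ hsq)).1)
    ((hasDerivAt_dz_of_differentiableAt (differentiableAt_dz hφ.contDiffOn hq)).1.sub
      (hasDerivAt_dz_of_differentiableAt (differentiableAt_dz hψ.contDiffOn hq)).1)
  simp only [Prod.mk.eta] at i1 i3
  have e1 := hφ.equation q.1 q.2 hq.1 hq.2
  have e2 := hψ.equation q.1 q.2 hq.1 hq.2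
  simp only [Prod.mk.eta] at e1 e2
  have e3 : dr (dr φ) q - dr (dr ψ) q + (dz (dz φ) q - dz (dz ψ) q) =
      d * (ε / q.1 ^ 2) + 2 * (ε / q.2 ^ 2) := by
    have h1 : (d : ℝ) / q.1 * (dr φ q - dr ψ q) = -(d * (ε / q.1 ^ 2)) := by
      rw [i1]; field_simp
    have h2 : 2 / q.2 * (dz φ q - dz ψ q) = -(2 * (ε / q.2 ^ 2)) := by
      rw [i3]; field_simp
    rw [mul_sub] at h1 h2
    linarith
  have hd' : (2 : ℝ) ≤ d := by exact_mod_cast hd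
  have g1 : 0 < ε / q.1 ^ 2 := div_pos hε0 (pow_pos hq.1 2)
  have g2 : 0 < ε / q.2 ^ 2 := div_pos hε0 (pow_pos hq.2 2)
  have g3 : 2 * (ε / q.1 ^ 2) ≤ d * (ε / q.1 ^ 2) := by gcongr
  linarith

theorem closedQuadrant_subset_closure : closedQuadrant ⊆ closure quadrant := by
  have h : quadrant = Ioi (0 : ℝ) ×ˢ Ioi (0 : ℝ) := by ext; rfl
  rw [h, closure_prod_eq, closure_Ioi]
  exact fun p hp => ⟨hp.1, hp.2⟩

theorem eqOn_of_isDecayingSolution {d : ℕ} (hd : 2 ≤ d) {a : ℝ} {Ω φ ψ : ℝ × ℝ → ℝ}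
    (hφ : IsDecayingSolution d a Ω φ) (hψ : IsDecayingSolution d a Ω ψ) :
    EqOn φ ψ closedQuadrant :=
  Set.EqOn.of_subset_closure (fun _ hp => le_antisymm (le_of_isDecayingSolution hd hφ hψ hp)
    (le_of_isDecayingSolution hd hψ hφ hp)) hφ.contDiffOn_closed.continuousOn
    hψ.contDiffOn_closed.continuousOn quadrant_subset closedQuadrant_subset_closure

end

section

/-! ### The parameters of the problem -/

section

variable {d : ℕ} {a μ M' : ℝ} {Ω : ℝ × ℝ → ℝ}

/-- The decay exponent of the source in the radial variable. -/
noncomputable def expT (d : ℕ) (μ : ℝ) : ℝ := ((d : ℝ) - 1) / (d * μ) - ((d : ℝ) - 3)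

/-- The exponent of the radial singularity of the source. -/
noncomputable def expS (d : ℕ) (a μ : ℝ) : ℝ := gam d a μ - ((d : ℝ) - 3)

/-- The decay exponent of the source in the axial variable. -/
noncomputable def expB (d : ℕ) (μ : ℝ) : ℝ := 1 + 1 / (d * μ)

theorem MuRange.bounds (hd : 3 ≤ d) (ha : ARange d a) (hμ : MuRange d a μ) :
    0 < a ∧ a < aOne d a ∧ a ≤ 1 / 2 ∧ ((d : ℝ) - 1) * a < μ ∧ ((d : ℝ) - 1) * aOne d a < μ ∧
      3 / (3 * (d : ℝ) - 5) < μ ∧ μ < 1 / ((d : ℝ) - 2) ∧ 0 < μ := by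
  have hd' : (3 : ℝ) ≤ d := by exact_mod_cast hd
  obtain ⟨c1, c2, c3, c4, c5⟩ := muLow_chain hd ha
  obtain ⟨h1, h2⟩ := hμ
  have ha0 : 0 < a := lt_trans (div_pos four_pos (mul_pos (by linarith) (by linarith))) ha.1
  have h0 : 0 < 3 / (3 * (d : ℝ) - 5) := div_pos three_pos (by linarith)
  refine ⟨ha0, lt_of_mul_lt_mul_left c3 (by linarith), ?_, by linarith, by linarith, by linarith, h2,
    by linarith⟩
  refine ha.2.le.trans ?_
  rw [one_div_le_one_div (mul_pos (by linarith) (by linarith)) two_pos]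
  nlinarith

/-- After cross-multiplication the difference is `(μ - (d-1)b)(dμ + 1)`. It yields the ordering `t ≤
s` of the source exponents. -/
theorem le_gam (hd : 3 ≤ d) {b : ℝ} (hb : 0 < b) (hμ : 0 < μ) (h : ((d : ℝ) - 1) * b ≤ μ) :
    ((d : ℝ) - 1) / (d * μ) ≤ gam d b μ := by
  have hd' : (3 : ℝ) ≤ d := by exact_mod_cast hd
  unfold gam
  rw [div_le_div_iff₀ (by positivity) (by positivity)]
  have : 0 ≤ (μ - ((d : ℝ) - 1) * b) * (d * μ + 1) := mul_nonneg (by linarith) (by positivity)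
  linarith

theorem gam_anti (hd : 3 ≤ d) {b b' : ℝ} (hb : 0 < b) (hbb : b ≤ b') (hμ : 0 < μ)
    (h : ((d : ℝ) - 1) * b ≤ μ) : gam d b' μ ≤ gam d b μ := by
  have hd' : (3 : ℝ) ≤ d := by exact_mod_cast hd
  unfold gam
  have : ((d : ℝ) - 1) * b ≤ ((d : ℝ) - 1) * b' := mul_le_mul_of_nonneg_left hbb (by linarith)
  exact div_le_div₀ (by linarith) (by linarith) (by linarith) (by linarith)

/-- Identifies the small parameter `σ`, the total decay of the source beyond the critical power two.
-/
theorem expT_add_expB (hd : 3 ≤ d) (hμ : 0 < μ) : expT d μ + expB d μ - 2 = 1 / μ - ((d : ℝ) - 2) := by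
  have hd' : (0 : ℝ) < d := by exact_mod_cast (by omega : 0 < d)
  unfold expT expB
  field_simp
  ring

/-- In terms of `q = 1/(dμ)` the exponents are `t = (d-1)q - (d-3)` and `β = 1 + q`. The bound `μ <
1/(d-2)` gives `t ≥ θ`, `β ≥ 1 + θ` and `t + β > 2`; `μ > 3/(3d-5)` gives `β ≤ 2 - θ` and `t + β ≤
3`. The choice `θ = 1/(4d)` is uniform in `μ`. -/
theorem MuRange.exponents (hd : 3 ≤ d) (ha : ARange d a) (hμ : MuRange d a μ) :
    Exponents (1 / (4 * (d : ℝ))) (expT d μ) (expS d a μ) (expB d μ) := by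
  have hd' : (3 : ℝ) ≤ d := by exact_mod_cast hd
  obtain ⟨b1, b2, b3, b4, b5, b6, b7, b8⟩ := hμ.bounds hd ha
  have hT := expT_add_expB hd b8
  obtain ⟨q, hq⟩ : ∃ q, q = 1 / ((d : ℝ) * μ) := ⟨_, rfl⟩
  have hqm : q * (d * μ) = 1 := by rw [hq]; field_simp
  have hq1 : ((d : ℝ) - 2) / d < q := by
    rw [hq, div_lt_div_iff₀ (by linarith) (by positivity)]
    rw [lt_div_iff₀ (by linarith)] at b7
    nlinarith
  have hq2 : q < (3 * (d : ℝ) - 5) / (3 * d) := by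
    rw [hq, div_lt_div_iff₀ (by positivity) (by positivity)]
    rw [div_lt_iff₀ (by linarith)] at b6
    nlinarith
  rw [div_lt_iff₀ (by linarith)] at hq1
  rw [lt_div_iff₀ (by linarith)] at hq2
  obtain ⟨θ, hθ⟩ : ∃ θ, θ = 1 / (4 * (d : ℝ)) := ⟨_, rfl⟩
  have hθd : θ * (4 * d) = 1 := by rw [hθ]; field_simp
  have hθ0 : 0 < θ := by rw [hθ]; positivity
  have hθ1 : θ ≤ 1 / 12 := by
    rw [hθ]; exact one_div_le_one_div_of_le (by norm_num) (by linarith)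
  have eT : expT d μ = ((d : ℝ) - 1) * q - (d - 3) := by rw [expT, hq]; ring
  have eB : expB d μ = 1 + q := by rw [expB, hq]
  rw [← hθ]
  have hμinv : 1 / μ = q * d := by rw [hq]; field_simp
  rw [hμinv] at hT
  refine ⟨hθ0, ?_, ?_, ?_, ?_, ?_, ?_, ?_⟩
  · rw [eT]
    refine le_of_mul_le_mul_right ?_ (by linarith : (0 : ℝ) < 4 * d)
    rw [hθd]
    nlinarith
  · unfold expT expS
    linarith [le_gam hd b1 b8 b4.le]
  -- This is where the lower bound on `a` enters: with `μ ≥ (d-1)a` the claim reduces to `1 + 2θ ≤ a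
  -- d (d-2)`, and `a d (d-2)` exceeds `4d/(4d-3)`.
  · have h1 : gam d a μ ≤ (d : ℝ) - 2 - θ := by
      unfold gam
      rw [div_le_iff₀ (by linarith)]
      have h2 : μ + a ≤ 2 := by
        have : 1 / ((d : ℝ) - 2) ≤ 1 := by rw [div_le_one (by linarith)]; linarith
        linarith
      have h3 : θ * (μ + a) ≤ θ * 2 := by gcongr
      have h4 : 1 + θ * 2 ≤ ((d : ℝ) - 3) * μ + (2 * d - 3) * a := by
        have h5 := ha.1
        rw [div_lt_iff₀ (mul_pos (by linarith) (by linarith))] at h5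
        have h6 : ((d : ℝ) - 3) * ((d - 1) * a) ≤ ((d : ℝ) - 3) * μ :=
          mul_le_mul_of_nonneg_left b4.le (by linarith)
        have h7 : ((d : ℝ) - 3) * ((d - 1) * a) + (2 * d - 3) * a = a * (d * (d - 2)) := by ring
        have h8 : 1 + θ * 2 ≤ a * (d * (d - 2)) := by
          refine le_of_mul_le_mul_right ?_ (by linarith : (0 : ℝ) < 4 * d - 3)
          have h9 : 4 * (d : ℝ) ≤ a * (d * (d - 2)) * (4 * d - 3) := by nlinarith
          nlinarith
        linarith
      linarith
    unfold expS
    linarith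
  · rw [eB]
    nlinarith
  · rw [eB]
    have : q ≤ 1 - θ := by
      refine le_of_mul_le_mul_right ?_ (by linarith : (0 : ℝ) < 3 * d)
      nlinarith
    linarith
  · linarith
  · linarith

/-- The right-hand side of the Poisson equation. -/
noncomputable def density (d : ℕ) (Ω : ℝ × ℝ → ℝ) (p : ℝ × ℝ) : ℝ := p.1 ^ (d - 3) * p.2⁻¹ * Ω p

theorem pow_sub_three (hd : 3 ≤ d) (r : ℝ) : r ^ (d - 3) = r ^ ((d : ℝ) - 3) := by
  rw [← Real.rpow_natCast, Nat.cast_sub hd, Nat.cast_ofNat]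

/-- Each half of the minimum is used on one side of `z = 1/2`. For small `z` the factor `z` cancels
the `z^{-1}` of the density; for `z ≥ 1/2` the power of `z` is comparable with that of `1+z`. The
summand `d` in the constant is there for the logarithmic derivative. -/
theorem MemB.density_le (hd : 3 ≤ d) (ha : ARange d a) (hμ : MuRange d a μ) (hM' : 1 < M')
    (hΩ : MemB d a μ M' Ω) {p : ℝ × ℝ} (hp : p ∈ quadrant) :
    density d Ω p ≤ (9 * M' + d) * (p.1 ^ (-expT d μ) * (1 + p.2) ^ (-expB d μ) +
      if p.2 < 1 / 2 then p.1 ^ (-expS d a μ) else 0) := by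
  have hr := hp.1
  have hz := hp.2
  have hd' : (3 : ℝ) ≤ d := by exact_mod_cast hd
  obtain ⟨h0, h1, h2, h3, h4, h5, h6, h7⟩ := hμ.exponents hd ha
  obtain ⟨b1, b2, b3, b4, b5, b6, b7, b8⟩ := hμ.bounds hd ha
  have hθ1 : 1 / (4 * (d : ℝ)) ≤ 1 := by rw [div_le_one (by positivity)]; linarith
  have hup := hΩ.upper p hp
  have hfac : 0 < p.1 ^ (d - 3) * p.2⁻¹ := by positivity
  have hP : 0 < p.1 ^ (-expT d μ) * (1 + p.2) ^ (-expB d μ) := by positivity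
  have hM : 9 * M' ≤ 9 * M' + d := by linarith
  unfold density
  split_ifs with hz2
  · have hS : 0 < p.1 ^ (-expS d a μ) := by positivity
    have hu : Ω p ≤ M' * (p.2 * p.1 ^ (-gam d a μ) + p.2 * p.1 ^ (-gam d (aOne d a) μ)) :=
      hup.trans (by gcongr; exact min_le_right _ _)
    have e1 : p.1 ^ (d - 3) * p.1 ^ (-gam d a μ) = p.1 ^ (-expS d a μ) := by
      rw [pow_sub_three hd, ← Real.rpow_add hr]; congr 1; unfold expS; ring
    have e2 : p.1 ^ (d - 3) * p.1 ^ (-gam d (aOne d a) μ) = p.1 ^ (-expS d (aOne d a) μ) := by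
      rw [pow_sub_three hd, ← Real.rpow_add hr]; congr 1; unfold expS; ring
    have l1 : expT d μ ≤ expS d (aOne d a) μ := by
      unfold expT expS
      linarith [le_gam hd (b1.trans b2) b8 b5.le]
    have l2 : expS d (aOne d a) μ ≤ expS d a μ := by
      unfold expS
      linarith [gam_anti hd b1 b2.le b8 b4.le]
    -- The exponent coming from `γ₁` lies between `t` and `s`, so it is dominated by the first power
    -- for `r ≥ 1` and by the second for `r ≤ 1`.
    have e3 : p.1 ^ (-expS d (aOne d a) μ) ≤ p.1 ^ (-expT d μ) + p.1 ^ (-expS d a μ) := by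
      have hT : 0 < p.1 ^ (-expT d μ) := by positivity
      rcases le_total 1 p.1 with h | h
      · have := rpow_neg_exp_anti h l1
        linarith
      · have := Real.rpow_le_rpow_of_exponent_ge hr h (neg_le_neg l2)
        linarith
    have e4 : 4 / 9 ≤ (1 + p.2) ^ (-expB d μ) := by
      calc (4 / 9 : ℝ) = (3 / 2) ^ (-2 : ℝ) := by
            rw [Real.rpow_neg (by norm_num)]; norm_num
        _ ≤ (3 / 2) ^ (-expB d μ) := Real.rpow_le_rpow_of_exponent_le (by norm_num) (by linarith)
        _ ≤ _ := rpow_neg_anti (by linarith) (by linarith) (by linarith)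
    have e5 : p.1 ^ (-expT d μ) * (4 / 9) ≤ p.1 ^ (-expT d μ) * (1 + p.2) ^ (-expB d μ) := by gcongr
    calc _ ≤ p.1 ^ (d - 3) * p.2⁻¹ *
          (M' * (p.2 * p.1 ^ (-gam d a μ) + p.2 * p.1 ^ (-gam d (aOne d a) μ))) := by gcongr
      _ = M' * (p.1 ^ (d - 3) * p.1 ^ (-gam d a μ) + p.1 ^ (d - 3) * p.1 ^ (-gam d (aOne d a) μ)) := by
          field_simp
      _ ≤ M' * (9 * (p.1 ^ (-expT d μ) * (1 + p.2) ^ (-expB d μ) + p.1 ^ (-expS d a μ))) := by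
          rw [e1, e2]
          gcongr
          linarith
      _ = 9 * M' * (p.1 ^ (-expT d μ) * (1 + p.2) ^ (-expB d μ) + p.1 ^ (-expS d a μ)) := by ring
      _ ≤ _ := by gcongr
  · have hu : Ω p ≤ M' * (p.1 ^ (-(((d : ℝ) - 1) / (d * μ))) * p.2 ^ (-(1 / (d * μ)))) :=
      hup.trans (by gcongr; exact min_le_left _ _)
    have e1 : p.1 ^ (d - 3) * p.1 ^ (-(((d : ℝ) - 1) / (d * μ))) = p.1 ^ (-expT d μ) := by
      rw [pow_sub_three hd, ← Real.rpow_add hr]; congr 1; unfold expT; ring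
    have e2 : p.2⁻¹ * p.2 ^ (-(1 / (d * μ))) = p.2 ^ (-expB d μ) := by
      rw [← Real.rpow_neg_one, ← Real.rpow_add hz]; congr 1; unfold expB; ring
    have e3 : p.2 ^ (-expB d μ) ≤ 9 * (1 + p.2) ^ (-expB d μ) := by
      calc p.2 ^ (-expB d μ) ≤ (1 / 3 * (1 + p.2)) ^ (-expB d μ) :=
            rpow_neg_anti (by positivity) (by linarith [not_lt.1 hz2]) (by linarith)
        _ = (1 / 3) ^ (-expB d μ) * (1 + p.2) ^ (-expB d μ) :=
            Real.mul_rpow (by norm_num) (by positivity)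
        _ ≤ (1 / 3) ^ (-2 : ℝ) * (1 + p.2) ^ (-expB d μ) := by
            gcongr ?_ * _
            exact Real.rpow_le_rpow_of_exponent_ge (by norm_num) (by norm_num) (by linarith)
        _ = _ := by
            rw [Real.rpow_neg (by norm_num)]; norm_num
    calc _ ≤ p.1 ^ (d - 3) * p.2⁻¹ *
          (M' * (p.1 ^ (-(((d : ℝ) - 1) / (d * μ))) * p.2 ^ (-(1 / (d * μ))))) := by gcongr
      _ = M' * ((p.1 ^ (d - 3) * p.1 ^ (-(((d : ℝ) - 1) / (d * μ)))) *
          (p.2⁻¹ * p.2 ^ (-(1 / (d * μ))))) := by ring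
      _ ≤ M' * (p.1 ^ (-expT d μ) * (9 * (1 + p.2) ^ (-expB d μ))) := by
          rw [e1, e2]
          gcongr
      _ = 9 * M' * (p.1 ^ (-expT d μ) * (1 + p.2) ^ (-expB d μ) + 0) := by ring
      _ ≤ _ := by gcongr

theorem MemB.source (hd : 3 ≤ d) (ha : ARange d a) (hμ : MuRange d a μ) (hM' : 1 < M')
    (hΩ : MemB d a μ M' Ω) :
    Source (expT d μ) (expS d a μ) (expB d μ) (9 * M' + d) (density d Ω) := by
  have hc : ContDiffOn ℝ 1 (density d Ω) quadrant := by
    unfold density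
    exact ((contDiff_fst.pow _).contDiffOn.mul (contDiff_snd.contDiffOn.inv
      fun p hp => hp.2.ne')).mul hΩ.contDiffOn
  have hpos : ∀ p ∈ quadrant, 0 < density d Ω p := fun p hp => by
    have := hp.1
    have := hp.2
    have := hΩ.pos p hp
    unfold density
    positivity
  have hd' : (3 : ℝ) ≤ d := by exact_mod_cast hd
  have hdiff : ∀ {f : ℝ × ℝ → ℝ}, ContDiffOn ℝ 1 f quadrant → ∀ {p}, p ∈ quadrant →
      DifferentiableAt ℝ f p := fun {f} hf p hp =>
    (hf.contDiffAt (quadrant_mem_nhds hp)).differentiableAt (by simp)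
  refine ⟨hc, hpos, fun p hp => hΩ.density_le hd ha hμ hM' hp, fun p hp => ?_, fun p hp => ?_⟩
  · have hr := hp.1
    have hz := hp.2
    have hΩp := hΩ.pos p hp
    obtain ⟨h1, h2⟩ := hasDerivAt_dr_of_differentiableAt (hdiff hΩ.contDiffOn hp)
    obtain ⟨h3, h4⟩ := hasDerivAt_dr_of_differentiableAt (hdiff hc hp)
    have h5 := ((hasDerivAt_pow (d - 3) p.1).mul_const p.2⁻¹).mul h1
    have h6 := h3.unique (h5.congr_of_eventuallyEq (.of_forall fun s => rfl))
    rw [Prod.mk.eta] at h6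
    rw [← h4, h6]
    have h7 : |p.1 * dr Ω p| ≤ M' * Ω p :=
      (le_add_of_nonneg_right (abs_nonneg _)).trans (hΩ.log_deriv p hp)
    rw [abs_mul, abs_of_pos hr] at h7
    have hfac : 0 < p.1 ^ (d - 3) * p.2⁻¹ := by positivity
    -- For `d = 3` the exponent `d - 3 - 1` is truncated to zero, but the coefficient in front
    -- vanishes.
    have hn : ((d - 3 : ℕ) : ℝ) * p.1 ^ (d - 3 - 1) * p.1 = ((d : ℝ) - 3) * p.1 ^ (d - 3) := by
      rcases Nat.eq_zero_or_pos (d - 3) with h | h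
      · have h' : (d : ℝ) - 3 = ((d - 3 : ℕ) : ℝ) := by rw [Nat.cast_sub hd, Nat.cast_ofNat]
        rw [h', h]; simp
      · rw [mul_assoc, ← pow_succ, Nat.sub_add_cancel h, Nat.cast_sub hd, Nat.cast_ofNat]
    have hn0 : 0 ≤ ((d - 3 : ℕ) : ℝ) * p.1 ^ (d - 3 - 1) := by positivity
    rw [← mul_assoc (9 * M' + (d : ℝ)), ← div_eq_mul_inv (_ * density d Ω p), le_div_iff₀ hr]
    refine (mul_le_mul_of_nonneg_right (abs_add_le _ _) hr.le).trans ?_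
    rw [abs_mul _ (Ω p), abs_mul _ (dr Ω p), abs_of_pos hfac, abs_of_pos hΩp,
      abs_of_nonneg (by positivity : (0 : ℝ) ≤ ((d - 3 : ℕ) : ℝ) * p.1 ^ (d - 3 - 1) * p.2⁻¹)]
    calc _ = (((d - 3 : ℕ) : ℝ) * p.1 ^ (d - 3 - 1) * p.1) * p.2⁻¹ * Ω p +
          p.1 ^ (d - 3) * p.2⁻¹ * (p.1 * |dr Ω p|) := by ring
      _ ≤ ((d : ℝ) - 3) * p.1 ^ (d - 3) * p.2⁻¹ * Ω p +
          p.1 ^ (d - 3) * p.2⁻¹ * (M' * Ω p) := by rw [hn]; gcongr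
      _ = ((d : ℝ) - 3 + M') * density d Ω p := by unfold density; ring
      _ ≤ _ := mul_le_mul_of_nonneg_right (by linarith) (hpos p hp).le
  · have hr := hp.1
    have hz := hp.2
    have hΩp := hΩ.pos p hp
    obtain ⟨h1, h2⟩ := hasDerivAt_dz_of_differentiableAt (hdiff hΩ.contDiffOn hp)
    obtain ⟨h3, h4⟩ := hasDerivAt_dz_of_differentiableAt (hdiff hc hp)
    have h5 := ((hasDerivAt_inv hz.ne').const_mul (p.1 ^ (d - 3))).mul h1
    have h6 := h3.unique (h5.congr_of_eventuallyEq (.of_forall fun s => rfl))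
    rw [Prod.mk.eta] at h6
    rw [← h4, h6]
    have h7 : |p.2 * dz Ω p| ≤ M' * Ω p :=
      (le_add_of_nonneg_left (abs_nonneg _)).trans (hΩ.log_deriv p hp)
    rw [abs_mul, abs_of_pos hz] at h7
    have hfac : 0 < p.1 ^ (d - 3) * p.2⁻¹ := by positivity
    rw [← mul_assoc (9 * M' + (d : ℝ)), ← div_eq_mul_inv (_ * density d Ω p), le_div_iff₀ hz]
    refine (mul_le_mul_of_nonneg_right (abs_add_le _ _) hz.le).trans ?_
    rw [abs_mul _ (Ω p), abs_mul _ (dz Ω p), abs_of_pos hfac, abs_of_pos hΩp, mul_neg, abs_neg,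
      abs_of_nonneg (by positivity : (0 : ℝ) ≤ p.1 ^ (d - 3) * (p.2 ^ 2)⁻¹)]
    calc _ = p.1 ^ (d - 3) * p.2⁻¹ * Ω p +
          p.1 ^ (d - 3) * p.2⁻¹ * (p.2 * |dz Ω p|) := by field_simp
      _ ≤ p.1 ^ (d - 3) * p.2⁻¹ * Ω p + p.1 ^ (d - 3) * p.2⁻¹ * (M' * Ω p) := by gcongr
      _ = (1 + M') * density d Ω p := by unfold density; ring
      _ ≤ _ := mul_le_mul_of_nonneg_right (by linarith) (hpos p hp).le

theorem MemB.le_density (hd : 3 ≤ d) (hΩ : MemB d a μ M' Ω) (r z : ℝ) (h1 : 2 < z) (h2 : z < r)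
    (h3 : r < 2 * z) : 1 / M' * (r ^ (-expT d μ) * z ^ (-expB d μ)) ≤ density d Ω (r, z) := by
  have hz : 0 < z := by linarith
  have hr : 0 < r := by linarith
  have e1 : r ^ (d - 3) * r ^ (-(((d : ℝ) - 1) / (d * μ))) = r ^ (-expT d μ) := by
    rw [pow_sub_three hd, ← Real.rpow_add hr]; congr 1; unfold expT; ring
  have e2 : z⁻¹ * z ^ (-(1 / (d * μ))) = z ^ (-expB d μ) := by
    rw [← Real.rpow_neg_one, ← Real.rpow_add hz]; congr 1; unfold expB; ring
  rw [← e1, ← e2]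
  calc _ = r ^ (d - 3) * z⁻¹ * (1 / M' * (r ^ (-(((d : ℝ) - 1) / (d * μ))) *
        z ^ (-(1 / (d * μ))))) := by ring
    _ ≤ _ := mul_le_mul_of_nonneg_left (hΩ.lower r z h1 h2 h3) (by positivity)

theorem potentialIntegrand_ae_eq (Ω : ℝ × ℝ → ℝ) (X : Space d) : potentialIntegrand d Ω X =ᵐ[volume]
    fun Y => (len (X - Y) ^ (d + 2))⁻¹ * lift (density d Ω) Y := by
  -- On the axes the values of `Ω` are uncontrolled, but the axes are a null set.
  filter_upwards [ae_mem_offAxes one_pos (0 : Space d)] with Y hY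
  rw [one_smul, zero_add] at hY
  rw [lift, indicator_of_mem hY]
  rfl

theorem MemB.integrable_and_psi0_eq (hd : 3 ≤ d) (ha : ARange d a) (hμ : MuRange d a μ)
    (hM' : 1 < M') (hΩ : MemB d a μ M' Ω) (X : Space d) :
    Integrable (potentialIntegrand d Ω X) ∧
      Psi0 d Ω X = Real.pi ^ (-(((d : ℝ) + 4) / 2)) * pot (density d Ω) X := by
  have hs := hΩ.source hd ha hμ hM'
  have he := hμ.exponents hd ha
  obtain ⟨h1, h2⟩ := integrable_newton_and_eq (hs.gaussInt_lift hd he) hs.lift_nonneg X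
    (hs.integrableOn_pot hd he X)
  refine ⟨h1.congr (potentialIntegrand_ae_eq Ω X).symm, ?_⟩
  rw [Psi0, integral_congr_ae (potentialIntegrand_ae_eq Ω X), h2, pot]

end

end

section

/-! ### Membership in the class of profiles -/

theorem one_le_jap (p : ℝ × ℝ) : 1 ≤ jap p :=
  Real.one_le_sqrt.2 (by nlinarith [sq_nonneg p.1, sq_nonneg p.2])

theorem jap_le {p : ℝ × ℝ} (hp : p ∈ closedQuadrant) : jap p ≤ 1 + p.1 + p.2 := by
  have h1 := hp.1
  have h2 := hp.2
  exact (Real.sqrt_le_left (by positivity)).2 (by nlinarith [mul_nonneg h1 h2])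

theorem le_two_mul_jap (p : ℝ × ℝ) : 1 + p.1 + p.2 ≤ 2 * jap p := by
  have h : jap p ^ 2 = 1 + p.1 ^ 2 + p.2 ^ 2 := Real.sq_sqrt (by positivity)
  have h1 := one_le_jap p
  nlinarith [sq_nonneg (p.1 - 1), sq_nonneg (p.2 - 1), sq_nonneg (p.1 - p.2),
    sq_nonneg (1 + p.1 + p.2 - 2 * jap p)]

theorem jap₁_pos (z : ℝ) : 0 < jap₁ z := Real.sqrt_pos.2 (by positivity)

theorem jap₁_le {z : ℝ} (hz : 0 ≤ z) : jap₁ z ≤ 1 + z :=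
  (Real.sqrt_le_left (by positivity)).2 (by nlinarith)

theorem half_jap_rpow_le {p : ℝ × ℝ} (hp : p ∈ closedQuadrant) {σ : ℝ} (h0 : 0 ≤ σ) (h1 : σ ≤ 1) :
    1 / 2 * jap p ^ (-σ) ≤ (1 + p.1 + p.2) ^ (-σ) := by
  have hj := one_le_jap p
  have hp1 := hp.1
  have hp2 := hp.2
  calc 1 / 2 * jap p ^ (-σ) ≤ 2 ^ (-σ) * jap p ^ (-σ) := by
        gcongr
        calc (1 / 2 : ℝ) = 2 ^ (-1 : ℝ) := by rw [Real.rpow_neg_one]; norm_num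
          _ ≤ _ := Real.rpow_le_rpow_of_exponent_le (by norm_num) (by linarith)
    _ = (2 * jap p) ^ (-σ) := (Real.mul_rpow (by norm_num) (by linarith)).symm
    _ ≤ _ := rpow_neg_anti (by linarith) (le_two_mul_jap p) h0

theorem dr_const_mul (k : ℝ) (f : ℝ × ℝ → ℝ) : dr (fun p => k * f p) = fun p => k * dr f p :=
  funext fun _ => deriv_const_mul_field k

theorem dz_const_mul (k : ℝ) (f : ℝ × ℝ → ℝ) : dz (fun p => k * f p) = fun p => k * dz f p :=
  funext fun _ => deriv_const_mul_field k

theorem gradNorm_le (f : ℝ × ℝ → ℝ) (p : ℝ × ℝ) : gradNorm f p ≤ |dr f p| + |dz f p| := by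
  refine (Real.sqrt_le_left (by positivity)).2 ?_
  nlinarith [sq_abs (dr f p), sq_abs (dz f p), mul_nonneg (abs_nonneg (dr f p)) (abs_nonneg (dz f p))]

theorem hessNorm_le {f : ℝ × ℝ → ℝ} {p : ℝ × ℝ} {B : ℝ} (h1 : |dr (dr f) p| ≤ B)
    (h2 : |dr (dz f) p| ≤ B) (h3 : |dz (dr f) p| ≤ B) (h4 : |dz (dz f) p| ≤ B) :
    hessNorm f p ≤ 2 * B := by
  have hB : 0 ≤ B := (abs_nonneg _).trans h1
  refine (Real.sqrt_le_left (by positivity)).2 ?_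
  have := sq_le_sq' (abs_le.1 h1).1 (abs_le.1 h1).2
  have := sq_le_sq' (abs_le.1 h2).1 (abs_le.1 h2).2
  have := sq_le_sq' (abs_le.1 h3).1 (abs_le.1 h3).2
  have := sq_le_sq' (abs_le.1 h4).1 (abs_le.1 h4).2
  nlinarith

/-- Quantitative bounds for a radial potential. -/
structure RadialBounds (K L t s β : ℝ) (f : ℝ × ℝ → ℝ) : Prop where
  upper : ∀ p ∈ closedQuadrant, f p ≤ K / (t + β - 2) * (1 + p.1 + p.2) ^ (2 - t - β)
  lower : ∀ p ∈ closedQuadrant, L / (t + β - 2) * (1 + p.1 + p.2) ^ (2 - t - β) ≤ f p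
  le_zero : ∀ p ∈ closedQuadrant, f p ≤ f (0, 0) + K
  dr_le : ∀ p ∈ quadrant, |dr f p| ≤ K * (1 + p.1 + p.2) ^ (1 - t - β)
  grad_le : ∀ p ∈ quadrant, |dr f p| + |dz f p| ≤
    K * ((1 + p.1 + p.2) ^ (-t) * (1 + p.2) ^ (1 - β))
  hess_le : ∀ p ∈ quadrant, hessNorm f p ≤ K * hessWeight t s β p

/-- The constants depend only on `d`, `θ`, `C` and `c`, not on the source or its exponents; they
therefore stay fixed while `t + β - 2` is sent to zero. -/
theorem exists_radialBounds {d : ℕ} (hd : 3 ≤ d) {θ C c : ℝ} (hθ : 0 < θ) (hC : 1 ≤ C) (hc : 0 < c) :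
    ∃ K L : ℝ, 0 < K ∧ 0 < L ∧ ∀ {t s β : ℝ} {w : ℝ × ℝ → ℝ}, Exponents θ t s β → Source t s β C w →
      (∀ r z : ℝ, 2 < z → z < r → r < 2 * z → c * (r ^ (-t) * z ^ (-β)) ≤ w (r, z)) →
      RadialBounds K L t s β (radial d w) := by
  obtain ⟨K₁, hK₁, h₁⟩ := exists_pot_le (d := d) hd hθ
  obtain ⟨K₂, hK₂, h₂⟩ := exists_le_pot (d := d) hd
  obtain ⟨K₃, hK₃, h₃⟩ := exists_pot_sub_le (d := d) hd hθ
  obtain ⟨K₄, hK₄, h₄⟩ := exists_abs_potOne_radial_le (d := d) hd hθ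
  obtain ⟨K₅, hK₅, h₅⟩ := exists_abs_potOne_le (d := d) hd hθ
  obtain ⟨K₆, hK₆, h₆⟩ := exists_abs_radialTwo_le (d := d) hd hθ
  have hC0 : 0 < C := by linarith
  obtain ⟨K, hK⟩ : ∃ K, K = K₁ * C + K₃ * C + K₄ * (C * C) + 2 * (K₅ * C) + 2 * (K₆ * (C * C)) :=
    ⟨_, rfl⟩
  have q₁ : 0 < K₁ * C := by positivity
  have q₃ : 0 < K₃ * C := by positivity
  have q₄ : 0 < K₄ * (C * C) := by positivity
  have q₅ : 0 < K₅ * C := by positivity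
  have q₆ : 0 < K₆ * (C * C) := by positivity
  refine ⟨K, K₂ * c, by rw [hK]; positivity, by positivity, fun {t s β w} he hw hlow => ?_⟩
  have hσ : 0 < t + β - 2 := by linarith [he.sum_gt]
  have n1 : ∀ p ∈ closedQuadrant, ‖(ray p : Space d).1‖ = p.1 := fun p hp => by
    rw [norm_ray_fst, abs_of_nonneg hp.1]
  have n2 : ∀ p ∈ closedQuadrant, ‖(ray p : Space d).2‖ = p.2 := fun p hp => by
    rw [norm_ray_snd, abs_of_nonneg hp.2]
  have hρ : ∀ p ∈ closedQuadrant, 0 < 1 + p.1 + p.2 := fun p hp => by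
    linarith [hp.1, hp.2]
  refine ⟨fun p hp => ?_, fun p hp => ?_, fun p hp => ?_, fun p hp => ?_, fun p hp => ?_, fun p hp => ?_⟩
  · have h := h₁ he hw (ray p)
    rw [n1 p hp, n2 p hp] at h
    have := hρ p hp
    refine h.trans ?_
    gcongr
    linarith
  · have h := h₂ he hw hc.le hlow (ray p)
    rwa [n1 p hp, n2 p hp] at h
  · have h := h₃ he hw (ray p)
    have e : (ray (0, 0) : Space d) = 0 := by simp [ray]
    rw [← e] at h
    exact h.trans (by unfold radial; linarith)
  · have hp' := quadrant_subset hp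
    have h := h₄ he hw (subUnit_basisVec (.inl 0)) rfl (ray p)
    rw [n1 p hp', n2 p hp'] at h
    rw [hw.dr_radial hd he]
    have := hρ p hp'
    refine h.trans ?_
    gcongr
    linarith
  · have hp' := quadrant_subset hp
    have h := h₅ he hw (subUnit_basisVec (.inl 0)) (ray p)
    have h' := h₅ he hw (subUnit_basisVec (.inr 0)) (ray p)
    rw [n1 p hp', n2 p hp'] at h h'
    rw [hw.dr_radial hd he, hw.dz_radial hd he]
    have := hρ p hp'
    have := hp.2
    refine (add_le_add h h').trans ?_
    rw [← add_mul]
    gcongr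
    linarith
  · have b := fun i j hi hj => h₆ he hw hC hp (i := i) (j := j) hi hj
    have hH := hessWeight_nonneg (t := t) (s := s) (β := β) hp
    refine (hessNorm_le (B := K₆ * (C * C) * hessWeight t s β p) ?_ ?_ ?_ ?_).trans ?_
    · rw [hw.dr_radial hd he, hw.dr_radialOne hd he _ hp]
      exact b _ _ (.inl rfl) (.inl rfl)
    · rw [hw.dz_radial hd he, hw.dr_radialOne hd he _ hp]
      exact b _ _ (.inr rfl) (.inl rfl)
    · rw [hw.dr_radial hd he, hw.dz_radialOne hd he _ hp]
      exact b _ _ (.inl rfl) (.inr rfl)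
    · rw [hw.dz_radial hd he, hw.dz_radialOne hd he _ hp]
      exact b _ _ (.inr rfl) (.inr rfl)
    · rw [← mul_assoc]
      gcongr
      linarith

theorem gradNorm_const_mul {k : ℝ} (hk : 0 ≤ k) (f : ℝ × ℝ → ℝ) (p : ℝ × ℝ) :
    gradNorm (fun p => k * f p) p = k * gradNorm f p := by
  rw [gradNorm, gradNorm, dr_const_mul, dz_const_mul, ← Real.sqrt_sq hk, ← Real.sqrt_mul (sq_nonneg _),
    Real.sqrt_sq hk]
  congr 1
  ring

theorem hessNorm_const_mul {k : ℝ} (hk : 0 ≤ k) (f : ℝ × ℝ → ℝ) (p : ℝ × ℝ) :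
    hessNorm (fun p => k * f p) p = k * hessNorm f p := by
  rw [hessNorm, hessNorm]
  simp only [dr_const_mul, dz_const_mul]
  nth_rewrite 5 [← Real.sqrt_sq hk]
  rw [← Real.sqrt_mul (sq_nonneg _)]
  congr 1
  ring

section

variable {d : ℕ} {a μ M' K L : ℝ} {f : ℝ × ℝ → ℝ}

theorem RadialBounds.pos {t s β : ℝ} (hb : RadialBounds K L t s β f) (hL : 0 < L) (hσ : 2 < t + β)
    {p : ℝ × ℝ} (hp : p ∈ closedQuadrant) : 0 < f p := by
  have h1 : 0 < 1 + p.1 + p.2 := by linarith [hp.1, hp.2]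
  have h2 : 0 < t + β - 2 := by linarith
  exact lt_of_lt_of_le (by positivity) (hb.lower p hp)

theorem zero_mem_closedQuadrant : ((0, 0) : ℝ × ℝ) ∈ closedQuadrant := ⟨le_rfl, le_rfl⟩

/-- The smallness condition says that `L/σ` exceeds `40K`, so `f` is at least `40K (1+r+z)^{-σ}`,
while the derivatives are of size `K` times the required weights. Its second summand does the same
for the bound by `a₁`. -/
theorem RadialBounds.memA0 (hd : 3 ≤ d) (ha : ARange d a) (hμ : MuRange d a μ) (hK : 0 < K)
    (hL : 0 < L) (hb : RadialBounds K L (expT d μ) (expS d a μ) (expB d μ) f)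
    (hc : ContinuousOn f closedQuadrant) (hc2 : ContDiffOn ℝ 2 f quadrant)
    (hsmall : (1 / μ - ((d : ℝ) - 2)) * (40 * K + a * K / (aOne d a - a)) ≤ L) :
    MemA0 d a μ (fun p => a / f (0, 0) * f p) := by
  obtain ⟨b1, b2, b3, b4, b5, b6, b7, b8⟩ := hμ.bounds hd ha
  obtain ⟨h0, h1, h2, h3, h4, h5, h6, h7⟩ := hμ.exponents hd ha
  have hT := expT_add_expB hd b8
  obtain ⟨σ, hσ⟩ : ∃ σ, σ = 1 / μ - ((d : ℝ) - 2) := ⟨_, rfl⟩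
  rw [← hσ] at hT hsmall
  have hσ0 : 0 < σ := by linarith
  have hσ1 : σ ≤ 1 := by linarith
  have hpos : ∀ p ∈ closedQuadrant, 0 < f p := fun p hp => hb.pos hL h6 hp
  have hf0 := hpos _ zero_mem_closedQuadrant
  have hk : 0 < a / f (0, 0) := by positivity
  have hA : 0 < a * K / (aOne d a - a) := div_pos (by positivity) (by linarith)
  have hs1 : σ * (40 * K) ≤ L := le_trans (by gcongr; linarith) hsmall
  have hs2 : σ * (a * K / (aOne d a - a)) ≤ L := le_trans (by gcongr; linarith) hsmall
  have hKL : 40 * K ≤ L / σ := by rw [le_div_iff₀ hσ0]; linarith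
  -- The constant 40 leaves room for the required `1/10`, a factor two from replacing `1+r+z` by the
  -- bracket, and a factor two from the bracket inside the unit ball.
  have hlow : ∀ p ∈ closedQuadrant, 40 * K * (1 + p.1 + p.2) ^ (-σ) ≤ f p := fun p hp => by
    have h := hb.lower p hp
    have e : 2 - expT d μ - expB d μ = -σ := by linarith
    rw [hT, e] at h
    have : 0 < 1 + p.1 + p.2 := by linarith [hp.1, hp.2]
    exact le_trans (by gcongr) h
  refine ⟨continuousOn_const.mul hc, contDiffOn_const.mul hc2, ?_, fun p hp => ?_, fun p hp => ?_,
    fun p hp => ?_, fun p hp => ?_, fun p hp => ?_⟩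
  · field_simp
  · have := hpos p hp
    positivity
  · have h := hb.le_zero p hp
    have h8 := hb.lower _ zero_mem_closedQuadrant
    simp only [add_zero, Real.one_rpow, mul_one] at h8
    rw [hT] at h8
    rw [div_mul_eq_mul_div, div_le_iff₀ hf0]
    -- Since `f ≤ f(0,0) + K`, the bound by `a₁` means that `aK` fits into the gap `(a₁ - a)
    -- f(0,0)`, and `f(0,0) ≥ L/σ` is large.
    have h9 : a * K ≤ (aOne d a - a) * f (0, 0) := by
      rw [mul_div_assoc', div_le_iff₀ (by linarith)] at hs2
      have h10 : L ≤ f (0, 0) * σ := by rwa [div_le_iff₀ hσ0] at h8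
      have h11 : L * (aOne d a - a) ≤ f (0, 0) * σ * (aOne d a - a) := by
        gcongr
      refine le_of_mul_le_mul_left ?_ hσ0
      linarith
    have h12 : a * f p ≤ a * (f (0, 0) + K) := by gcongr
    linarith
  · have hp' := quadrant_subset hp
    have hr := hp.1
    have hz := hp.2
    rw [gradNorm_const_mul hk.le, mul_left_comm]
    refine mul_le_mul_of_nonneg_left ?_ hk.le
    have hj := one_le_jap p
    have hj1 := jap₁_pos p.2
    -- The power `-t` splits into the weight of the gradient bound and `-σ`, and the latter is
    -- absorbed by the lower bound of `f`.
    have e1 : -expT d μ = -(1 - 1 / (d * μ)) + -σ := by unfold expB at hT; linarith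
    have e2 : 1 - expB d μ = -(1 / (d * μ)) := by unfold expB; ring
    have hq : 0 ≤ 1 / ((d : ℝ) * μ) := by positivity
    have hq1 : 1 / ((d : ℝ) * μ) ≤ 1 := by unfold expB at h5; linarith
    have hρ : 0 < 1 + p.1 + p.2 := by linarith
    have c1 : (1 + p.1 + p.2) ^ (-(1 - 1 / (d * μ))) ≤ jap p ^ (-1 + 1 / (d * μ)) := by
      have e3 : -1 + 1 / ((d : ℝ) * μ) = -(1 - 1 / (d * μ)) := by ring
      rw [e3]
      exact rpow_neg_anti (by linarith) (jap_le hp') (by linarith)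
    have c2 : (1 + p.2) ^ (-(1 / (d * μ))) ≤ jap₁ p.2 ^ (-(1 / (d * μ))) :=
      rpow_neg_anti hj1 (jap₁_le hz.le) hq
    have g := (gradNorm_le f p).trans (hb.grad_le p hp)
    rw [e1, e2, Real.rpow_add hρ] at g
    have hfl := hlow p hp'
    have hρσ : 0 < K * (1 + p.1 + p.2) ^ (-σ) := by positivity
    calc _ ≤ _ := g
      _ = (1 + p.1 + p.2) ^ (-(1 - 1 / (d * μ))) * (1 + p.2) ^ (-(1 / (d * μ))) *
          (K * (1 + p.1 + p.2) ^ (-σ)) := by ring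
      _ ≤ jap p ^ (-1 + 1 / (d * μ)) * jap₁ p.2 ^ (-(1 / (d * μ))) * (1 / 10 * f p) := by
          have hj0 : 0 < jap p := by linarith
          exact mul_le_mul (mul_le_mul c1 c2 (by positivity) (by positivity)) (by linarith)
            (by positivity) (by positivity)
      _ = _ := by ring
  · have hp' := quadrant_subset hp
    have hr := hp.1
    have hz := hp.2
    rw [dr_const_mul]
    simp only
    rw [mul_left_comm, abs_mul, abs_of_pos hk, mul_left_comm]
    refine mul_le_mul_of_nonneg_left ?_ hk.le
    have hj := one_le_jap p
    have hρ : 0 < 1 + p.1 + p.2 := by linarith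
    have e1 : 1 - expT d μ - expB d μ = -1 + -σ := by linarith
    have g := hb.dr_le p hp
    rw [e1, Real.rpow_add hρ, Real.rpow_neg_one] at g
    rw [abs_mul, abs_of_pos (by linarith : 0 < jap p)]
    have hfl := hlow p hp'
    have hρσ : 0 < K * (1 + p.1 + p.2) ^ (-σ) := by positivity
    calc _ ≤ (1 + p.1 + p.2) * (K * ((1 + p.1 + p.2)⁻¹ * (1 + p.1 + p.2) ^ (-σ))) := by
          gcongr
          exact jap_le hp'
      _ = K * (1 + p.1 + p.2) ^ (-σ) := by field_simp
      _ ≤ _ := by linarith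
  · have hp' := quadrant_subset hp
    have hr := hp.1
    have hz := hp.2
    rw [hessNorm_const_mul hk.le, mul_left_comm]
    refine mul_le_mul_of_nonneg_left ?_ hk.le
    have hj := one_le_jap p
    have hj0 : 0 < jap p := by linarith
    have hj1 := jap₁_pos p.2
    have e1 : 2 - (d : ℝ) + 1 / μ = σ := by linarith
    have e2 : (d : ℝ) - 3 - ((d : ℝ) - 1) / (d * μ) = -expT d μ := by unfold expT; ring
    have e3 : -1 - 1 / ((d : ℝ) * μ) = -expB d μ := by unfold expB; ring
    have e4 : (d : ℝ) - 3 - gam d a μ = -expS d a μ := by unfold expS; ring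
    rw [e1, e2, e3, e4]
    refine (hb.hess_le p hp).trans ?_
    have hfl : 20 * K * jap p ^ (-σ) ≤ f p := by
      have := mul_le_mul_of_nonneg_left (half_jap_rpow_le hp' hσ0.le hσ1)
        (by positivity : 0 ≤ 40 * K)
      linarith [hlow p hp']
    have hfp := hpos p hp'
    have c2 : (1 + p.2) ^ (-expB d μ) ≤ jap₁ p.2 ^ (-expB d μ) :=
      rpow_neg_anti hj1 (jap₁_le hz.le) (by linarith)
    have hcan : jap p ^ σ * jap p ^ (-σ) = 1 := by
      rw [← Real.rpow_add hj0, add_neg_cancel, Real.rpow_zero]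
    have hrT : 0 < p.1 ^ (-expT d μ) := by positivity
    have hjB : 0 < jap₁ p.2 ^ (-expB d μ) := by positivity
    have hmain : K * (p.1 ^ (-expT d μ) * (1 + p.2) ^ (-expB d μ)) ≤
        1 / 10 * (jap p ^ σ * p.1 ^ (-expT d μ) * jap₁ p.2 ^ (-expB d μ)) * f p := by
      have hjσ : 0 < jap p ^ σ := by positivity
      calc _ ≤ K * (p.1 ^ (-expT d μ) * jap₁ p.2 ^ (-expB d μ)) := by gcongr
        _ ≤ 2 * (K * (p.1 ^ (-expT d μ) * jap₁ p.2 ^ (-expB d μ))) := by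
            have : 0 < K * (p.1 ^ (-expT d μ) * jap₁ p.2 ^ (-expB d μ)) := by positivity
            linarith
        _ = 1 / 10 * (jap p ^ σ * p.1 ^ (-expT d μ) * jap₁ p.2 ^ (-expB d μ)) *
            (20 * K * jap p ^ (-σ)) := by
            linear_combination (-2 * K * p.1 ^ (-expT d μ) * jap₁ p.2 ^ (-expB d μ)) * hcan
        _ ≤ _ := by gcongr
    unfold hessWeight
    split_ifs with hin
    · have hj2 : jap p ≤ 2 := by
        refine (Real.sqrt_le_left (by norm_num)).2 ?_
        linarith
      have hjs : 1 / 2 ≤ jap p ^ (-σ) := by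
        calc (1 / 2 : ℝ) = 2 ^ (-1 : ℝ) := by rw [Real.rpow_neg_one]; norm_num
          _ ≤ 2 ^ (-σ) := Real.rpow_le_rpow_of_exponent_le (by norm_num) (by linarith)
          _ ≤ _ := rpow_neg_anti hj0 hj2 hσ0.le
      have hS : 0 < p.1 ^ (-expS d a μ) := by positivity
      have hKf : K ≤ 1 / 10 * f p := by
        have : 20 * K * (1 / 2) ≤ 20 * K * jap p ^ (-σ) := by gcongr
        linarith
      have := mul_le_mul_of_nonneg_right hKf hS.le
      linarith
    · rw [add_zero, add_zero]
      exact hmain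

end

end

/-! ### The normalized potential as a decaying solution. -/

section

section

variable {d : ℕ} {a μ M' K L : ℝ} {Ω : ℝ × ℝ → ℝ}

/-- The normalized potential. -/
noncomputable def profile (d : ℕ) (a : ℝ) (Ω : ℝ × ℝ → ℝ) (p : ℝ × ℝ) : ℝ :=
  a / radial d (density d Ω) (0, 0) * radial d (density d Ω) p

theorem pot_zero (w : ℝ × ℝ → ℝ) : pot w (0 : Space d) = radial d w (0, 0) := by
  rw [pot_eq_radial]; simp

theorem MemB.profile_eq (hd : 3 ≤ d) (ha : ARange d a) (hμ : MuRange d a μ) (hM' : 1 < M')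
    (hΩ : MemB d a μ M' Ω) (X : Space d) :
    profile d a Ω (‖X.1‖, ‖X.2‖) = a / normalization d Ω * Psi0 d Ω X := by
  rw [normalization, (hΩ.integrable_and_psi0_eq hd ha hμ hM' X).2,
    (hΩ.integrable_and_psi0_eq hd ha hμ hM' 0).2, profile, pot_zero, ← pot_eq_radial]
  have : 0 < Real.pi ^ (-(((d : ℝ) + 4) / 2)) := Real.rpow_pos_of_pos Real.pi_pos _
  rw [mul_comm _ (radial d _ _), ← div_div, div_mul_eq_mul_div, div_mul_eq_mul_div,
    div_mul_eq_mul_div]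
  field_simp

theorem MemB.isDecayingSolution (hd : 3 ≤ d) (ha : ARange d a) (hμ : MuRange d a μ) (hM' : 1 < M')
    (hΩ : MemB d a μ M' Ω) (hL : 0 < L) (hb : RadialBounds K L (expT d μ) (expS d a μ) (expB d μ)
      (radial d (density d Ω))) : IsDecayingSolution d a Ω (profile d a Ω) := by
  have hs := hΩ.source hd ha hμ hM'
  have he := hμ.exponents hd ha
  have hσ := he.sum_gt
  refine ⟨(contDiff_const.mul (hs.contDiff_radial hd he)).contDiffOn,
    contDiffOn_const.mul (hs.contDiffOn_radial hd he), fun r z hr hz => ?_, ?_⟩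
  · have hp : ((r, z) : ℝ × ℝ) ∈ quadrant := ⟨hr, hz⟩
    have heq := hs.radial_equation hd he hp
    have e1 : dr (profile d a Ω) = fun p => a / radial d (density d Ω) (0, 0) *
        radialOne (d := d) (density d Ω) (.inl 0) p := by
      rw [← hs.dr_radial hd he]
      exact dr_const_mul _ _
    have e2 : dz (profile d a Ω) = fun p => a / radial d (density d Ω) (0, 0) *
        radialOne (d := d) (density d Ω) (.inr 0) p := by
      rw [← hs.dz_radial hd he]
      exact dz_const_mul _ _
    rw [e1, e2, dr_const_mul, dz_const_mul]
    beta_reduce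
    rw [hs.dr_radialOne hd he _ hp, hs.dz_radialOne hd he _ hp, normalization,
      (hΩ.integrable_and_psi0_eq hd ha hμ hM' 0).2, pot_zero, Real.rpow_neg Real.pi_pos.le]
    have hπ : 0 < Real.pi ^ (((d : ℝ) + 4) / 2) := Real.rpow_pos_of_pos Real.pi_pos _
    have h0 := hb.pos hL hσ zero_mem_closedQuadrant
    simp only [density] at heq
    -- The factor `π^{(d+4)/2}` on the right of the Poisson equation is exactly the ratio between
    -- the radial potential at the origin and `normalization`.
    have key := congrArg (fun x => a / radial d (density d Ω) (0, 0) * x) heq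
    rw [mul_add, mul_add, mul_add] at key
    calc _ = _ := by ring
      _ = _ := key
      _ = _ := by field_simp
  · have h0 := hb.pos hL hσ zero_mem_closedQuadrant
    obtain ⟨b1, -⟩ := hμ.bounds hd ha
    have hk : 0 < a / radial d (density d Ω) (0, 0) := by positivity
    have h1 : Tendsto (fun x : ℝ => a / radial d (density d Ω) (0, 0) *
        (K / (expT d μ + expB d μ - 2) * (1 + x) ^ (-(expT d μ + expB d μ - 2)))) atTop (𝓝 0) := by
      have := (((tendsto_rpow_neg_atTop (by linarith : 0 < expT d μ + expB d μ - 2)).comp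
        (tendsto_atTop_add_const_left atTop (1 : ℝ) tendsto_id)).const_mul
        (K / (expT d μ + expB d μ - 2))).const_mul (a / radial d (density d Ω) (0, 0))
      simpa using this
    have h2 : Tendsto (fun p : ℝ × ℝ => a / radial d (density d Ω) (0, 0) *
        (K / (expT d μ + expB d μ - 2) * (1 + (p.1 + p.2)) ^ (-(expT d μ + expB d μ - 2))))
        (comap (fun p : ℝ × ℝ => p.1 + p.2) atTop ⊓ 𝓟 closedQuadrant) (𝓝 0) :=
      h1.comp (tendsto_comap.mono_left inf_le_left)
    refine squeeze_zero' ?_ ?_ h2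
    · filter_upwards [mem_inf_of_right (mem_principal_self closedQuadrant)] with p hp
      exact mul_nonneg hk.le (hb.pos hL hσ hp).le
    · filter_upwards [mem_inf_of_right (mem_principal_self closedQuadrant)] with p hp
      refine mul_le_mul_of_nonneg_left ?_ hk.le
      have := hb.upper p hp
      rwa [add_assoc, sub_sub, ← neg_sub (expT d μ + expB d μ)] at this

theorem jap_radii (X : Space d) : √(1 + len X ^ 2) = jap (‖X.1‖, ‖X.2‖) := by
  rw [len_sq, jap, sqLen, ← add_assoc]

/-- Two-sided bounds by powers of the bracket. -/
theorem RadialBounds.bracket {t s β : ℝ} {f : ℝ × ℝ → ℝ} (hb : RadialBounds K L t s β f)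
    (hK : 0 < K) (hL : 0 < L) (hσ : 2 < t + β) (hσ1 : t + β ≤ 3) {p : ℝ × ℝ}
    (hp : p ∈ closedQuadrant) : L / 2 / (t + β - 2) * jap p ^ (-(t + β - 2)) ≤ f p ∧
      f p ≤ K / (t + β - 2) * jap p ^ (-(t + β - 2)) := by
  have h1 := hb.lower p hp
  have h2 := hb.upper p hp
  have hj := one_le_jap p
  have e : 2 - t - β = -(t + β - 2) := by ring
  rw [e] at h1 h2
  have hσ0 : 0 < t + β - 2 := by linarith
  constructor
  · refine le_trans ?_ h1
    have h3 := mul_le_mul_of_nonneg_left (half_jap_rpow_le hp hσ0.le (by linarith))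
      (by positivity : 0 ≤ L / (t + β - 2))
    refine le_trans (le_of_eq ?_) h3
    ring
  · refine h2.trans ?_
    have h3 : (1 + p.1 + p.2) ^ (-(t + β - 2)) ≤ jap p ^ (-(t + β - 2)) :=
      rpow_neg_anti (by linarith) (jap_le hp) hσ0.le
    gcongr

end

end

end EulerProfile

theorem proposition2p5 (d : ℕ) (hd : 3 ≤ d) (a : ℝ) (ha : ARange d a) (M' : ℝ) (hM' : 1 < M') :
    ∃ M'' μ₀ : ℝ, 1 < M'' ∧ muLow d a < μ₀ ∧ μ₀ < 1 / ((d : ℝ) - 2) ∧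
      ∀ μ : ℝ, MuRange d a μ → ∀ Ω : ℝ × ℝ → ℝ, MemB d a μ M' Ω →
        -- the potential is well defined, with the two-sided bounds that `M''` stands for
        (∀ X : Space d, Integrable (potentialIntegrand d Ω X)
          ∧ 1 / (M'' * (1 - μ * ((d : ℝ) - 2))) * √(1 + len X ^ 2) ^ ((d : ℝ) - 2 - 1 / μ)
              ≤ Psi0 d Ω X
          ∧ Psi0 d Ω X
              ≤ M'' / (1 - μ * ((d : ℝ) - 2)) * √(1 + len X ^ 2) ^ ((d : ℝ) - 2 - 1 / μ)) ∧
        ∃ ψ : ℝ × ℝ → ℝ,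
          -- existence
          IsDecayingSolution d a Ω ψ ∧
          -- uniqueness on the closed quadrant
          (∀ φ : ℝ × ℝ → ℝ, IsDecayingSolution d a Ω φ → EqOn φ ψ closedQuadrant) ∧
          -- `ψ = (a / 𝔐(Ω)) ψ₀`, where `Ψ₀(x, y) = ψ₀(|x|, |y|)`
          (∀ X : Space d, ψ (‖X.1‖, ‖X.2‖) = a / normalization d Ω * Psi0 d Ω X) ∧
          (μ₀ < μ → MemA d a μ (2 * M'' ^ 2) ψ) := by
  have hd' : (3 : ℝ) ≤ d := by exact_mod_cast hd
  obtain ⟨K, L, hK, hL, hKL⟩ := exists_radialBounds (d := d) hd (θ := 1 / (4 * (d : ℝ)))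
    (C := 9 * M' + d) (c := 1 / M') (by positivity) (by linarith) (by positivity)
  obtain ⟨c1, c2, c3, c4, c5⟩ := muLow_chain hd ha
  have ha0 : 0 < a := lt_trans (div_pos four_pos (mul_pos (by linarith) (by linarith))) ha.1
  have ha1 : a < aOne d a := lt_of_mul_lt_mul_left c3 (by linarith)
  obtain ⟨P, hP⟩ : ∃ P, P = Real.pi ^ (-(((d : ℝ) + 4) / 2)) := ⟨_, rfl⟩
  have hP0 : 0 < P := by rw [hP]; exact Real.rpow_pos_of_pos Real.pi_pos _
  -- `P K` serves the upper bound of `Ψ₀` and `2d/(PL)` the lower one; `K/L` and `K/(aL)` serve the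
  -- upper and lower bounds of `ψ`, where upper and lower bounds of the potential are divided by
  -- each other.
  obtain ⟨M'', hM⟩ : ∃ M'', M'' = 1 + P * K + 2 * d / (P * L) + K / L + K / (a * L) := ⟨_, rfl⟩
  have m1 : 0 < P * K := by positivity
  have m2 : 0 < 2 * d / (P * L) := by positivity
  have m3 : 0 < K / L := by positivity
  have m4 : 0 < K / (a * L) := by positivity
  obtain ⟨J, hJ⟩ : ∃ J, J = 40 * K + a * K / (aOne d a - a) := ⟨_, rfl⟩
  have hJ0 : 0 < J := by
    have : 0 < a * K / (aOne d a - a) := div_pos (by positivity) (by linarith)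
    rw [hJ]; linarith
  have hM1 : 1 < M'' := by rw [hM]; linarith
  have hM0 : 0 < M'' := by linarith
  have hMsq : M'' ≤ M'' ^ 2 := by nlinarith
  -- The first entry is the threshold beyond which `σ J ≤ L`, the smallness condition for
  -- membership; the midpoint merely ensures that `μ₀` lies above `muLow`.
  refine ⟨M'', max (1 / ((d : ℝ) - 2 + L / J)) ((muLow d a + 1 / ((d : ℝ) - 2)) / 2), hM1,
    lt_max_of_lt_right (by linarith), max_lt ?_ (by linarith), ?_⟩
  · exact one_div_lt_one_div_of_lt (by linarith) (by linarith [div_pos hL hJ0])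
  intro μ hμ Ω hΩ
  have hs := hΩ.source hd ha hμ hM'
  have he := hμ.exponents hd ha
  obtain ⟨b1, b2, b3, b4, b5, b6, b7, b8⟩ := hμ.bounds hd ha
  have hb := hKL he hs (hΩ.le_density hd)
  have hT := expT_add_expB hd b8
  obtain ⟨σ, hσ⟩ : ∃ σ, σ = 1 / μ - ((d : ℝ) - 2) := ⟨_, rfl⟩
  rw [← hσ] at hT
  have hσ0 : 0 < σ := by linarith [he.sum_gt]
  have e1 : (d : ℝ) - 2 - 1 / μ = -σ := by rw [hσ]; ring
  -- The stated factor and `σ` differ by `μ`, which lies between `1/d` and `1`.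
  have e2 : 1 - μ * ((d : ℝ) - 2) = μ * σ := by rw [hσ]; field_simp
  have hμd : 1 ≤ d * μ := by
    rw [← div_le_iff₀' (by linarith)]
    linarith
  have hμ1 : μ ≤ 1 := by
    have : 1 / ((d : ℝ) - 2) ≤ 1 := by rw [div_le_one (by linarith)]; linarith
    linarith
  have hbr := fun p hp => hb.bracket hK hL he.sum_gt he.sum_le (p := p) hp
  rw [hT] at hbr
  have hjpos : ∀ p : ℝ × ℝ, 0 < jap p ^ (-σ) := fun p =>
    Real.rpow_pos_of_pos (by linarith [one_le_jap p]) _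
  refine ⟨fun X => ?_, profile d a Ω, hΩ.isDecayingSolution hd ha hμ hM' hL hb,
    fun φ hφ => eqOn_of_isDecayingSolution (by omega) hφ
      (hΩ.isDecayingSolution hd ha hμ hM' hL hb),
    hΩ.profile_eq hd ha hμ hM', fun hμ₀ => ?_⟩
  · obtain ⟨i1, i2⟩ := hΩ.integrable_and_psi0_eq hd ha hμ hM' X
    obtain ⟨l1, l2⟩ := hbr (‖X.1‖, ‖X.2‖) ⟨norm_nonneg _, norm_nonneg _⟩
    have hj := hjpos (‖X.1‖, ‖X.2‖)
    rw [← hP] at i2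
    rw [jap_radii, i2, pot_eq_radial, e1, e2]
    refine ⟨i1, ?_, ?_⟩
    · calc _ ≤ P * (L / 2 / σ * jap (‖X.1‖, ‖X.2‖) ^ (-σ)) := ?_
        _ ≤ _ := by gcongr
      rw [← mul_assoc P]
      refine mul_le_mul_of_nonneg_right ?_ hj.le
      rw [div_le_iff₀ (by positivity)]
      have h1 : 2 * d / (P * L) ≤ M'' := by rw [hM]; linarith
      rw [div_le_iff₀ (by positivity)] at h1
      have h2 : 2 * d * μ ≤ M'' * (P * L) * μ := by gcongr
      calc (1 : ℝ) ≤ M'' * (P * L) * μ / 2 := by linarith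
        _ = _ := by field_simp
    · calc _ ≤ P * (K / σ * jap (‖X.1‖, ‖X.2‖) ^ (-σ)) := by gcongr
        _ ≤ _ := ?_
      rw [← mul_assoc P]
      refine mul_le_mul_of_nonneg_right ?_ hj.le
      rw [le_div_iff₀ (by positivity)]
      calc P * (K / σ) * (μ * σ) = P * K * μ := by field_simp
        _ ≤ P * K * 1 := by gcongr
        _ ≤ M'' := by rw [hM]; linarith
  · have hμ₁ := lt_of_le_of_lt (le_max_left _ _) hμ₀
    have hσJ : σ * J ≤ L := by
      rw [← le_div_iff₀ hJ0, hσ]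
      have := (one_div_lt b8 (by linarith [div_pos hL hJ0])).2 hμ₁
      linarith
    have hf0 := hb.pos hL he.sum_gt zero_mem_closedQuadrant
    -- The value at the origin lies between `L/(2σ)` and `K/σ`, so in the quotient `a f(p)/f(0,0)`
    -- the factors `1/σ` cancel and the bounds for `ψ` are uniform in `μ`.
    obtain ⟨l1, l2⟩ := hbr _ zero_mem_closedQuadrant
    have hj0 : jap (0, 0) ^ (-σ) = 1 := by simp [jap]
    rw [hj0, mul_one] at l1 l2
    rw [hJ, hσ] at hσJ
    refine ⟨hb.memA0 hd ha hμ hK hL (hs.contDiff_radial hd he).continuous.continuousOn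
      (hs.contDiffOn_radial hd he) hσJ, fun p hp => ?_, fun p hp => ?_⟩
    · rw [e1, profile, div_mul_eq_mul_div, le_div_iff₀ hf0]
      have h1 : K / (a * L) ≤ M'' ^ 2 := le_trans (by rw [hM]; linarith) hMsq
      rw [div_le_iff₀ (by positivity)] at h1
      have h2 := hjpos p
      have h3 : (2 * M'' ^ 2)⁻¹ * (K / σ) ≤ a * (L / 2 / σ) := by
        rw [inv_mul_le_iff₀ (by positivity)]
        calc K / σ ≤ M'' ^ 2 * (a * L) / σ := by gcongr
          _ = _ := by ring
      calc _ ≤ (2 * M'' ^ 2)⁻¹ * jap p ^ (-σ) * (K / σ) := by gcongr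
        _ = (2 * M'' ^ 2)⁻¹ * (K / σ) * jap p ^ (-σ) := by ring
        _ ≤ a * (L / 2 / σ) * jap p ^ (-σ) := by gcongr
        _ = a * (L / 2 / σ * jap p ^ (-σ)) := by ring
        _ ≤ _ := by gcongr; exact (hbr p hp).1
    · rw [e1, profile, div_mul_eq_mul_div, div_le_iff₀ hf0]
      have h1 : K / L ≤ M'' ^ 2 := le_trans (by rw [hM]; linarith) hMsq
      rw [div_le_iff₀ hL] at h1
      have h2 := hjpos p
      have h3 : a * (K / σ) ≤ 2 * M'' ^ 2 * (L / 2 / σ) := by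
        calc a * (K / σ) ≤ 1 * (M'' ^ 2 * L / σ) := by gcongr; linarith
          _ = _ := by ring
      calc _ ≤ a * (K / σ * jap p ^ (-σ)) := by gcongr; exact (hbr p hp).2
        _ = a * (K / σ) * jap p ^ (-σ) := by ring
        _ ≤ 2 * M'' ^ 2 * (L / 2 / σ) * jap p ^ (-σ) := by gcongr
        _ = 2 * M'' ^ 2 * jap p ^ (-σ) * (L / 2 / σ) := by ring
        _ ≤ _ := by gcongr
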